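/- Let $\alpha\in\,]0,1[$, let $\vec\Lambda\subset\mathbb C$ be a $\mathbb Z$-lattice (a discrete additive subgroup generating $\mathbb C$ as a real vector space), with covolume $\mathrm{covol}$ and systole $\mathrm{sys}=\min\{|p| : p\in\vec\Lambda,\ p\ne 0\}$, and let $\Lambda=z_0+\vec\Lambda$, with $z_0\in\mathbb C$, be a $\mathbb Z$-grid. Let $\varphi:\mathbb N\to\,]0,+\infty[$ tend to $+\infty$ with $\varphi(N)/N^{1-\alpha}\to\lambda\in[0,+\infty]$, and let $\psi(N)=\big(N^{2-\alpha}/\varphi(N)\big)^2$. For $N,N',N''\in\mathbb N$ consider $$\mathcal R_{N,N',N''}=\frac{1}{(N'+N'')\,\psi(N)}\sum_{\substack{m,n\in\Lambda,\ n\neq m\\ 0<|m|,|n|\le N}}\ \sum_{\substack{r\in\exp^{-1}(m),\ s\in\exp^{-1}(n)\\ |\Im r-\Im s|<2\pi\\ -2\pi N'\le \Im r,\,\Im s<2\pi N''}}\Delta_{\varphi(N)(\exp(\alpha s)-\exp(\alpha r))},$$ where $\Delta_z$ is the Dirac mass at $z$ (this is the empirical pair correlation measure of the $\alpha$-powers of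 the points of $\exp^{-1}(\Lambda)$, where $\exp:\mathbb C\to\mathbb C^*$ is identified with the helicoid by $r\mapsto(\exp r,\Im r)$). Let $$\rho(z)=\begin{cases}0&\text{if }\lambda=+\infty,\\[1mm] \dfrac{\pi}{\alpha^2(2-\alpha)\,\mathrm{covol}^2}&\text{if }\lambda=0,\\[3mm] \dfrac{\alpha^{\frac{2}{1-\alpha}}}{(1-\alpha)\,\mathrm{covol}}\Big(\dfrac{|z|}{\lambda}\Big)^{-\frac{4-2\alpha}{1-\alpha}}\displaystyle\sum_{p\in\vec\Lambda,\ |p|\le\frac{|z|}{\alpha\lambda}}|p|^{\frac{2}{1-\alpha}}&\text{if }0<\lambda<+\infty\end{cases}$$ (with $\rho(0)=0$ in the last case). (1) As $\min\{N,N'+N''\}\to\infty$, the measures $\mathcal R_{N,N',N''}$ converge vaguely to $\rho\,\mathrm{Leb}_{\mathbb C}$: these measures are locally finite, and for every continuous $f:\mathbb C\to\mathbb C$ with compact support, $\mathcal R_{N,N',N''}(f)\to\int_{\mathbb C} f(z)\rho(z)\,dz$. (2) (Level repulsion) If $0<\lambda<+\infty$, then $\rho=0$ on the open disk $D(0,\alpha\lambda\,\mathrm{sys})$,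 whose radius is positive. (3) (Error term) There is a constant $C>0$ depending only on $\alpha$ and $\Lambda$ such that for all $\varphi,\lambda$ as above and all $A>1$ there is an integer $M$ (depending on $\alpha,\Lambda,\varphi,\lambda,A$) such that for every $C^1$ function $f:\mathbb C\to\mathbb C$ with compact support contained in the open disk $D(0,A)$ and all $N,N',N''\in\mathbb N$ with $\min\{N,N'+N''\}\ge M$, $$\Big|\mathcal R_{N,N',N''}(f)-\int_{\mathbb C} f(z)\rho(z)\,dz\Big|\le C\,(E_1+E_2),$$ where $E_1=E_2=0$ if $\lambda=+\infty$ and otherwise, writing $\|f\|_{C^1}=\|f\|_\infty+\|df\|_\infty$, $$E_1=\begin{cases}A^4\|f\|_{C^1}\Big(\dfrac{\varphi(N)}{N^{1-\alpha}}+\dfrac{1}{N^\alpha\varphi(N)}+\dfrac1{N'+N''}\Big)&\text{if }\lambda=0,\\[3mm] \|f\|_{C^1}\big(\lambda+\tfrac1\lambda\big)^{\frac{10-8\alpha}{1-\alpha}}\Big(A^{\frac{8-6\alpha}{1-\alpha}}\Big|\dfrac{\varphi(N)}{\lambda N^{1-\alpha}}-1\Big|+\dfrac{A^4}{N}+\dfrac{A^2}{N'+N''}\Big)&\text{if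 }0<\lambda<+\infty,\end{cases}$$ $$E_2=\frac{N}{(N'+N'')\,\psi(N)}\Big(\frac{A N^{1-\alpha}}{\varphi(N)}+1\Big)^3 .$$ -/

import Mathlib

open MeasureTheory Filter
open scoped ENNReal Topology

noncomputable section

namespace PairCorr

/-- `Λ` is a `ℤ`-grid of `ℂ` with underlying lattice `L`: a translate `z₀ + L`. -/
def IsGrid (L : Submodule ℤ ℂ) (Λ : Set ℂ) : Prop :=
  ∃ z₀ : ℂ, Λ = {w : ℂ | ∃ p ∈ L, w = z₀ + p}

/-- The scaling assumption: `φ : ℕ → ]0, ∞[` tends to infinity and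
`φ(N) / N^(1-α)` tends to `lam ∈ [0, ∞]`. -/
structure IsScaling (α : ℝ) (φ : ℕ → ℝ) (lam : ℝ≥0∞) : Prop where
  pos : ∀ N, 0 < φ N
  tendsto_atTop : Tendsto φ atTop atTop
  tendsto_ratio :
    Tendsto (fun N : ℕ => ENNReal.ofReal (φ N / (N : ℝ) ^ (1 - α))) atTop (𝓝 lam)

/-- The renormalization factor `ψ(N) = (N^(2-α) / φ(N))²`. -/
def renorm (α : ℝ) (φ : ℕ → ℝ) (N : ℕ) : ℝ :=
  ((N : ℝ) ^ (2 - α) / φ N) ^ 2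

/-- A point of the helicoid over `ℂ \ {0}` is a complex number `r` (a logarithm); it lies over
`exp r` and has height `Im r`. A logarithm `r` is admissible if it lies over a point of `Λ` of
modulus at most `N`, at height in `[-2πN', 2πN''[`. -/
def IsAdmissible (Λ : Set ℂ) (N N' N'' : ℕ) (r : ℂ) : Prop :=
  Complex.exp r ∈ Λ ∧ ‖Complex.exp r‖ ≤ N ∧
    -(2 * Real.pi * N') ≤ r.im ∧ r.im < 2 * Real.pi * N''

/-- The pairs `(r, s)` of admissible logarithms of distinct points `m = exp r`, `n = exp s`
of the grid, whose heights differ by less than `2π`. -/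
def pairSet (Λ : Set ℂ) (N N' N'' : ℕ) : Set (ℂ × ℂ) :=
  {q | IsAdmissible Λ N N' N'' q.1 ∧ IsAdmissible Λ N N' N'' q.2 ∧
    Complex.exp q.1 ≠ Complex.exp q.2 ∧ |q.1.im - q.2.im| < 2 * Real.pi}

/-- The empirical pair correlation measure `R_{N,N',N''}` of the `α`-powers: on the universal
cover, the `α`-power is `r ↦ α r`, with complex coordinate `exp (α r)`. -/
def empirical (α : ℝ) (Λ : Set ℂ) (φ : ℕ → ℝ) (N N' N'' : ℕ) : Measure ℂ :=
  ENNReal.ofReal (1 / (((N' : ℝ) + N'') * renorm α φ N)) •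
    Measure.sum (fun q : pairSet Λ N N' N'' =>
      Measure.dirac ((φ N : ℂ) *
        (Complex.exp (α * (q : ℂ × ℂ).2) - Complex.exp (α * (q : ℂ × ℂ).1))))

/-- The limit density `ρ_{α,L,lam}`. The sum runs over finitely many lattice points. -/
def density (α : ℝ) (L : Submodule ℤ ℂ) (lam : ℝ≥0∞) (z : ℂ) : ℝ :=
  if lam = ⊤ then 0
  else if lam = 0 then Real.pi / (α ^ 2 * (2 - α) * ZLattice.covolume L ^ 2)
  else α ^ (2 / (1 - α)) / ((1 - α) * ZLattice.covolume L) *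
    (‖z‖ / lam.toReal) ^ (-((4 - 2 * α) / (1 - α))) *
    ∑' p : {p : ℂ // p ∈ L ∧ ‖p‖ ≤ ‖z‖ / (α * lam.toReal)}, ‖(p : ℂ)‖ ^ (2 / (1 - α))

/-- The measure `ρ_{α,L,lam} Leb`. -/
def limitMeasure (α : ℝ) (L : Submodule ℤ ℂ) (lam : ℝ≥0∞) : Measure ℂ :=
  (volume : Measure ℂ).withDensity (fun z => ENNReal.ofReal (density α L lam z))

/-- The systole of a lattice. -/
def systole (L : Submodule ℤ ℂ) : ℝ :=
  sInf {x : ℝ | ∃ p ∈ L, p ≠ 0 ∧ x = ‖p‖}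

/-- Vague convergence of Radon (that is, on `ℂ`, locally finite) measures on `ℂ`. -/
def VagueTendsto {ι : Type*} (l : Filter ι) (μ : ι → Measure ℂ) (ν : Measure ℂ) : Prop :=
  (∀ i, IsLocallyFiniteMeasure (μ i)) ∧ IsLocallyFiniteMeasure ν ∧
    ∀ f : ℂ → ℂ, Continuous f → HasCompactSupport f →
      Tendsto (fun i => ∫ z, f z ∂(μ i)) l (𝓝 (∫ z, f z ∂ν))

/-- The filter `min {N, N' + N''} → ∞` on triples `(N, N', N'')`. -/
def minFilter : Filter (ℕ × ℕ × ℕ) :=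
  comap (fun q => min q.1 (q.2.1 + q.2.2)) atTop

/-- The size `‖f‖_∞ + ‖df‖_∞` of a `C¹` function with compact support. -/
def c1Norm (f : ℂ → ℂ) : ℝ :=
  (⨆ z, ‖f z‖) + ⨆ z, ‖fderiv ℝ f z‖

/-- The error term of the level separated correlations, without the implied constant. -/
def levelError (α : ℝ) (φ : ℕ → ℝ) (lam : ℝ≥0∞) (f : ℂ → ℂ) (A : ℝ) (N N' N'' : ℕ) : ℝ :=
  if lam = ⊤ then 0
  else if lam = 0 then
    A ^ 4 * c1Norm f *
      (φ N / (N : ℝ) ^ (1 - α) + 1 / ((N : ℝ) ^ α * φ N) + 1 / ((N' : ℝ) + N''))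
  else
    c1Norm f * (lam.toReal + 1 / lam.toReal) ^ ((10 - 8 * α) / (1 - α)) *
      (A ^ ((8 - 6 * α) / (1 - α)) * |φ N / (lam.toReal * (N : ℝ) ^ (1 - α)) - 1|
        + A ^ 4 / N + A ^ 2 / ((N' : ℝ) + N''))

/-- The error term due to the pairs that cross the branch cut, without the implied constant. -/
def branchCutError (α : ℝ) (φ : ℕ → ℝ) (lam : ℝ≥0∞) (A : ℝ) (N N' N'' : ℕ) : ℝ :=
  if lam = ⊤ then 0
  else (N : ℝ) / (((N' : ℝ) + N'') * renorm α φ N) *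
    (A * (N : ℝ) ^ (1 - α) / φ N + 1) ^ 3

end PairCorr

end

/-! Write `τ = φ(N)/N^(1-α)`, `H = N' + N''`, `V` for the covolume, and let `f` be a test function
supported in the disk of radius `A`. If a pair `(r, s)` contributes, then `exp (α s)` and `exp (α
r)` are at distance less than `A/φ(N)`. Because `α < 1` and the heights differ by less than `2π`,
this forces `s - r` itself to be small (`Regime.separation`). So the pair is given by a sheet `k`, a
grid point `m` and a non-zero lattice vector `p`, with `s` reached from `r` through the principal
logarithm of `(m + p)/m`, and `p` satisfies `‖p‖ ≤ P = 4A/(ατ)`. This turns the pair sum into a sum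
over `k`, `p` and `m` (`tsum_pairSet_eq`).

For fixed `k` and `p`, the difference of the powers is close to its linearization `α p z^(α-1)` at
any `z` in the cell of `m`. The sum over `m` becomes an integral over the plane
(`exists_cell_comparison`). The comparison fails only near the branch cut and near the circle of
radius `N`, a set of area `O(N(‖p‖ + d))`. Elsewhere the error is Lipschitz and of size `1/‖z‖`,
which is integrable (`norm_pairTerm_sub_modelTerm_le`). Pairs crossing the cut are absorbed in the
area estimate, so the level error alone bounds the difference and the branch cut error enters only
through its sign.

Summing the integrals over the sheets lets the angle run over an interval of length `2πH`. The
integrand has period `2π/(1-α)` in the angle, so it averages to a full circle with error `O(1/H)`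
after normalization (`norm_sum_modelTerm_sub_le`). What remains is `latticeSum`, namely `(τ²/V) ∑
diskAverage α f (τ p)` (`exists_core_estimate`).

The three regimes follow from this sum. If `τ → ∞`, no non-zero `p` is short enough and everything
vanishes. If `τ → 0`, it is a Riemann sum of mesh `τ` for `V⁻² ∫ diskAverage α f`, which Fubini
evaluates (`exists_latticeSum_sub_integral_le`). If `τ → lam` is finite and positive, the sum is
Lipschitz in `τ` (`exists_latticeSum_sub_le`), and its value at `lam` is exactly the integral of `f`
against the density (`integral_mul_density_eq_latticeSum`). Vague convergence then follows by `C¹`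
approximation. -/

noncomputable section

namespace PairCorr

/-! ### Lattice points: systole, comparison of sums with integrals, counting. -/

section Lattice

variable (L : Submodule ℤ ℂ) [DiscreteTopology L]

theorem finite_lattice_ball (R : ℝ) : {p : ℂ | p ∈ L ∧ ‖p‖ ≤ R}.Finite := by
  have : DiscreteTopology L.toAddSubgroup := ‹DiscreteTopology L›
  have hc : IsClosed (L : Set ℂ) := AddSubgroup.isClosed_of_discrete (H := L.toAddSubgroup)
  have := Metric.finite_isBounded_inter_isClosed (K := Metric.closedBall (0 : ℂ) R)
    (s := (L : Set ℂ)) ⟨inferInstance⟩ Metric.isBounded_closedBall hc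
  refine this.subset ?_
  rintro p ⟨hp, hR⟩
  exact ⟨by simpa using hR, hp⟩

/-- The nonzero lattice points of norm at most `R`. -/
def puncturedBall (R : ℝ) : Finset ℂ :=
  Set.Finite.toFinset (s := {p : ℂ | p ∈ L ∧ p ≠ 0 ∧ ‖p‖ ≤ R})
    ((finite_lattice_ball L R).subset fun _ h => ⟨h.1, h.2.2⟩)

variable {L} in
theorem mem_puncturedBall {R : ℝ} {p : ℂ} :
    p ∈ puncturedBall L R ↔ p ∈ L ∧ p ≠ 0 ∧ ‖p‖ ≤ R := by
  simp [puncturedBall]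

omit [DiscreteTopology L] in
theorem systole_le {p : ℂ} (hp : p ∈ L) (h0 : p ≠ 0) : systole L ≤ ‖p‖ :=
  csInf_le ⟨0, by rintro x ⟨q, -, -, rfl⟩; positivity⟩ ⟨p, hp, h0, rfl⟩

theorem exists_mem_ne_zero [IsZLattice ℝ L] : ∃ p ∈ L, p ≠ 0 := by
  by_contra! h
  have h1 : (L : Set ℂ) ⊆ {0} := fun p hp => h p hp
  have h2 := IsZLattice.span_top (K := ℝ) (L := L)
  have h3 := Submodule.span_mono (R := ℝ) h1
  rw [h2, Submodule.span_zero_singleton, top_le_iff] at h3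
  exact bot_ne_top h3

theorem systole_pos [IsZLattice ℝ L] : 0 < systole L := by
  obtain ⟨p, hp, h0⟩ := exists_mem_ne_zero L
  have hne : (puncturedBall L ‖p‖).Nonempty := ⟨p, mem_puncturedBall.2 ⟨hp, h0, le_rfl⟩⟩
  obtain ⟨q, hq, hmin⟩ := Finset.exists_min_image _ (fun p => ‖p‖) hne
  have hq' := mem_puncturedBall.1 hq
  refine lt_of_lt_of_le (norm_pos_iff.2 hq'.2.1) (le_csInf ⟨_, p, hp, h0, rfl⟩ ?_)
  rintro x ⟨r, hr, hr0, rfl⟩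
  rcases le_total ‖r‖ ‖p‖ with h | h
  · exact hmin r (mem_puncturedBall.2 ⟨hr, hr0, h⟩)
  · exact hq'.2.2.trans h

open scoped Pointwise in
/-- Comparison of a sum over a translate of a lattice with an integral. -/
theorem exists_cell_comparison [IsZLattice ℝ L] : ∃ d : ℝ, 0 < d ∧
    ∀ (z₀ : ℂ) (G g : ℂ → ℂ) (E : ℂ → ℝ), Integrable g → Integrable E →
      {l : L | G (z₀ + l) ≠ 0}.Finite →
      (∀ (l : L) (z : ℂ), ‖z - (z₀ + l)‖ ≤ d → ‖G (z₀ + l) - g z‖ ≤ E z) →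
      ‖(ZLattice.covolume L : ℂ) * ∑' l : L, G (z₀ + l) - ∫ z, g z‖ ≤ ∫ z, E z := by
  have : MeasurableVAdd L ℂ := (inferInstance : MeasurableVAdd L.toAddSubgroup ℂ)
  have : VAddInvariantMeasure L ℂ (volume : Measure ℂ) :=
    (inferInstance : VAddInvariantMeasure L.toAddSubgroup ℂ volume)
  let b := Module.Free.chooseBasis ℤ L
  let F := ZSpan.fundamentalDomain (b.ofZLatticeBasis ℝ L)
  have hF : IsAddFundamentalDomain L F (volume : Measure ℂ) := ZLattice.isAddFundamentalDomain b _
  have hFm : MeasurableSet F := ZSpan.fundamentalDomain_measurableSet _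
  have hcov : ∀ l : L, (volume : Measure ℂ).real (l +ᵥ F) = ZLattice.covolume L := by
    intro l
    rw [ZLattice.covolume_eq_measure_fundamentalDomain L volume hF, measureReal_def,
      measureReal_def, measure_vadd]
  obtain ⟨d, hd0, hd⟩ := (ZSpan.fundamentalDomain_isBounded (b.ofZLatticeBasis ℝ L)).exists_pos_norm_le
  refine ⟨d, hd0, fun z₀ G g E hg hE hfin hGE => ?_⟩
  have hg' : Integrable (fun z => g (z₀ + z)) := hg.comp_add_left z₀
  have hE' : Integrable (fun z => E (z₀ + z)) := hE.comp_add_left z₀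
  have hsg : HasSum (fun l : L => ∫ z in (l +ᵥ F), g (z₀ + z)) (∫ z, g z) := by
    rw [← integral_add_left_eq_self g z₀]
    have := hasSum_integral_measure (μ := fun l : L => (volume : Measure ℂ).restrict (l +ᵥ F))
      (f := fun z => g (z₀ + z)) (by rw [hF.sum_restrict]; exact hg')
    rwa [hF.sum_restrict] at this
  have hsE : HasSum (fun l : L => ∫ z in (l +ᵥ F), E (z₀ + z)) (∫ z, E z) := by
    rw [← integral_add_left_eq_self E z₀]
    have := hasSum_integral_measure (μ := fun l : L => (volume : Measure ℂ).restrict (l +ᵥ F))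
      (f := fun z => E (z₀ + z)) (by rw [hF.sum_restrict]; exact hE')
    rwa [hF.sum_restrict] at this
  have hsG : Summable (fun l : L => G (z₀ + l)) := summable_of_hasFiniteSupport hfin
  have key := (hsG.hasSum.mul_left (ZLattice.covolume L : ℂ)).sub hsg
  rw [← key.tsum_eq]
  -- The cells `l +ᵥ F` tile the plane and all have area the covolume, so the comparison is made
  -- cell by cell: the term at `l` is the integral of a constant over its cell.
  refine tsum_of_norm_bounded hsE fun l => ?_
  have hvol : volume ((l +ᵥ F : Set ℂ)) < ⊤ := by
    rw [measure_vadd]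
    exact (ZSpan.fundamentalDomain_isBounded _).measure_lt_top
  have h1 : (ZLattice.covolume L : ℂ) * G (z₀ + l) = ∫ z in (l +ᵥ F), G (z₀ + l) := by
    rw [setIntegral_const, hcov]; simp
  have hi : IntegrableOn (fun _ : ℂ => G (z₀ + l)) (l +ᵥ F) := integrableOn_const hvol.ne
  rw [h1, ← integral_sub hi hg'.integrableOn]
  refine norm_integral_le_of_norm_le hE'.integrableOn ?_
  refine (ae_restrict_iff' (hFm.const_vadd l)).2 (ae_of_all _ ?_)
  rintro _ ⟨y, hy, rfl⟩
  refine hGE l _ ?_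
  have : z₀ + (l +ᵥ y) - (z₀ + l) = y := by
    change z₀ + ((l : ℂ) + y) - _ = _; ring
  rw [this]
  exact hd _ hy

/-- Each counted point owns a cell inside the disk of radius `R + d`. Leaving out the origin allows
a purely quadratic bound: below the systole nothing is counted, and above it `d ≤ (d / systole L) *
R`. -/
theorem exists_card_puncturedBall_le [IsZLattice ℝ L] : ∃ C : ℝ, 0 < C ∧ ∀ R : ℝ, 0 ≤ R →
    ((puncturedBall L R).card : ℝ) ≤ C * R ^ 2 := by
  obtain ⟨d, hd0, hd⟩ := exists_cell_comparison L
  have hs := systole_pos L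
  have hc := ZLattice.covolume_pos L volume
  refine ⟨Real.pi * (1 + d / systole L) ^ 2 / ZLattice.covolume L, by positivity, fun R hR => ?_⟩
  rcases lt_or_ge R (systole L) with h | h
  · have : puncturedBall L R = ∅ := by
      refine Finset.eq_empty_of_forall_notMem fun p hp => ?_
      have hp := mem_puncturedBall.1 hp
      linarith [systole_le L hp.1 hp.2.1]
    rw [this]; simp; positivity
  have h1 := hd 0 (fun p => if p ∈ puncturedBall L R then 1 else 0) 0
    (Set.indicator (Metric.closedBall 0 (R + d)) 1) (integrable_zero _ _ _)
    ((integrable_indicator_iff measurableSet_closedBall).2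
      (integrableOn_const (Metric.isBounded_closedBall.measure_lt_top.ne))) (by
      refine Set.Finite.of_finite_image (f := fun l : L => (l : ℂ))
        ((puncturedBall L R).finite_toSet.subset ?_) Subtype.val_injective.injOn
      rintro _ ⟨l, hl, rfl⟩
      simpa using hl) (by
      intro l z hz
      by_cases hl : (l : ℂ) ∈ puncturedBall L R
      · have : z ∈ Metric.closedBall (0 : ℂ) (R + d) := by
          have h2 := (mem_puncturedBall.1 hl).2.2
          simp only [zero_add] at hz
          rw [mem_closedBall_zero_iff]
          calc ‖z‖ = ‖(l : ℂ) + (z - l)‖ := by congr 1; ring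
            _ ≤ _ := (norm_add_le _ _).trans (add_le_add h2 hz)
        simp [hl, this]
      · simp only [zero_add, hl, if_false, Pi.zero_apply, sub_zero, norm_zero]
        exact Set.indicator_nonneg (by simp) _)
  have h2 : ∑' l : L, (if (0 + (l : ℂ)) ∈ puncturedBall L R then (1 : ℂ) else 0)
      = (puncturedBall L R).card := by
    have hinj : Function.Injective (fun l : L => (l : ℂ)) := Subtype.val_injective
    have := hinj.tsum_eq (f := fun p : ℂ => if p ∈ puncturedBall L R then (1 : ℂ) else 0) (by
      intro p hp
      have : p ∈ puncturedBall L R := by by_contra h; simp [h] at hp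
      exact ⟨⟨p, (mem_puncturedBall.1 this).1⟩, rfl⟩)
    simp only [zero_add]
    rw [this, tsum_eq_sum (s := puncturedBall L R) (by intro b hb; simp [hb])]
    simp
  rw [h2, integral_indicator measurableSet_closedBall] at h1
  simp only [Pi.zero_apply, integral_zero, sub_zero, Pi.one_apply, integral_const, smul_eq_mul,
    mul_one, measureReal_restrict_apply MeasurableSet.univ, Set.univ_inter, norm_mul,
    Complex.norm_real, Complex.norm_natCast, measureReal_def, Complex.volume_closedBall] at h1
  rw [Real.norm_of_nonneg hc.le] at h1
  simp only [ENNReal.toReal_mul, ENNReal.toReal_pow, ENNReal.coe_toReal, NNReal.coe_real_pi] at h1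
  rw [ENNReal.toReal_ofReal (by positivity)] at h1
  have h3 : R + d ≤ (1 + d / systole L) * R := by
    have : d ≤ d / systole L * R := by
      rw [div_mul_eq_mul_div, le_div_iff₀ hs]
      gcongr
    linarith
  calc ((puncturedBall L R).card : ℝ) ≤ (R + d) ^ 2 * Real.pi / ZLattice.covolume L := by
        rw [le_div_iff₀ hc]; linarith
    _ ≤ ((1 + d / systole L) * R) ^ 2 * Real.pi / ZLattice.covolume L := by gcongr
    _ = _ := by ring

end Lattice

/-! ### Branches of the logarithm and local expansion of the power. -/

section Logarithms

/-- The branch of the logarithm with imaginary part in `[0, 2π[`. -/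
def logPos (z : ℂ) : ℂ :=
  (starRingEnd ℂ) (Complex.log (-(starRingEnd ℂ) z)) + Real.pi * Complex.I

theorem exp_logPos {z : ℂ} (hz : z ≠ 0) : Complex.exp (logPos z) = z := by
  rw [logPos, Complex.exp_add, Complex.exp_pi_mul_I, Complex.exp_conj, Complex.exp_log]
  · simp
  · simpa using hz

theorem im_logPos (z : ℂ) : (logPos z).im = Real.pi - Complex.arg (-(starRingEnd ℂ) z) := by
  simp [logPos, Complex.log_im]; ring

theorem im_logPos_nonneg (z : ℂ) : 0 ≤ (logPos z).im := by
  rw [im_logPos]; linarith [Complex.arg_le_pi (-(starRingEnd ℂ) z)]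

theorem im_logPos_lt (z : ℂ) : (logPos z).im < 2 * Real.pi := by
  rw [im_logPos]; linarith [Complex.neg_pi_lt_arg (-(starRingEnd ℂ) z)]

theorem measurable_logPos : Measurable logPos := by
  unfold logPos
  have h1 : Measurable (starRingEnd ℂ) := Complex.continuous_conj.measurable
  exact (h1.comp (Complex.measurable_log.comp h1.neg)).add_const _

theorem eq_of_exp_eq_of_im_lt {r s : ℂ} (h : Complex.exp r = Complex.exp s)
    (him : |r.im - s.im| < 2 * Real.pi) : r = s := by
  obtain ⟨n, hn⟩ := Complex.exp_eq_exp_iff_exists_int.1 h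
  have h1 : r.im - s.im = n * (2 * Real.pi) := by rw [hn]; simp
  rw [h1, abs_mul, abs_of_pos Real.two_pi_pos] at him
  have h2 : |(n : ℝ)| < 1 := by
    by_contra! h
    nlinarith [Real.two_pi_pos]
  have h3 : n = 0 := by
    rw [← Int.abs_lt_one_iff]; exact_mod_cast h2
  simpa [h3] using hn

theorem logPos_unique {r z : ℂ} (h : Complex.exp r = z) (h0 : 0 ≤ r.im)
    (h1 : r.im < 2 * Real.pi) : r = logPos z := by
  have hz : z ≠ 0 := h ▸ Complex.exp_ne_zero r
  refine eq_of_exp_eq_of_im_lt (h.trans (exp_logPos hz).symm) ?_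
  rw [abs_lt]
  constructor <;> linarith [im_logPos_nonneg z, im_logPos_lt z]

theorem im_eq_norm_mul_sin {z : ℂ} (hz : z ≠ 0) : z.im = ‖z‖ * Real.sin (logPos z).im := by
  conv_lhs => rw [← exp_logPos hz]
  rw [Complex.exp_im, ← Complex.norm_exp, exp_logPos hz]

/-- Away from the positive real axis, `logPos` is locally given by the principal logarithm. -/
theorem logPos_eq_add_log {y z : ℂ} {D : ℝ} (hD : 2 * D ≤ ‖z‖) (hy : ‖y - z‖ ≤ D)
    (him : 2 * D < |z.im|) : logPos y = logPos z + Complex.log (y / z) := by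
  have hz : z ≠ 0 := by
    rintro rfl
    have : 0 ≤ D := (norm_nonneg _).trans hy
    simp at him; linarith
  have hzn : 0 < ‖z‖ := norm_pos_iff.2 hz
  have hyz : y / z - 1 = (y - z) / z := by field_simp
  have hx : ‖y / z - 1‖ ≤ D / ‖z‖ := by rw [hyz, norm_div]; gcongr
  have hD0 : 0 ≤ D := (norm_nonneg _).trans hy
  have hD2 : D / ‖z‖ ≤ 1 / 2 := by rw [div_le_iff₀ hzn]; linarith
  set x := y / z with hxdef
  have hxn : 1 / 2 ≤ ‖x‖ := by
    have := norm_sub_norm_le (1 : ℂ) (1 - x)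
    rw [sub_sub_cancel, norm_one, norm_sub_rev] at this
    linarith
  have hx0 : x ≠ 0 := norm_pos_iff.1 (by linarith)
  have hy0 : y ≠ 0 := by
    rintro rfl; exact hx0 (by simp [hxdef])
  have hre : 0 < x.re := by
    have := (abs_le.1 ((Complex.abs_re_le_norm (x - 1)).trans (hx.trans hD2))).1
    simp at this; linarith
  have harg := (Complex.abs_arg_lt_pi_div_two_iff).2 (Or.inl hre)
  have hsin : |Real.sin x.arg| ≤ 2 * D / ‖z‖ := by
    rw [Complex.sin_arg, abs_div, abs_norm, div_le_iff₀ (by linarith)]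
    have h1 : |x.im| ≤ D / ‖z‖ := by
      have := (Complex.abs_im_le_norm (x - 1)).trans hx
      simpa using this
    have h2 : 0 ≤ D / ‖z‖ := by positivity
    rw [mul_div_assoc]; nlinarith
  have himz := im_eq_norm_mul_sin hz
  have hth : 2 * D / ‖z‖ < |Real.sin (logPos z).im| := by
    rw [himz, abs_mul, abs_norm] at him
    rw [div_lt_iff₀ hzn]; linarith
  have hexp : Complex.exp (logPos z + Complex.log x) = y := by
    rw [Complex.exp_add, exp_logPos hz, Complex.exp_log hx0, hxdef]; field_simp
  refine (logPos_unique hexp ?_ ?_).symm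
  -- If the sum of the arguments left `[0, 2π[` on either side, the argument of `z` would be closer
  -- to the cut than that of `x`, contradicting `|sin (arg x)| ≤ 2D/‖z‖ < |sin (arg z)|` by
  -- monotonicity of the sine on `[-π/2, π/2]`.
  · by_contra! h
    rw [Complex.add_im, Complex.log_im] at h
    have h0 := im_logPos_nonneg z
    have ha := (abs_lt.1 harg).1
    have h1 : Real.sin (logPos z).im ≤ Real.sin (-x.arg) :=
      Real.sin_le_sin_of_le_of_le_pi_div_two (by linarith [Real.pi_pos]) (by linarith) (by linarith)
    have h2 : 0 ≤ Real.sin (logPos z).im := Real.sin_nonneg_of_nonneg_of_le_pi h0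
      (by linarith [Real.pi_pos])
    rw [abs_of_nonneg h2] at hth
    rw [Real.sin_neg] at h1
    linarith [neg_abs_le (Real.sin x.arg)]
  · by_contra! h
    rw [Complex.add_im, Complex.log_im] at h
    have h0 := im_logPos_lt z
    have ha := (abs_lt.1 harg).2
    have h1 : Real.sin (2 * Real.pi - (logPos z).im) ≤ Real.sin x.arg :=
      Real.sin_le_sin_of_le_of_le_pi_div_two (by linarith [Real.pi_pos]) (by linarith) (by linarith)
    have h2 : 0 ≤ Real.sin (2 * Real.pi - (logPos z).im) := Real.sin_nonneg_of_nonneg_of_le_pi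
      (by linarith) (by linarith [Real.pi_pos])
    rw [Real.sin_two_pi_sub] at h1 h2
    rw [abs_of_nonpos (by linarith)] at hth
    linarith [le_abs_self (Real.sin x.arg)]

/-- First order expansion of `(1 + x) ^ α` near `x = 0`. -/
theorem norm_one_add_cpow_sub_le {α : ℝ} (h0 : 0 < α) (h1 : α < 1) {x y : ℂ} {ρ : ℝ}
    (hρ : ρ ≤ 1 / 2) (hx : ‖x‖ ≤ ρ) (hy : ‖y‖ ≤ ρ) :
    ‖Complex.exp (α * Complex.log (1 + y)) - Complex.exp (α * Complex.log (1 + x))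
      - α * (y - x)‖ ≤ 3 * ρ * ‖y - x‖ := by
  have key := Convex.norm_image_sub_le_of_norm_hasDerivWithin_le (𝕜 := ℂ)
    (f := fun x => Complex.exp (α * Complex.log (1 + x)) - α * x)
    (f' := fun x => Complex.exp (α * Complex.log (1 + x)) * (α * (1 / (1 + x))) - α)
    (s := Metric.closedBall (0 : ℂ) ρ) (x := x) (y := y) (C := 3 * ρ) ?_ ?_
    (convex_closedBall _ _) (by simpa using hx) (by simpa using hy)
  · have h (a b : ℂ) : a - b - α * (y - x) = a - α * y - (b - α * x) := by ring
    rw [h]; exact key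
  · intro z hz
    rw [mem_closedBall_zero_iff] at hz
    have hs : 1 + z ∈ Complex.slitPlane := Complex.mem_slitPlane_of_norm_lt_one (by linarith)
    refine HasDerivAt.hasDerivWithinAt ?_
    have h2 : HasDerivAt (fun x : ℂ => 1 + x) 1 z := (hasDerivAt_id z).const_add 1
    have h3 := ((h2.clog hs).const_mul (α : ℂ)).cexp
    have h4 := (hasDerivAt_id z).const_mul (α : ℂ)
    rw [mul_one] at h4
    exact h3.sub h4
  · intro z hz
    rw [mem_closedBall_zero_iff] at hz
    have hs : 1 + z ∈ Complex.slitPlane := Complex.mem_slitPlane_of_norm_lt_one (by linarith)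
    have hne := Complex.slitPlane_ne_zero hs
    -- The derivative of `(1 + z)^α - α z` is `α ((1 + z)^(α-1) - 1)`, which is `O(ρ)` on the ball;
    -- the mean value inequality then concludes.
    have h5 : Complex.exp (α * Complex.log (1 + z)) * (α * (1 / (1 + z))) - α
        = α * (Complex.exp ((α - 1) * Complex.log (1 + z)) - 1) := by
      rw [sub_mul, Complex.exp_sub, one_mul, Complex.exp_log hne]; field_simp
    have hl := Complex.norm_log_one_add_half_le_self (z := z) (by linarith)
    have h6 : ‖((α : ℂ) - 1) * Complex.log (1 + z)‖ ≤ 3 / 2 * ρ := by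
      rw [norm_mul]
      have : ‖(α : ℂ) - 1‖ ≤ 1 := by
        rw [← Complex.ofReal_one, ← Complex.ofReal_sub, Complex.norm_real, Real.norm_eq_abs,
          abs_le]; constructor <;> linarith
      calc _ ≤ 1 * (3 / 2 * ‖z‖) := by gcongr
        _ ≤ _ := by linarith
    rw [h5, norm_mul, Complex.norm_real, Real.norm_of_nonneg h0.le]
    have h7 := Complex.norm_exp_sub_one_le (h6.trans (by linarith))
    have h8 := norm_nonneg (Complex.exp (((α : ℂ) - 1) * Complex.log (1 + z)) - 1)
    nlinarith

/-- On the helicoid, `exp (α w)` is close to `1` only if `w` is close to `0`. -/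
theorem norm_le_of_norm_exp_mul_sub_one_lt {α η : ℝ} (h0 : 0 < α)
    (hη : η ≤ 1 / 2) (hη1 : η ≤ 1 - α) {w : ℂ} (him : |w.im| < 2 * Real.pi)
    (hw : ‖Complex.exp (α * w) - 1‖ < η) : ‖w‖ ≤ 2 * η / α := by
  set x := Complex.exp (α * w) - 1 with hx
  have hl := Complex.norm_log_one_add_half_le_self (z := x) (by linarith)
  have hexp : Complex.exp (α * w) = Complex.exp (Complex.log (1 + x)) := by
    rw [Complex.exp_log, hx, add_sub_cancel]
    rw [hx, add_sub_cancel]; exact Complex.exp_ne_zero _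
  -- The imaginary parts differ by at most `2πα + (3/2)(1 - α) < 2π`. The gap `1 - α` is what
  -- excludes another determination of the logarithm.
  have him' : |(α * w : ℂ).im - (Complex.log (1 + x)).im| < 2 * Real.pi := by
    have h1 := Complex.abs_im_le_norm (Complex.log (1 + x))
    have h2 : |(α * w : ℂ).im| ≤ α * (2 * Real.pi) := by
      rw [Complex.im_ofReal_mul, abs_mul, abs_of_pos h0]
      gcongr
    have h3 := abs_sub (α * w : ℂ).im (Complex.log (1 + x)).im
    have h4 : 0 < 1 - α := lt_of_lt_of_le ((norm_nonneg x).trans_lt hw) hη1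
    have h5 : 0 < (1 - α) * (Real.pi - 3) := mul_pos h4 (by linarith [Real.pi_gt_three])
    nlinarith
  have h := eq_of_exp_eq_of_im_lt hexp him'
  rw [le_div_iff₀ h0]
  have : ‖(α : ℂ) * w‖ = ‖w‖ * α := by
    rw [norm_mul, Complex.norm_real, Real.norm_of_nonneg h0.le, mul_comm]
  rw [← this, h]
  linarith [norm_nonneg x]

end Logarithms

/-! ### Comparison of one pair with its linearization. -/

section Pointwise

/-- The scaling `φ` is large in terms of the support radius `A`, the minimal distance `s` between
grid points, the minimal norm `c` of a nonzero grid point and the cell diameter `d`. -/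
structure Regime (α A s c d φ : ℝ) : Prop where
  α_pos : 0 < α
  α_lt : α < 1
  A_pos : 0 < A
  s_pos : 0 < s
  c_pos : 0 < c
  d_pos : 0 < d
  φ_pos : 0 < φ
  sep_half : A / (φ * c ^ α) ≤ 1 / 2
  sep_one_sub : A / (φ * c ^ α) ≤ 1 - α
  sep_quarter : A / (φ * c ^ α) ≤ α / 4
  small : A / (α * φ) ≤ 1 / 64
  far : (16 * d + 1) ^ (1 - α) ≤ α * φ * s / (4 * A)

/-- A Lipschitz bounded function supported in the ball of radius `A`. -/
structure IsTest (A B₀ B₁ : ℝ) (f : ℂ → ℂ) : Prop where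
  eq_zero : ∀ z, A ≤ ‖z‖ → f z = 0
  norm_le : ∀ z, ‖f z‖ ≤ B₀
  lipschitz : ∀ x y, ‖f x - f y‖ ≤ B₁ * ‖x - y‖

/-- The logarithm of `z` on the `k`-th sheet of the helicoid. -/
def sheetLog (k : ℤ) (z : ℂ) : ℂ := logPos z + 2 * Real.pi * k * Complex.I

theorem exp_sheetLog (k : ℤ) {z : ℂ} (hz : z ≠ 0) : Complex.exp (sheetLog k z) = z := by
  have : (2 * Real.pi * k * Complex.I : ℂ) = k * (2 * Real.pi * Complex.I) := by ring
  rw [sheetLog, Complex.exp_add, exp_logPos hz, this, Complex.exp_int_mul_two_pi_mul_I, mul_one]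

theorem im_sheetLog (k : ℤ) (z : ℂ) : (sheetLog k z).im = (logPos z).im + 2 * Real.pi * k := by
  simp [sheetLog]

theorem measurable_sheetLog (k : ℤ) : Measurable (sheetLog k) := measurable_logPos.add_const _

open Classical in
/-- The contribution to the pair correlation of the grid point `m` on the sheet `k` and of the
translate of `m` by `p`, reached along the shortest path. -/
def pairTerm (α φ : ℝ) (f : ℂ → ℂ) (N N' N'' : ℕ) (k : ℤ) (p m : ℂ) : ℂ :=
  if m ≠ 0 ∧ m + p ≠ 0 ∧ ‖m‖ ≤ N ∧ ‖m + p‖ ≤ N ∧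
      -(2 * Real.pi * N') ≤ (sheetLog k m + Complex.log ((m + p) / m)).im ∧
      (sheetLog k m + Complex.log ((m + p) / m)).im < 2 * Real.pi * N'' then
    f (φ * (Complex.exp (α * (sheetLog k m + Complex.log ((m + p) / m)))
      - Complex.exp (α * sheetLog k m)))
  else 0

/-- The linearized contribution of the pair `(z, z + p)` on the sheet `k`. -/
def modelTerm (α φ : ℝ) (f : ℂ → ℂ) (N : ℕ) (k : ℤ) (p z : ℂ) : ℂ :=
  (Metric.closedBall 0 N \ {0} : Set ℂ).indicator
    (fun z => f (φ * (α * p * Complex.exp ((α - 1) * sheetLog k z)))) z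

/-- The points near the branch cut or near the boundary circle. -/
def badSet (N D : ℝ) : Set ℂ :=
  {z | |z.re| ≤ 2 * N ∧ |z.im| ≤ 2 * D} ∪ {z | N - D ≤ ‖z‖ ∧ ‖z‖ ≤ N + D}

/-- The pointwise error in the comparison of `pairTerm` and `modelTerm`. -/
def pointError (B₀ N D E : ℝ) (z : ℂ) : ℝ :=
  (badSet N D).indicator (fun _ => 2 * B₀) z
    + (Metric.closedBall (0 : ℂ) (2 * N)).indicator (fun z => E / ‖z‖) z

variable {α A s c d φ : ℝ}

theorem norm_exp_real_mul (a : ℝ) (r : ℂ) :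
    ‖Complex.exp (a * r)‖ = ‖Complex.exp r‖ ^ a := by
  rw [Complex.norm_exp, Complex.norm_exp, ← Real.exp_mul, Complex.re_ofReal_mul, mul_comm]

/-- Factoring out `exp (α r)`, of modulus `R^α`, gives `‖exp (α w) - 1‖ < η` with `η = A/(φ R^α)`,
hence `‖w‖ ≤ 2η/α`. Then `‖exp w - 1‖ ≤ 2‖w‖` turns this into the bound on the displacement. The
lower bound `c` makes `η` small uniformly in `R`. -/
theorem Regime.separation (h : Regime α A s c d φ) {r w : ℂ} (hr : c ≤ ‖Complex.exp r‖)
    (hw : |w.im| < 2 * Real.pi)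
    (hA : ‖(φ : ℂ) * (Complex.exp (α * (r + w)) - Complex.exp (α * r))‖ < A) :
    ‖w‖ ≤ 1 / 2 ∧
      φ * ‖Complex.exp (r + w) - Complex.exp r‖ * ‖Complex.exp r‖ ^ (α - 1) ≤ 4 * A / α := by
  obtain ⟨hα, hα1, hA0, hs, hc, hd, hφ, h1, h2, h3, -, -⟩ := h
  set R := ‖Complex.exp r‖ with hR
  have hR0 : 0 < R := hc.trans_le hr
  have hRα : 0 < R ^ α := Real.rpow_pos_of_pos hR0 _
  have hcα : 0 < c ^ α := Real.rpow_pos_of_pos hc _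
  have hη : A / (φ * R ^ α) ≤ A / (φ * c ^ α) := by gcongr
  have h4 : Complex.exp (α * (r + w)) - Complex.exp (α * r)
      = Complex.exp (α * r) * (Complex.exp (α * w) - 1) := by
    rw [mul_add, Complex.exp_add]; ring
  have h5 : ‖Complex.exp (α * w) - 1‖ < A / (φ * R ^ α) := by
    rw [h4, norm_mul, norm_mul, norm_exp_real_mul, Complex.norm_real, Real.norm_of_nonneg hφ.le]
      at hA
    rw [lt_div_iff₀ (by positivity)]
    linarith
  have h6 := norm_le_of_norm_exp_mul_sub_one_lt hα (hη.trans h1) (hη.trans h2) hw h5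
  have h7 : ‖w‖ ≤ 1 / 2 := by
    refine h6.trans ?_
    rw [div_le_iff₀ hα]; linarith
  refine ⟨h7, ?_⟩
  have h8 := Complex.norm_exp_sub_one_le (x := w) (by linarith)
  have h9 : Complex.exp (r + w) - Complex.exp r = Complex.exp r * (Complex.exp w - 1) := by
    rw [Complex.exp_add]; ring
  rw [h9, norm_mul, ← hR]
  have h10 : R * R ^ (α - 1) = R ^ α := by
    rw [Real.rpow_sub_one hR0.ne']; field_simp
  calc φ * (R * ‖Complex.exp w - 1‖) * R ^ (α - 1)
      = φ * R ^ α * ‖Complex.exp w - 1‖ := by rw [← h10]; ring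
    _ ≤ φ * R ^ α * (2 * (2 * (A / (φ * R ^ α)) / α)) := by gcongr; linarith
    _ = 4 * A / α := by field_simp; ring

/-- The hypothesis reads `α φ q ≤ 4A R^(1-α)`: since `q ≥ s` and `φ` is large, `R` must be large.
Once `R ≥ 1`, `R^(1-α) ≤ R`, and `q` is small compared with `R`. Contributing points therefore lie
far from the origin relative to `p` and to the cell diameter. -/
theorem Regime.far_of_le (h : Regime α A s c d φ) {R q : ℝ} (hR : 0 < R) (hq : s ≤ q)
    (hle : φ * q * R ^ (α - 1) ≤ 4 * A / α) : 16 * d + 1 ≤ R ∧ 16 * q ≤ R := by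
  obtain ⟨hα, hα1, hA0, hs, hc, hd, hφ, -, -, -, h1, h2⟩ := h
  have hR1 : 0 < R ^ (1 - α) := Real.rpow_pos_of_pos hR _
  have h3 : R ^ (α - 1) = (R ^ (1 - α))⁻¹ := by rw [← Real.rpow_neg hR.le]; congr 1; ring
  have h4 : α * φ * q ≤ 4 * A * R ^ (1 - α) := by
    rw [h3, ← div_eq_mul_inv, div_le_div_iff₀ hR1 hα] at hle
    linarith
  have h5 : 16 * d + 1 ≤ R := by
    have : (16 * d + 1) ^ (1 - α) ≤ R ^ (1 - α) := by
      refine h2.trans ?_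
      rw [div_le_iff₀ (by positivity)]
      calc α * φ * s ≤ α * φ * q := by gcongr
        _ ≤ _ := by linarith
    exact (Real.rpow_le_rpow_iff (by positivity) hR.le (by linarith)).1 this
  refine ⟨h5, ?_⟩
  have h6 : R ^ (1 - α) ≤ R := by
    conv_rhs => rw [← Real.rpow_one R]
    exact Real.rpow_le_rpow_of_exponent_le (by linarith) (by linarith)
  rw [div_le_iff₀ (by positivity)] at h1
  have h7 : 4 * A * R ^ (1 - α) ≤ 4 * A * R := by gcongr
  have h8 : 4 * A * R ≤ α * φ / 16 * R := by gcongr; linarith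
  have h9 : α * φ * (16 * q) ≤ α * φ * R := by linarith
  exact le_of_mul_le_mul_left h9 (by positivity)

variable {B₀ B₁ : ℝ} {f : ℂ → ℂ} {N N' N'' : ℕ} {k : ℤ} {p m z : ℂ}

theorem Regime.of_pairTerm_ne_zero (h : Regime α A s c d φ) (hf : IsTest A B₀ B₁ f)
    (hm : m ≠ 0 → c ≤ ‖m‖) (hne : pairTerm α φ f N N' N'' k p m ≠ 0) :
    m ≠ 0 ∧ ‖m‖ ≤ N ∧ φ * ‖p‖ * ‖m‖ ^ (α - 1) ≤ 4 * A / α := by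
  unfold pairTerm at hne
  rw [ite_ne_right_iff] at hne
  obtain ⟨⟨h1, h2, h3, h4, -, -⟩, h5⟩ := hne
  refine ⟨h1, h3, ?_⟩
  have h6 := h.separation (r := sheetLog k m) (w := Complex.log ((m + p) / m))
    (by rw [exp_sheetLog k h1]; exact hm h1)
    (by
      rw [Complex.log_im]
      linarith [Complex.abs_arg_le_pi ((m + p) / m), Real.pi_pos])
    (by by_contra! h'; exact h5 (hf.eq_zero _ h'))
  have h7 := h6.2
  rw [Complex.exp_add, exp_sheetLog k h1, Complex.exp_log (div_ne_zero h2 h1),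
    mul_div_cancel₀ _ h1, add_sub_cancel_left] at h7
  exact h7

theorem Regime.of_modelTerm_ne_zero (h : Regime α A s c d φ) (hf : IsTest A B₀ B₁ f)
    (hne : modelTerm α φ f N k p z ≠ 0) :
    z ≠ 0 ∧ ‖z‖ ≤ N ∧ φ * ‖p‖ * ‖z‖ ^ (α - 1) ≤ A / α := by
  unfold modelTerm at hne
  have hz := Set.mem_of_indicator_ne_zero hne
  rw [Set.indicator_of_mem hz] at hne
  obtain ⟨hz1, hz2⟩ := hz
  have hz2 : z ≠ 0 := hz2
  refine ⟨hz2, by simpa using hz1, ?_⟩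
  have h5 : ‖(φ : ℂ) * (α * p * Complex.exp ((α - 1) * sheetLog k z))‖ < A := by
    by_contra! h'; exact hne (hf.eq_zero _ h')
  rw [norm_mul, norm_mul, norm_mul, ← Complex.ofReal_one, ← Complex.ofReal_sub, norm_exp_real_mul,
    exp_sheetLog k hz2, Complex.norm_real, Complex.norm_real, Real.norm_of_nonneg h.φ_pos.le,
    Real.norm_of_nonneg h.α_pos.le] at h5
  rw [le_div_iff₀ h.α_pos]; linarith

theorem norm_pairTerm_le (hf : IsTest A B₀ B₁ f) : ‖pairTerm α φ f N N' N'' k p m‖ ≤ B₀ := by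
  unfold pairTerm
  split_ifs
  · exact hf.norm_le _
  · simpa using (norm_nonneg _).trans (hf.norm_le 0)

theorem norm_modelTerm_le (hf : IsTest A B₀ B₁ f) : ‖modelTerm α φ f N k p z‖ ≤ B₀ := by
  unfold modelTerm
  by_cases hz : z ∈ (Metric.closedBall 0 N \ {0} : Set ℂ)
  · rw [Set.indicator_of_mem hz]; exact hf.norm_le _
  · rw [Set.indicator_of_notMem hz]; simpa using (norm_nonneg _).trans (hf.norm_le 0)

/-- On the bad set the trivial bound `2 * B₀` suffices. Off it, `z`, `m` and `m + p` are on one side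
of the circle and no short path between them crosses the cut, so inside the disk their logarithms on
the sheet differ by principal logarithms of ratios close to `1`, and the power can be expanded at
`z`. -/
theorem norm_pairTerm_sub_modelTerm_le_of_far (h : Regime α A s c d φ) (hf : IsTest A B₀ B₁ f)
    (hk : -(N' : ℤ) ≤ k) (hk' : k < N'') (hB₁ : 0 ≤ B₁) (hp : p ≠ 0)
    (hzm : ‖z - m‖ ≤ d) (hD : 4 * (‖p‖ + d) ≤ ‖z‖) (hzN : ‖z‖ ≤ 2 * N)
    (hφ : φ * ‖p‖ * ‖z‖ ^ (α - 1) ≤ 8 * A / α) :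
    ‖pairTerm α φ f N N' N'' k p m - modelTerm α φ f N k p z‖ ≤
      pointError B₀ N (‖p‖ + d) (24 / α * (A * B₁ * (‖p‖ + d))) z := by
  have hB₀ : 0 ≤ B₀ := (norm_nonneg _).trans (hf.norm_le 0)
  have hα := h.α_pos
  have hA := h.A_pos
  have hd := h.d_pos
  have hp0 : 0 < ‖p‖ := norm_pos_iff.2 hp
  have hzn : 0 < ‖z‖ := by linarith
  set D := ‖p‖ + d with hDdef
  have h2 : 0 ≤ (Metric.closedBall (0 : ℂ) (2 * N)).indicator
      (fun z => 24 / α * (A * B₁ * D) / ‖z‖) z := Set.indicator_nonneg (fun _ _ => by positivity) _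
  by_cases hbad : z ∈ badSet N D
  · rw [pointError, Set.indicator_of_mem hbad]
    have := norm_sub_le (pairTerm α φ f N N' N'' k p m) (modelTerm α φ f N k p z)
    linarith [norm_pairTerm_le (α := α) (φ := φ) (N := N) (N' := N') (N'' := N'') (k := k)
      (p := p) (m := m) hf, norm_modelTerm_le (α := α) (φ := φ) (N := N) (k := k)
      (p := p) (z := z) hf]
  rw [pointError, Set.indicator_of_notMem hbad, zero_add, Set.indicator_of_mem (by simpa using hzN)]
  simp only [badSet, Set.mem_union, Set.mem_ofPred_eq, not_or, not_and, not_le] at hbad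
  have him := hbad.1 ((Complex.abs_re_le_norm z).trans hzN)
  have hzm' : ‖m - z‖ ≤ d := by rwa [norm_sub_rev]
  have hmz : ‖m + p - z‖ ≤ D := by
    calc ‖m + p - z‖ = ‖p + (m - z)‖ := by congr 1; ring
      _ ≤ _ := (norm_add_le _ _).trans (by rw [hDdef]; gcongr)
  have hm1 : ‖z‖ ≤ ‖m‖ + d := by
    have := norm_le_norm_add_norm_sub m z; linarith
  -- Outside the circle, being off the annulus means `‖z‖ > N + D`, so `m` is also outside and both
  -- terms vanish.
  rcases lt_or_ge (N : ℝ) ‖z‖ with hlt | hle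
  · have h3 := hbad.2 (by linarith)
    have h4 : pairTerm α φ f N N' N'' k p m = 0 := by
      unfold pairTerm
      rw [if_neg]
      rintro ⟨-, -, h5, -⟩
      linarith
    have h5 : modelTerm α φ f N k p z = 0 := by
      unfold modelTerm
      rw [Set.indicator_of_notMem]
      rintro ⟨h6, -⟩
      rw [mem_closedBall_zero_iff] at h6
      linarith
    rw [h4, h5, sub_zero, norm_zero]; positivity
  have hzD : ‖z‖ < N - D := by
    by_contra! h'
    have := hbad.2 h'
    linarith
  have hz0 : z ≠ 0 := norm_pos_iff.1 hzn
  have hm0 : m ≠ 0 := norm_pos_iff.1 (by linarith)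
  have hmN : ‖m‖ ≤ N := by
    have := norm_le_norm_add_norm_sub z m
    rw [hDdef] at hzD; linarith
  have hmp : ‖z‖ ≤ ‖m + p‖ + D := by
    have := norm_le_norm_add_norm_sub (m + p) z; linarith
  have hmp0 : m + p ≠ 0 := norm_pos_iff.1 (by linarith)
  have hmpN : ‖m + p‖ ≤ N := by
    have := norm_le_norm_add_norm_sub z (m + p)
    rw [norm_sub_rev] at this; rw [norm_sub_rev] at hmz
    linarith [norm_sub_rev z (m+p)]
  -- Since `D = ‖p‖ + d`, the distance of `z` to the cut leaves room at `m` after a move of at most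
  -- `d`.
  have hmim : 2 * ‖p‖ < |m.im| := by
    have h3 : |z.im| ≤ |m.im| + d := by
      have h4 := (Complex.abs_im_le_norm (z - m)).trans hzm
      have h5 := abs_sub_abs_le_abs_sub z.im m.im
      rw [Complex.sub_im] at h4
      linarith
    linarith
  have hl1 : sheetLog k m = sheetLog k z + Complex.log (m / z) := by
    rw [sheetLog, logPos_eq_add_log (D := d) (y := m) (z := z) (by linarith) hzm' (by linarith),
      sheetLog]; ring
  have hl2 : sheetLog k (m + p) = sheetLog k z + Complex.log ((m + p) / z) := by
    rw [sheetLog, logPos_eq_add_log (D := D) (z := z) (by linarith) hmz (by linarith),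
      sheetLog]; ring
  have hl3 : sheetLog k m + Complex.log ((m + p) / m) = sheetLog k (m + p) := by
    rw [sheetLog, sheetLog, logPos_eq_add_log (D := ‖p‖) (y := m + p) (z := m) (by linarith)
      (by simp) hmim]; ring
  have hk1 : -(N' : ℝ) ≤ k := by exact_mod_cast hk
  have hk2 : (k : ℝ) + 1 ≤ N'' := by exact_mod_cast hk'
  have hpi := Real.pi_pos
  have hp1 : pairTerm α φ f N N' N'' k p m = f (φ * (Complex.exp (α * sheetLog k (m + p))
      - Complex.exp (α * sheetLog k m))) := by
    unfold pairTerm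
    rw [hl3, if_pos]
    refine ⟨hm0, hmp0, hmN, hmpN, ?_, ?_⟩
    · rw [im_sheetLog]; nlinarith [im_logPos_nonneg (m + p)]
    · rw [im_sheetLog]; nlinarith [im_logPos_lt (m + p)]
  have hp2 : modelTerm α φ f N k p z
      = f (φ * (α * p * Complex.exp ((α - 1) * sheetLog k z))) := by
    unfold modelTerm
    rw [Set.indicator_of_mem]
    exact ⟨by simpa using hle, hz0⟩
  have hx1 : ‖m / z - 1‖ ≤ D / ‖z‖ := by
    have : m / z - 1 = (m - z) / z := by field_simp
    rw [this, norm_div]; gcongr; linarith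
  have hx2 : ‖(m + p) / z - 1‖ ≤ D / ‖z‖ := by
    have : (m + p) / z - 1 = (m + p - z) / z := by field_simp
    rw [this, norm_div]; gcongr
  have hDz : D / ‖z‖ ≤ 1 / 2 := by rw [div_le_iff₀ hzn]; linarith
  have hexp := norm_one_add_cpow_sub_le hα h.α_lt hDz hx1 hx2
  rw [add_sub_cancel, add_sub_cancel] at hexp
  have hpz : (m + p) / z - 1 - (m / z - 1) = p / z := by field_simp; ring
  rw [hpz] at hexp
  have hE : Complex.exp ((α - 1) * sheetLog k z) = Complex.exp (α * sheetLog k z) / z := by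
    rw [sub_mul, one_mul, Complex.exp_sub, exp_sheetLog k hz0]
  rw [hp1, hp2]
  refine (hf.lipschitz _ _).trans ?_
  have hfac : (φ : ℂ) * (Complex.exp (α * sheetLog k (m + p)) - Complex.exp (α * sheetLog k m))
      - φ * (α * p * Complex.exp ((α - 1) * sheetLog k z))
      = φ * (Complex.exp (α * sheetLog k z) * (Complex.exp (α * Complex.log ((m + p) / z))
        - Complex.exp (α * Complex.log (m / z)) - α * (p / z))) := by
    rw [hE, hl1, hl2, mul_add, mul_add, Complex.exp_add, Complex.exp_add]; ring
  rw [hfac, norm_mul, norm_mul, norm_exp_real_mul, exp_sheetLog k hz0, Complex.norm_real,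
    Real.norm_of_nonneg h.φ_pos.le]
  have hφ0 := h.φ_pos
  have hz1 : ‖z‖ ^ α = ‖z‖ ^ (α - 1) * ‖z‖ := by
    rw [Real.rpow_sub_one hzn.ne']; field_simp
  -- The factor `φ ‖p‖ ‖z‖^(α-1)` is bounded by `8A/α` through `hφ`, so only the decay `D/‖z‖`
  -- remains; `24 = 3 · 8`.
  calc B₁ * (φ * (‖z‖ ^ α * _)) ≤ B₁ * (φ * (‖z‖ ^ α * (3 * (D / ‖z‖) * ‖p / z‖))) := by gcongr
    _ = B₁ * (3 * (D / ‖z‖)) * (φ * ‖p‖ * ‖z‖ ^ (α - 1)) := by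
      rw [hz1, norm_div]; field_simp
    _ ≤ B₁ * (3 * (D / ‖z‖)) * (8 * A / α) := by gcongr
    _ = _ := by field_simp; ring

/-- Either both terms vanish, or one is non-zero and `Regime.far_of_le`, applied at `z` or at `m`,
provides the distance needed for the expansion. -/
theorem norm_pairTerm_sub_modelTerm_le (h : Regime α A s c d φ) (hf : IsTest A B₀ B₁ f)
    (hk : -(N' : ℤ) ≤ k) (hk' : k < N'') (hB₁ : 0 ≤ B₁) (hp : p ≠ 0) (hsp : s ≤ ‖p‖)
    (hm : m ≠ 0 → c ≤ ‖m‖) (hzm : ‖z - m‖ ≤ d) :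
    ‖pairTerm α φ f N N' N'' k p m - modelTerm α φ f N k p z‖ ≤
      pointError B₀ N (‖p‖ + d) (24 / α * (A * B₁ * (‖p‖ + d))) z := by
  have hα := h.α_pos
  have hA := h.A_pos
  have hd := h.d_pos
  have hφ0 := h.φ_pos
  by_cases h1 : pairTerm α φ f N N' N'' k p m = 0
  · by_cases h2 : modelTerm α φ f N k p z = 0
    · have hB₀ : 0 ≤ B₀ := (norm_nonneg _).trans (hf.norm_le 0)
      rw [h1, h2, sub_zero, norm_zero, pointError]
      exact add_nonneg (Set.indicator_nonneg (fun _ _ => by positivity) _)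
        (Set.indicator_nonneg (fun _ _ => by positivity) _)
    · obtain ⟨hz0, hzN, h3⟩ := h.of_modelTerm_ne_zero hf h2
      have hzn : 0 < ‖z‖ := norm_pos_iff.2 hz0
      have h4 : A / α ≤ 4 * A / α := by gcongr; linarith
      have h5 : 4 * A / α ≤ 8 * A / α := by gcongr; norm_num
      obtain ⟨h6, h7⟩ := h.far_of_le hzn hsp (h3.trans h4)
      exact norm_pairTerm_sub_modelTerm_le_of_far h hf hk hk' hB₁ hp hzm (by linarith)
        (by linarith) ((h3.trans h4).trans h5)
  · obtain ⟨hm0, hmN, h3⟩ := h.of_pairTerm_ne_zero hf hm h1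
    have hmn : 0 < ‖m‖ := norm_pos_iff.2 hm0
    obtain ⟨h6, h7⟩ := h.far_of_le hmn hsp h3
    have h8 := norm_le_norm_add_norm_sub m z
    have h9 := norm_le_norm_add_norm_sub z m
    rw [norm_sub_rev] at h8
    have hzm' := hzm
    rw [norm_sub_rev] at hzm'
    have hz1 : ‖m‖ ≤ ‖z‖ + d := by linarith [norm_sub_rev m z]
    have hz2 : ‖z‖ ≤ ‖m‖ + d := by linarith [norm_sub_rev m z]
    refine norm_pairTerm_sub_modelTerm_le_of_far h hf hk hk' hB₁ hp hzm (by linarith)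
      (by linarith) ?_
    -- Passing from `m` to `z` costs `2^(1-α) ≤ 2` because `‖z‖ ≥ ‖m‖/2`; this turns `4A/α` into
    -- `8A/α`.
    have h10 : ‖z‖ ^ (α - 1) ≤ 2 * ‖m‖ ^ (α - 1) := by
      have h11 : ‖z‖ ^ (α - 1) ≤ (‖m‖ / 2) ^ (α - 1) :=
        Real.rpow_le_rpow_of_nonpos (by linarith) (by linarith) (by linarith [h.α_lt])
      refine h11.trans ?_
      rw [Real.div_rpow hmn.le zero_le_two, div_le_iff₀ (by positivity), mul_right_comm]
      refine le_mul_of_one_le_left (by positivity) ?_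
      calc (1 : ℝ) ≤ 2 ^ α := Real.one_le_rpow one_le_two hα.le
        _ = _ := by rw [Real.rpow_sub_one two_ne_zero]; ring
    calc φ * ‖p‖ * ‖z‖ ^ (α - 1) ≤ φ * ‖p‖ * (2 * ‖m‖ ^ (α - 1)) := by gcongr
      _ = 2 * (φ * ‖p‖ * ‖m‖ ^ (α - 1)) := by ring
      _ ≤ 2 * (4 * A / α) := by gcongr
      _ = _ := by ring

end Pointwise

/-! ### Polar coordinates and averages of periodic functions. -/

section Integrals

theorem integrable_of_bounded_of_eq_zero {g : ℂ → ℂ} (hg : Measurable g) {B R : ℝ}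
    (hB : ∀ z, ‖g z‖ ≤ B) (hR : ∀ z, R < ‖z‖ → g z = 0) : Integrable g := by
  have h1 : IntegrableOn g (Metric.closedBall 0 R) :=
    Measure.integrableOn_of_bounded (M := B) Metric.isBounded_closedBall.measure_lt_top.ne
      hg.aestronglyMeasurable (ae_of_all _ hB)
  refine (integrableOn_iff_integrable_of_support_subset ?_).1 h1
  intro z hz
  by_contra h
  exact hz (hR z (by simpa using h))

theorem integrableOn_polar {g : ℂ → ℂ} (hg : Measurable g) {B R : ℝ}
    (hB : ∀ z, ‖g z‖ ≤ B) (hR : ∀ z, R < ‖z‖ → g z = 0) :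
    IntegrableOn (fun x : ℝ × ℝ => x.1 • g (x.1 * Complex.exp (x.2 * Complex.I)))
      (Set.Ioi (0 : ℝ) ×ˢ Set.Ioo (-Real.pi) Real.pi) := by
  have hB0 : 0 ≤ B := (norm_nonneg _).trans (hB 0)
  have hm : Measurable (fun x : ℝ × ℝ => x.1 • g (x.1 * Complex.exp (x.2 * Complex.I))) := by
    refine measurable_fst.smul (hg.comp ?_)
    fun_prop
  have hn : ∀ x : ℝ × ℝ, 0 < x.1 → ‖(x.1 : ℂ) * Complex.exp (x.2 * Complex.I)‖ = x.1 := by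
    intro x hx
    rw [norm_mul, Complex.norm_exp_ofReal_mul_I, mul_one, Complex.norm_real,
      Real.norm_of_nonneg hx.le]
  have h1 : IntegrableOn (fun x : ℝ × ℝ => x.1 • g (x.1 * Complex.exp (x.2 * Complex.I)))
      (Set.Ioc (0 : ℝ) R ×ˢ Set.Ioo (-Real.pi) Real.pi) := by
    refine Measure.integrableOn_of_bounded (M := R * B) ?_ hm.aestronglyMeasurable ?_
    · exact (((Metric.isBounded_Ioc _ _).prod (Metric.isBounded_Ioo _ _)).measure_lt_top).ne
    · refine (ae_restrict_iff' (measurableSet_Ioc.prod measurableSet_Ioo)).2 (ae_of_all _ ?_)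
      rintro x ⟨⟨hx0, hxR⟩, -⟩
      rw [norm_smul, Real.norm_of_nonneg hx0.le]
      exact mul_le_mul hxR (hB _) (norm_nonneg _) (hx0.le.trans hxR)
  refine h1.of_forall_sdiff_eq_zero (measurableSet_Ioi.prod measurableSet_Ioo) ?_
  rintro x ⟨⟨hx0, hxθ⟩, hx⟩
  have hxR : R < x.1 := by
    by_contra! h
    exact hx ⟨⟨hx0, h⟩, hxθ⟩
  change x.1 • g _ = 0
  rw [hR _ (by rw [hn x hx0]; exact hxR), smul_zero]

theorem setIntegral_Ioo_eq_of_circle (g : ℂ → ℂ) (t : ℝ) :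
    ∫ θ in Set.Ioo (-Real.pi) Real.pi, g (t * Complex.exp (θ * Complex.I))
      = ∫ θ in (0 : ℝ)..(2 * Real.pi), g (t * Complex.exp (θ * Complex.I)) := by
  have hper : Function.Periodic (fun θ : ℝ => g (t * Complex.exp (θ * Complex.I)))
      (2 * Real.pi) := by
    intro θ
    have : (((θ + 2 * Real.pi : ℝ) : ℂ) * Complex.I) = θ * Complex.I + 2 * Real.pi * Complex.I := by
      push_cast; ring
    simp only [this, Complex.exp_periodic (θ * Complex.I)]
  rw [← integral_Ioc_eq_integral_Ioo, ← intervalIntegral.integral_of_le (by linarith [Real.pi_pos])]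
  have := hper.intervalIntegral_add_eq (-Real.pi) 0
  rw [zero_add] at this
  rw [← this]
  congr 1; ring

/-- Integration in polar coordinates. -/
theorem integral_polar {g : ℂ → ℂ} (hg : Measurable g) {B R : ℝ}
    (hB : ∀ z, ‖g z‖ ≤ B) (hR : ∀ z, R < ‖z‖ → g z = 0) :
    IntegrableOn (fun t : ℝ => t • ∫ θ in (0 : ℝ)..(2 * Real.pi),
      g (t * Complex.exp (θ * Complex.I))) (Set.Ioi 0) ∧
    ∫ z, g z = ∫ t in Set.Ioi (0 : ℝ), t • ∫ θ in (0 : ℝ)..(2 * Real.pi),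
      g (t * Complex.exp (θ * Complex.I)) := by
  have h1 := integrableOn_polar hg hB hR
  have h2 : ∀ t : ℝ, ∫ θ in Set.Ioo (-Real.pi) Real.pi, t • g (t * Complex.exp (θ * Complex.I))
      = t • ∫ θ in (0 : ℝ)..(2 * Real.pi), g (t * Complex.exp (θ * Complex.I)) := by
    intro t
    rw [integral_smul, setIntegral_Ioo_eq_of_circle]
  constructor
  · have h3 := h1
    rw [IntegrableOn, Measure.volume_eq_prod, ← Measure.prod_restrict] at h3
    have h4 := h3.integral_prod_left
    simp only [h2] at h4
    exact h4
  · rw [← Complex.integral_comp_polarCoord_symm]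
    have h3 : ∀ x : ℝ × ℝ, Complex.polarCoord.symm x = x.1 * Complex.exp (x.2 * Complex.I) := by
      intro x
      rw [Complex.polarCoord_symm_apply, Complex.exp_mul_I]; push_cast; rfl
    simp only [h3]
    rw [polarCoord_target, Measure.volume_eq_prod, setIntegral_prod _ h1]
    simp only [h2]

/-- The mean of a periodic function over a long interval is close to its mean over a period. -/
theorem norm_integral_sub_periodic_le {F : ℝ → ℂ} {T B : ℝ} (hF : Function.Periodic F T)
    (hT : 0 < T) (hm : Measurable F) (hB : ∀ x, ‖F x‖ ≤ B) (a b : ℝ) :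
    ‖(∫ x in a..b, F x) - ((b - a) / T : ℝ) • ∫ x in (0 : ℝ)..T, F x‖ ≤ 2 * T * B := by
  have hi : ∀ s t : ℝ, IntervalIntegrable F volume s t := by
    intro s t
    rw [intervalIntegrable_iff]
    exact Measure.integrableOn_of_bounded (M := B) (by simp) hm.aestronglyMeasurable
      (ae_of_all _ hB)
  have hB0 : 0 ≤ B := (norm_nonneg _).trans (hB 0)
  -- The interval is cut into `n` whole periods and a remainder shorter than `T`; the remainder and
  -- the fractional part of `(b - a)/T` each cost `T * B`.
  set n : ℤ := ⌊(b - a) / T⌋ with hn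
  have h1 : (n : ℝ) ≤ (b - a) / T := Int.floor_le _
  have h2 : (b - a) / T < n + 1 := Int.lt_floor_add_one _
  have h3 := hF.intervalIntegral_add_zsmul_eq n a hi
  have h4 := hF.intervalIntegral_add_eq a 0
  rw [zero_add] at h4
  rw [h4] at h3
  rw [← intervalIntegral.integral_add_adjacent_intervals (hi a (a + n • T)) (hi _ b), h3,
    ← Int.cast_smul_eq_zsmul ℝ]
  have h5 : ‖∫ x in (0 : ℝ)..T, F x‖ ≤ B * T := by
    have := intervalIntegral.norm_integral_le_of_norm_le_const (a := 0) (b := T) (f := F) (C := B)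
      (fun x _ => hB x)
    rwa [sub_zero, abs_of_pos hT] at this
  have h6 : ‖∫ x in (a + n • T)..b, F x‖ ≤ B * T := by
    refine (intervalIntegral.norm_integral_le_of_norm_le_const (C := B)
      (fun x _ => hB x)).trans ?_
    rw [zsmul_eq_mul]
    rw [le_div_iff₀ hT] at h1
    rw [div_lt_iff₀ hT] at h2
    gcongr
    rw [abs_le]; constructor <;> linarith
  have h7 : ∀ X Y : ℂ, (n : ℝ) • X + Y - ((b - a) / T : ℝ) • X
      = Y - ((b - a) / T - n : ℝ) • X := by
    intro X Y; rw [sub_smul]; ring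
  rw [h7]
  refine (norm_sub_le _ _).trans ?_
  rw [norm_smul, Real.norm_of_nonneg (by linarith)]
  have h8 : ((b - a) / T - n) * ‖∫ x in (0 : ℝ)..T, F x‖ ≤ 1 * (B * T) := by
    gcongr; linarith
  linarith

theorem periodic_comp_exp (f : ℂ → ℂ) (c : ℂ) {b : ℝ} (hb : b ≠ 0) :
    Function.Periodic (fun θ : ℝ => f (c * Complex.exp (b * (θ * Complex.I))))
      (2 * Real.pi / b) := by
  intro θ
  have hbc : (b : ℂ) ≠ 0 := Complex.ofReal_ne_zero.2 hb
  have : ((b : ℂ) * ((θ + 2 * Real.pi / b : ℝ) * Complex.I))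
      = b * (θ * Complex.I) + 2 * Real.pi * Complex.I := by
    push_cast; field_simp
  simp only [this, Complex.exp_periodic _]

theorem integral_comp_circle_rotate (f : ℂ → ℂ) (c : ℂ) :
    ∫ θ in (0 : ℝ)..(2 * Real.pi), f (c * Complex.exp (θ * Complex.I))
      = ∫ θ in (0 : ℝ)..(2 * Real.pi), f (‖c‖ * Complex.exp (θ * Complex.I)) := by
  have hper := periodic_comp_exp f (‖c‖ : ℂ) one_ne_zero
  simp only [Complex.ofReal_one, one_mul, div_one] at hper
  have h1 : ∀ θ : ℝ, f (c * Complex.exp (θ * Complex.I))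
      = (fun θ : ℝ => f (‖c‖ * Complex.exp (θ * Complex.I))) (θ + c.arg) := by
    intro θ
    change _ = f _
    congr 1
    conv_lhs => rw [← Complex.norm_mul_exp_arg_mul_I c]
    rw [mul_assoc, ← Complex.exp_add]; congr 2; push_cast; ring
  simp only [h1]
  rw [intervalIntegral.integral_comp_add_right (fun θ : ℝ => f (‖c‖ * Complex.exp (θ * Complex.I)))]
  have := hper.intervalIntegral_add_eq c.arg 0
  rw [zero_add] at this
  rw [← this]; congr 1 <;> ring

/-- Over an angle `2π/β` the phase winds exactly once around the circle; the reversed orientation is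
harmless by periodicity. -/
theorem integral_circle_power (f : ℂ → ℂ) (c : ℂ) {β : ℝ} (hβ : 0 < β) :
    ∫ θ in (0 : ℝ)..(2 * Real.pi / β), f (c * Complex.exp (-β * (θ * Complex.I)))
      = (β⁻¹ : ℝ) • ∫ θ in (0 : ℝ)..(2 * Real.pi), f (c * Complex.exp (θ * Complex.I)) := by
  have hper := periodic_comp_exp f c one_ne_zero
  simp only [Complex.ofReal_one, one_mul, div_one] at hper
  have h1 := intervalIntegral.integral_comp_mul_left (a := 0) (b := 2 * Real.pi / β)
    (fun θ : ℝ => f (c * Complex.exp (θ * Complex.I))) (c := -β) (by linarith)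
  have h2 : ∀ θ : ℝ, f (c * Complex.exp (((-β * θ : ℝ) : ℂ) * Complex.I))
      = f (c * Complex.exp (-β * (θ * Complex.I))) := by
    intro θ; congr 3; push_cast; ring
  simp only [h2] at h1
  rw [h1, mul_zero]
  have h3 : -β * (2 * Real.pi / β) = -(2 * Real.pi) := by field_simp
  have h4 := hper.intervalIntegral_add_eq (-(2 * Real.pi)) 0
  rw [zero_add, neg_add_cancel] at h4
  rw [h3, intervalIntegral.integral_symm, h4, inv_neg, smul_neg, neg_smul, neg_neg]

end Integrals

/-! ### Integral of the pointwise error. -/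

section PointErrorIntegral

theorem measureReal_badSet_le {N D : ℝ} (hD : 0 ≤ D) (hDN : D ≤ N) :
    MeasurableSet (badSet N D) ∧ volume (badSet N D) < ⊤ ∧
      (volume : Measure ℂ).real (badSet N D) ≤ 30 * (N * D) := by
  have hN : 0 ≤ N := hD.trans hDN
  have hpi := Real.pi_pos
  have e1 : {z : ℂ | |z.re| ≤ 2 * N ∧ |z.im| ≤ 2 * D}
      = Set.Icc (-(2 * N)) (2 * N) ×ℂ Set.Icc (-(2 * D)) (2 * D) := by
    ext z; simp [Complex.mem_reProdIm, abs_le]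
  have e2 : {z : ℂ | N - D ≤ ‖z‖ ∧ ‖z‖ ≤ N + D}
      = Metric.closedBall 0 (N + D) \ Metric.ball 0 (N - D) := by
    ext z; simp [and_comm]
  have m1 : MeasurableSet {z : ℂ | |z.re| ≤ 2 * N ∧ |z.im| ≤ 2 * D} := by
    exact ((isClosed_le Complex.continuous_re.abs continuous_const).inter
      (isClosed_le Complex.continuous_im.abs continuous_const)).measurableSet
  have m2 : MeasurableSet {z : ℂ | N - D ≤ ‖z‖ ∧ ‖z‖ ≤ N + D} := by
    rw [e2]; exact measurableSet_closedBall.diff measurableSet_ball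
  have v1 : volume {z : ℂ | |z.re| ≤ 2 * N ∧ |z.im| ≤ 2 * D} = ENNReal.ofReal (16 * (N * D)) := by
    rw [e1]
    have := Complex.volume_preserving_equiv_real_prod.measure_preimage
      (s := Set.Icc (-(2 * N)) (2 * N) ×ˢ Set.Icc (-(2 * D)) (2 * D))
      (measurableSet_Icc.prod measurableSet_Icc).nullMeasurableSet
    rw [Measure.volume_eq_prod, Measure.prod_prod, Real.volume_Icc, Real.volume_Icc,
      ← ENNReal.ofReal_mul (by linarith)] at this
    rw [← show (16 * (N * D)) = (2 * N - -(2 * N)) * (2 * D - -(2 * D)) by ring] at this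
    exact this
  have v2 : volume {z : ℂ | N - D ≤ ‖z‖ ∧ ‖z‖ ≤ N + D}
      = ENNReal.ofReal (4 * Real.pi * (N * D)) := by
    rw [e2, measure_sdiff (Metric.ball_subset_closedBall.trans
      (Metric.closedBall_subset_closedBall (by linarith))) measurableSet_ball.nullMeasurableSet
      (Metric.isBounded_ball.measure_lt_top.ne), Complex.volume_ball, Complex.volume_closedBall,
      ← ENNReal.ofReal_pow (by linarith), ← ENNReal.ofReal_pow (by linarith),
      ← ENNReal.sub_mul (by simp), ← ENNReal.ofReal_sub _ (by positivity),
      ← ENNReal.ofReal_coe_nnreal, NNReal.coe_real_pi, ← ENNReal.ofReal_mul' hpi.le]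
    congr 1; ring
  have v3 : volume (badSet N D) ≤ ENNReal.ofReal (16 * (N * D)) +
      ENNReal.ofReal (4 * Real.pi * (N * D)) := by
    rw [← v1, ← v2]; exact measure_union_le _ _
  have hND : 0 ≤ N * D := mul_nonneg hN hD
  rw [← ENNReal.ofReal_add (by positivity) (by positivity)] at v3
  refine ⟨m1.union m2, v3.trans_lt ENNReal.ofReal_lt_top, ?_⟩
  refine ENNReal.toReal_le_of_le_ofReal (by positivity) (v3.trans (ENNReal.ofReal_le_ofReal ?_))
  nlinarith [Real.pi_lt_d2]

/-- In polar coordinates the Jacobian cancels the singularity, so the integral is linear in `R`.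
This makes the linearization error of the same order as the area of the bad set. -/
theorem integral_indicator_div_norm {E R : ℝ} (hR : 0 ≤ R) :
    Integrable ((Metric.closedBall (0 : ℂ) R).indicator (fun z => E / ‖z‖)) ∧
    ∫ z, (Metric.closedBall (0 : ℂ) R).indicator (fun z => E / ‖z‖) z
      = 2 * Real.pi * R * E := by
  have h1 : (Metric.closedBall (0 : ℂ) R).indicator (fun z => E / ‖z‖)
      = fun z : ℂ => (Set.Iic R).indicator (fun t => E / t) ‖z‖ := by
    ext z
    by_cases hz : ‖z‖ ≤ R
    · rw [Set.indicator_of_mem (by simpa using hz), Set.indicator_of_mem (by simpa using hz)]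
    · rw [Set.indicator_of_notMem (by simpa using hz), Set.indicator_of_notMem (by simpa using hz)]
  have h2 : ∀ y ∈ Set.Ioi (0 : ℝ), y ^ (Module.finrank ℝ ℂ - 1) •
      (Set.Iic R).indicator (fun t => E / t) y = (Set.Ioc 0 R).indicator (fun _ => E) y := by
    intro y hy
    have hy : 0 < y := hy
    rw [Complex.finrank_real_complex]
    by_cases hyR : y ≤ R
    · rw [Set.indicator_of_mem (by simpa using hyR), Set.indicator_of_mem (by exact ⟨hy, hyR⟩)]
      simp; field_simp
    · rw [Set.indicator_of_notMem (by simpa using hyR), Set.indicator_of_notMem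
        (by rintro ⟨-, h⟩; exact hyR h)]
      simp
  rw [h1]
  constructor
  · rw [integrable_fun_norm_addHaar, integrableOn_congr_fun h2 measurableSet_Ioi]
    refine Integrable.integrableOn ?_
    rw [integrable_indicator_iff measurableSet_Ioc]
    exact integrableOn_const (by simp)
  · rw [integral_fun_norm_addHaar, setIntegral_congr_fun measurableSet_Ioi h2,
      setIntegral_indicator measurableSet_Ioc, setIntegral_const, measureReal_def,
      Complex.volume_ball, Complex.finrank_real_complex]
    have : Set.Ioi (0 : ℝ) ∩ Set.Ioc 0 R = Set.Ioc 0 R :=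
      Set.inter_eq_right.2 fun x hx => hx.1
    rw [this]
    simp [hR]; ring

theorem integral_pointError_le {B₀ N D E : ℝ} (hB₀ : 0 ≤ B₀) (hE : 0 ≤ E) (hD : 0 ≤ D)
    (hDN : D ≤ N) : Integrable (pointError B₀ N D E) ∧
      ∫ z, pointError B₀ N D E z ≤ 60 * B₀ * (N * D) + 13 * N * E := by
  obtain ⟨h1, h2, h3⟩ := measureReal_badSet_le hD hDN
  have hN : 0 ≤ N := hD.trans hDN
  obtain ⟨h4, h5⟩ := integral_indicator_div_norm (E := E) (R := 2 * N) (by linarith)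
  have h6 : Integrable ((badSet N D).indicator (fun _ => 2 * B₀)) := by
    rw [integrable_indicator_iff h1]; exact integrableOn_const h2.ne
  refine ⟨h6.add h4, ?_⟩
  unfold pointError
  rw [integral_add h6 h4, h5, integral_indicator h1, setIntegral_const, smul_eq_mul]
  have h7 : 0 ≤ N * E := mul_nonneg hN hE
  nlinarith [Real.pi_lt_d2]

end PointErrorIntegral

/-! ### Averaging the linearized terms over the sheets. -/

section Model

variable {α φ : ℝ} {f : ℂ → ℂ}

/-- The image of a test function under the averaging over a disk of the linearized pair
differences. -/
def diskAverage (α : ℝ) (f : ℂ → ℂ) (q : ℂ) : ℂ :=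
  ∫ w in Metric.closedBall (0 : ℂ) 1, f (α * q * ((‖w‖ ^ (α - 2) : ℝ) * w))

theorem measurable_modelTerm (hf : Measurable f) (N : ℕ) (k : ℤ) (p : ℂ) :
    Measurable (modelTerm α φ f N k p) := by
  unfold modelTerm
  refine Measurable.indicator (hf.comp ?_)
    (measurableSet_closedBall.diff (measurableSet_singleton 0))
  have := measurable_sheetLog k
  fun_prop

theorem integral_closedBall_polar (hf : Measurable f) {B₀ R : ℝ} (hB : ∀ z, ‖f z‖ ≤ B₀) (c : ℂ) :
    IntegrableOn (fun t : ℝ => t • (Set.Iic R).indicator (fun t => ∫ θ in (0 : ℝ)..(2 * Real.pi),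
        f (c * (t ^ (α - 1) : ℝ) * Complex.exp (θ * Complex.I))) t) (Set.Ioi 0) ∧
    ∫ w in Metric.closedBall (0 : ℂ) R, f (c * ((‖w‖ ^ (α - 2) : ℝ) * w))
      = ∫ t in Set.Ioi (0 : ℝ), t • (Set.Iic R).indicator (fun t => ∫ θ in (0 : ℝ)..(2 * Real.pi),
        f (c * (t ^ (α - 1) : ℝ) * Complex.exp (θ * Complex.I))) t := by
  have hB0 : 0 ≤ B₀ := (norm_nonneg _).trans (hB 0)
  have hm : Measurable ((Metric.closedBall (0 : ℂ) R).indicator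
      (fun w => f (c * ((‖w‖ ^ (α - 2) : ℝ) * w)))) := by
    refine Measurable.indicator (hf.comp ?_) measurableSet_closedBall
    fun_prop
  have h := integral_polar (B := B₀) (R := R) hm
    (fun z => (norm_indicator_le_norm_self _ _).trans (hB _))
    (fun z hz => Set.indicator_of_notMem (by simpa using hz) _)
  have h2 : ∀ t ∈ Set.Ioi (0 : ℝ), (t • ∫ θ in (0 : ℝ)..(2 * Real.pi),
      (Metric.closedBall (0 : ℂ) R).indicator (fun w => f (c * ((‖w‖ ^ (α - 2) : ℝ) * w)))
        (t * Complex.exp (θ * Complex.I)))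
      = t • (Set.Iic R).indicator (fun t => ∫ θ in (0 : ℝ)..(2 * Real.pi),
        f (c * (t ^ (α - 1) : ℝ) * Complex.exp (θ * Complex.I))) t := by
    intro t ht
    have ht : 0 < t := ht
    have hn : ∀ θ : ℝ, ‖(t : ℂ) * Complex.exp (θ * Complex.I)‖ = t := by
      intro θ
      rw [norm_mul, Complex.norm_exp_ofReal_mul_I, mul_one, Complex.norm_real,
        Real.norm_of_nonneg ht.le]
    have hpow : ((t ^ (α - 2) : ℝ) : ℂ) * t = (t ^ (α - 1) : ℝ) := by
      rw [← Complex.ofReal_mul, ← Real.rpow_add_one ht.ne']; congr 2; ring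
    by_cases htR : t ≤ R
    · rw [Set.indicator_of_mem (by simpa using htR)]
      congr 1
      refine intervalIntegral.integral_congr fun θ _ => ?_
      rw [Set.indicator_of_mem (by simpa using (hn θ).trans_le htR), hn, ← hpow]
      congr 1; ring
    · rw [Set.indicator_of_notMem (by simpa using htR), smul_zero]
      have : ∀ θ : ℝ, (Metric.closedBall (0 : ℂ) R).indicator
          (fun w => f (c * ((‖w‖ ^ (α - 2) : ℝ) * w))) (t * Complex.exp (θ * Complex.I)) = 0 := by
        intro θ
        refine Set.indicator_of_notMem ?_ _
        rw [mem_closedBall_zero_iff, hn]; exact htR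
      simp [this]
  rw [← integral_indicator measurableSet_closedBall, h.2]
  exact ⟨(integrableOn_congr_fun h2 measurableSet_Ioi).1 h.1,
    setIntegral_congr_fun measurableSet_Ioi h2⟩

theorem logPos_polar {t θ : ℝ} (ht : 0 < t) (h0 : 0 ≤ θ) (h1 : θ < 2 * Real.pi) :
    logPos (t * Complex.exp (θ * Complex.I)) = Real.log t + θ * Complex.I := by
  refine (logPos_unique ?_ (by simpa using h0) (by simpa using h1)).symm
  rw [Complex.exp_add, ← Complex.ofReal_exp, Real.exp_log ht]

/-- Moving to sheet `k` shifts the angle by `2πk`. The radial form matches that of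
`integral_closedBall_polar`, so that the two can be compared radius by radius. -/
theorem integral_modelTerm (hf : Measurable f) {B₀ : ℝ} (hB : ∀ z, ‖f z‖ ≤ B₀) (N : ℕ) (k : ℤ)
    (p : ℂ) :
    IntegrableOn (fun t : ℝ => t • (Set.Iic (N : ℝ)).indicator
      (fun t => ∫ θ in (2 * Real.pi * k)..(2 * Real.pi * (k + 1)),
        f (φ * α * p * (t ^ (α - 1) : ℝ) * Complex.exp (-((1 - α : ℝ) : ℂ) * (θ * Complex.I)))) t)
      (Set.Ioi 0) ∧
    ∫ z, modelTerm α φ f N k p z = ∫ t in Set.Ioi (0 : ℝ), t • (Set.Iic (N : ℝ)).indicator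
      (fun t => ∫ θ in (2 * Real.pi * k)..(2 * Real.pi * (k + 1)),
        f (φ * α * p * (t ^ (α - 1) : ℝ) * Complex.exp (-((1 - α : ℝ) : ℂ) * (θ * Complex.I)))) t
      := by
  have hB0 : 0 ≤ B₀ := (norm_nonneg _).trans (hB 0)
  have h := integral_polar (B := B₀) (R := N) (measurable_modelTerm (α := α) (φ := φ) hf N k p)
    (fun z => by
      unfold modelTerm
      exact (norm_indicator_le_norm_self _ _).trans (hB _))
    (fun z hz => Set.indicator_of_notMem (by rintro ⟨h, -⟩; simp at h; linarith) _)
  have h2 : ∀ t ∈ Set.Ioi (0 : ℝ), (t • ∫ θ in (0 : ℝ)..(2 * Real.pi),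
      modelTerm α φ f N k p (t * Complex.exp (θ * Complex.I)))
      = t • (Set.Iic (N : ℝ)).indicator
      (fun t => ∫ θ in (2 * Real.pi * k)..(2 * Real.pi * (k + 1)),
        f (φ * α * p * (t ^ (α - 1) : ℝ) * Complex.exp (-((1 - α : ℝ) : ℂ) * (θ * Complex.I)))) t
      := by
    intro t ht
    have ht : 0 < t := ht
    have hn : ∀ θ : ℝ, ‖(t : ℂ) * Complex.exp (θ * Complex.I)‖ = t := by
      intro θ
      rw [norm_mul, Complex.norm_exp_ofReal_mul_I, mul_one, Complex.norm_real,
        Real.norm_of_nonneg ht.le]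
    have hne : ∀ θ : ℝ, (t : ℂ) * Complex.exp (θ * Complex.I) ≠ 0 := by
      intro θ; rw [← norm_pos_iff, hn]; exact ht
    by_cases htR : t ≤ N
    · rw [Set.indicator_of_mem (by simpa using htR)]
      congr 1
      have h3 := intervalIntegral.integral_comp_add_right (a := 0) (b := 2 * Real.pi)
        (fun θ : ℝ => f (φ * α * p * (t ^ (α - 1) : ℝ) *
          Complex.exp (-((1 - α : ℝ) : ℂ) * (θ * Complex.I)))) (2 * Real.pi * k)
      rw [show 2 * Real.pi * (k + 1) = 2 * Real.pi + 2 * Real.pi * k by ring]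
      rw [zero_add] at h3
      rw [← h3]
      -- The endpoint `2π` must be discarded: there `logPos` jumps back to argument `0`.
      rw [intervalIntegral.integral_of_le Real.two_pi_pos.le,
        intervalIntegral.integral_of_le Real.two_pi_pos.le, integral_Ioc_eq_integral_Ioo,
        integral_Ioc_eq_integral_Ioo]
      refine setIntegral_congr_fun measurableSet_Ioo fun θ hθ => ?_
      simp only [modelTerm]
      have hmem : (t : ℂ) * Complex.exp (θ * Complex.I) ∈ (Metric.closedBall 0 N \ {0} : Set ℂ) :=
        ⟨by simpa using (hn θ).trans_le htR, hne θ⟩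
      rw [Set.indicator_of_mem hmem, sheetLog,
        logPos_polar ht hθ.1.le hθ.2]
      congr 1
      have h4 : ((t ^ (α - 1) : ℝ) : ℂ) = Complex.exp ((α - 1) * Real.log t) := by
        rw [Real.rpow_def_of_pos ht, Complex.ofReal_exp]; congr 1; push_cast; ring
      rw [h4]
      have h5 : ((α : ℂ) - 1) * (Real.log t + θ * Complex.I + 2 * Real.pi * k * Complex.I)
          = (α - 1) * Real.log t
            + -((1 - α : ℝ) : ℂ) * (((θ + 2 * Real.pi * k : ℝ) : ℂ) * Complex.I) := by
        push_cast; ring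
      rw [h5, Complex.exp_add]; ring
    · rw [Set.indicator_of_notMem (by simpa using htR), smul_zero]
      have : ∀ θ : ℝ, modelTerm α φ f N k p (t * Complex.exp (θ * Complex.I)) = 0 := by
        intro θ
        refine Set.indicator_of_notMem ?_ _
        rintro ⟨h, -⟩
        rw [mem_closedBall_zero_iff, hn] at h; exact htR h
      simp [this]
  rw [h.2]
  exact ⟨(integrableOn_congr_fun h2 measurableSet_Ioi).1 h.1,
    setIntegral_congr_fun measurableSet_Ioi h2⟩

/-- The map `w ↦ ‖w‖^(α-2) w` is homogeneous of degree `α - 1`, so rescaling the disk to radius `1`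
replaces `φ` by `φ / N^(1-α)`. -/
theorem closedBall_integral_eq_diskAverage {N : ℕ} (hN : 0 < N) (p : ℂ) :
    ∫ w in Metric.closedBall (0 : ℂ) N, f (φ * α * p * ((‖w‖ ^ (α - 2) : ℝ) * w))
      = (N : ℂ) ^ 2 * diskAverage α f ((φ / (N : ℝ) ^ (1 - α) : ℝ) * p) := by
  have hN' : (0 : ℝ) < N := by exact_mod_cast hN
  have h := Measure.setIntegral_comp_smul_of_pos (volume : Measure ℂ)
    (fun w => f (φ * α * p * ((‖w‖ ^ (α - 2) : ℝ) * w))) (Metric.closedBall 0 1) hN'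
  rw [smul_unitClosedBall, Complex.finrank_real_complex, Real.norm_of_nonneg hN'.le] at h
  have h2 : diskAverage α f ((φ / (N : ℝ) ^ (1 - α) : ℝ) * p) = ∫ w in Metric.closedBall (0 : ℂ) 1,
      f (φ * α * p * ((‖(N : ℝ) • w‖ ^ (α - 2) : ℝ) * ((N : ℝ) • w))) := by
    refine setIntegral_congr_fun measurableSet_closedBall fun w _ => ?_
    congr 1
    rw [norm_smul, Real.norm_of_nonneg hN'.le, Real.mul_rpow hN'.le (norm_nonneg _)]
    have h3 : ((N : ℝ) ^ (α - 2)) * N = 1 / (N : ℝ) ^ (1 - α) := by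
      rw [← Real.rpow_add_one hN'.ne', one_div, ← Real.rpow_neg hN'.le]; congr 1; ring
    have h4 : (((N : ℝ) ^ (α - 2) : ℝ) : ℂ) * N = ((1 / (N : ℝ) ^ (1 - α) : ℝ) : ℂ) := by
      rw [← h3]; push_cast; ring
    rw [Complex.real_smul, div_eq_mul_one_div, Complex.ofReal_mul, ← h4]
    push_cast; ring
  have hNc : (N : ℂ) ≠ 0 := by exact_mod_cast hN.ne'
  rw [h2, h, Complex.real_smul, ← mul_assoc]
  push_cast
  rw [mul_inv_cancel₀ (pow_ne_zero 2 hNc), one_mul]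

theorem norm_sum_modelTerm_sub_le (hα : α < 1) (hf : Measurable f) {B₀ : ℝ}
    (hB : ∀ z, ‖f z‖ ≤ B₀) {N : ℕ} (hN : 0 < N) (N' N'' : ℕ) (p : ℂ) :
    ‖(∑ j ∈ Finset.range (N' + N''), ∫ z, modelTerm α φ f N ((j : ℤ) - N') p z)
      - ((N' + N'' : ℕ) : ℂ) * ((N : ℂ) ^ 2 * diskAverage α f ((φ / (N : ℝ) ^ (1 - α) : ℝ) * p))‖
      ≤ 4 * Real.pi / (1 - α) * B₀ * (N : ℝ) ^ 2 := by
  have hβ : 0 < 1 - α := by linarith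
  have hB0 : 0 ≤ B₀ := (norm_nonneg _).trans (hB 0)
  have hN' : (0 : ℝ) < N := by exact_mod_cast hN
  have h1 := fun j : ℕ => integral_modelTerm (α := α) (φ := φ) hf hB N ((j : ℤ) - N') p
  have h2 := integral_closedBall_polar (α := α) (R := N) hf hB (φ * α * p)
  rw [← closedBall_integral_eq_diskAverage hN, h2.2]
  rw [Finset.sum_congr rfl fun j _ => (h1 j).2]
  rw [← integral_finsetSum _ (fun j _ => (h1 j).1), ← integral_const_mul,
    ← integral_sub (integrable_finsetSum _ fun j _ => (h1 j).1) (h2.1.const_mul _)]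
  have hint : IntegrableOn ((Set.Ioc (0 : ℝ) N).indicator
      (fun t => 4 * Real.pi / (1 - α) * B₀ * t)) (Set.Ioi 0) := by
    refine Integrable.integrableOn ?_
    rw [integrable_indicator_iff measurableSet_Ioc]
    exact (Continuous.integrableOn_Icc (by fun_prop)).mono_set Set.Ioc_subset_Icc_self
  refine (norm_integral_le_of_norm_le hint ?_).trans ?_
  · refine (ae_restrict_iff' measurableSet_Ioi).2 (ae_of_all _ fun t ht => ?_)
    have ht : 0 < t := ht
    by_cases htN : t ≤ N
    · rw [Set.indicator_of_mem (show t ∈ Set.Ioc (0 : ℝ) N from ⟨ht, htN⟩)]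
      simp only [Set.indicator_of_mem (show t ∈ Set.Iic (N : ℝ) from htN)]
      set c : ℂ := φ * α * p * (t ^ (α - 1) : ℝ) with hc
      set F : ℝ → ℂ := fun θ => f (c * Complex.exp (-((1 - α : ℝ) : ℂ) * (θ * Complex.I))) with hF
      have hFm : Measurable F := hf.comp (by fun_prop)
      have hFi : ∀ a b : ℝ, IntervalIntegrable F volume a b := by
        intro s t
        rw [intervalIntegrable_iff]
        exact Measure.integrableOn_of_bounded (M := B₀) (by simp) hFm.aestronglyMeasurable
          (ae_of_all _ fun _ => hB _)
      have hper : Function.Periodic F (2 * Real.pi / (1 - α)) := by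
        have := (periodic_comp_exp f c (b := -(1 - α)) (by linarith)).neg
        rw [div_neg, neg_neg] at this
        rwa [Complex.ofReal_neg] at this
      -- Consecutive sheets have adjacent angular windows, whose union is the whole admissible range
      -- of heights.
      have hs : (∑ j ∈ Finset.range (N' + N''), ∫ θ in
          (2 * Real.pi * (((j : ℤ) - N' : ℤ) : ℝ))..(2 * Real.pi * ((((j : ℤ) - N' : ℤ) : ℝ) + 1)),
            F θ) = ∫ θ in (-(2 * Real.pi * N'))..(2 * Real.pi * N''), F θ := by
        have := intervalIntegral.sum_integral_adjacent_intervals (μ := volume) (f := F)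
          (a := fun j : ℕ => 2 * Real.pi * ((j : ℝ) - N')) (n := N' + N'') (fun k _ => hFi _ _)
        convert this using 2
        · push_cast; congr 1; ring
        · push_cast; ring
        · push_cast; ring
      have hav := norm_integral_sub_periodic_le hper (by positivity) hFm (fun _ => hB _)
        (-(2 * Real.pi * N')) (2 * Real.pi * N'')
      have hcp := integral_circle_power f c hβ
      rw [hcp, ← hs, smul_smul] at hav
      -- The number of periods, `(1 - α)(N' + N'')`, cancels against the Jacobian of
      -- `integral_circle_power`.
      have hco : (2 * Real.pi * N'' - -(2 * Real.pi * N')) / (2 * Real.pi / (1 - α)) * (1 - α)⁻¹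
          = (N' + N'' : ℕ) := by
        push_cast; field_simp; ring
      rw [hco] at hav
      rw [← Finset.smul_sum]
      rw [show ∀ X Y : ℂ, t • X - ((N' + N'' : ℕ) : ℂ) * (t • Y)
        = t • (X - ((N' + N'' : ℕ) : ℝ) • Y) by
          intro X Y; simp only [Complex.real_smul]; push_cast; ring]
      rw [norm_smul, Real.norm_of_nonneg ht.le]
      calc _ ≤ t * (2 * (2 * Real.pi / (1 - α)) * B₀) := by gcongr
        _ = _ := by ring
    · rw [Set.indicator_of_notMem (show t ∉ Set.Ioc (0 : ℝ) N from fun h => htN h.2)]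
      simp [Set.indicator_of_notMem (show t ∉ Set.Iic (N : ℝ) from htN)]
  · rw [setIntegral_indicator measurableSet_Ioc,
      Set.inter_eq_right.2 (show Set.Ioc (0 : ℝ) N ⊆ Set.Ioi 0 from fun x hx => hx.1),
      integral_const_mul, ← intervalIntegral.integral_of_le hN'.le, integral_id]
    have : (0:ℝ) ≤ 4 * Real.pi / (1 - α) * B₀ := by positivity
    have := mul_nonneg this (sq_nonneg (N : ℝ))
    linarith

end Model

/-! ### The pair sum as a sum over sheets, lattice vectors and grid points. -/

section Empirical

theorem eq_sheetLog (r : ℂ) : r = sheetLog ⌊r.im / (2 * Real.pi)⌋ (Complex.exp r) := by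
  have hpi := Real.two_pi_pos
  set k := ⌊r.im / (2 * Real.pi)⌋ with hk
  have h1 : (k : ℝ) ≤ r.im / (2 * Real.pi) := Int.floor_le _
  have h2 : r.im / (2 * Real.pi) < k + 1 := Int.lt_floor_add_one _
  rw [le_div_iff₀ hpi] at h1
  rw [div_lt_iff₀ hpi] at h2
  have him : (r - 2 * Real.pi * k * Complex.I).im = r.im - k * (2 * Real.pi) := by
    simp; ring
  have : r - 2 * Real.pi * k * Complex.I = logPos (Complex.exp r) := by
    refine logPos_unique ?_ (by rw [him]; linarith) (by rw [him]; linarith)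
    have : (2 * Real.pi * k * Complex.I : ℂ) = k * (2 * Real.pi * Complex.I) := by ring
    rw [Complex.exp_sub, this, Complex.exp_int_mul_two_pi_mul_I, div_one]
  rw [sheetLog, ← this]; ring

theorem sheet_bounds {N' N'' : ℕ} {r : ℂ} (h1 : -(2 * Real.pi * N') ≤ r.im)
    (h2 : r.im < 2 * Real.pi * N'') :
    ∃ j ∈ Finset.range (N' + N''), r = sheetLog ((j : ℤ) - N') (Complex.exp r) := by
  have hpi := Real.two_pi_pos
  have h3 : -(N' : ℤ) ≤ ⌊r.im / (2 * Real.pi)⌋ := by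
    rw [Int.le_floor, le_div_iff₀ hpi]; push_cast; linarith
  have h4 : ⌊r.im / (2 * Real.pi)⌋ < N'' := by
    rw [Int.floor_lt, div_lt_iff₀ hpi]; push_cast; linarith
  refine ⟨(⌊r.im / (2 * Real.pi)⌋ + N').toNat, Finset.mem_range.2 (by omega), ?_⟩
  have h5 : (((⌊r.im / (2 * Real.pi)⌋ + N').toNat : ℕ) : ℤ) - N' = ⌊r.im / (2 * Real.pi)⌋ := by
    omega
  rw [h5]
  exact eq_sheetLog r

theorem im_sheetLog_mem {N' N'' j : ℕ} (hj : j ∈ Finset.range (N' + N'')) (z : ℂ) :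
    -(2 * Real.pi * N') ≤ (sheetLog ((j : ℤ) - N') z).im ∧
      (sheetLog ((j : ℤ) - N') z).im < 2 * Real.pi * N'' := by
  have hj' : (j : ℝ) + 1 ≤ N' + N'' := by exact_mod_cast Finset.mem_range.1 hj
  have hj0 : (0 : ℝ) ≤ j := j.cast_nonneg
  have hpi := Real.two_pi_pos
  rw [im_sheetLog]
  push_cast
  constructor
  · nlinarith [im_logPos_nonneg z]
  · nlinarith [im_logPos_lt z]

theorem sheetLog_injective {k k' : ℤ} {z z' : ℂ} (hz : z ≠ 0) (hz' : z' ≠ 0)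
    (h : sheetLog k z = sheetLog k' z') : k = k' ∧ z = z' := by
  have h1 : z = z' := by rw [← exp_sheetLog k hz, h, exp_sheetLog k' hz']
  subst h1
  refine ⟨?_, rfl⟩
  have h2 := congrArg Complex.im h
  rw [im_sheetLog, im_sheetLog] at h2
  have h3 : 2 * Real.pi * (k : ℝ) = 2 * Real.pi * k' := by linarith
  exact_mod_cast mul_left_cancel₀ Real.two_pi_pos.ne' h3

variable {L : Submodule ℤ ℂ} [DiscreteTopology L] {Λ : Set ℂ}

theorem IsGrid.finite_inter (hΛ : IsGrid L Λ) (R : ℝ) : {m : ℂ | m ∈ Λ ∧ ‖m‖ ≤ R}.Finite := by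
  obtain ⟨z₀, rfl⟩ := hΛ
  refine ((finite_lattice_ball L (R + ‖z₀‖)).image (fun p => z₀ + p)).subset ?_
  rintro _ ⟨⟨p, hp, rfl⟩, hR⟩
  refine ⟨p, ⟨hp, ?_⟩, rfl⟩
  calc ‖p‖ = ‖z₀ + p - z₀‖ := by congr 1; ring
    _ ≤ _ := (norm_sub_le _ _).trans (by gcongr)

theorem IsGrid.exists_norm_ge (hΛ : IsGrid L Λ) :
    ∃ c : ℝ, 0 < c ∧ ∀ m ∈ Λ, m ≠ 0 → c ≤ ‖m‖ := by
  have hfin : {m : ℂ | m ∈ Λ ∧ ‖m‖ ≤ 1 ∧ m ≠ 0}.Finite :=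
    (hΛ.finite_inter 1).subset fun m h => ⟨h.1, h.2.1⟩
  rcases Set.eq_empty_or_nonempty {m : ℂ | m ∈ Λ ∧ ‖m‖ ≤ 1 ∧ m ≠ 0} with h | h
  · refine ⟨1, one_pos, fun m hm hm0 => ?_⟩
    by_contra! h'
    have : m ∈ {m : ℂ | m ∈ Λ ∧ ‖m‖ ≤ 1 ∧ m ≠ 0} := ⟨hm, h'.le, hm0⟩
    rw [h] at this; exact this
  · obtain ⟨q, hq, hmin⟩ := Set.exists_min_image _ (fun m => ‖m‖) hfin h
    refine ⟨‖q‖, norm_pos_iff.2 hq.2.2, fun m hm hm0 => ?_⟩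
    rcases le_total ‖m‖ 1 with h' | h'
    · exact hmin m ⟨hm, h', hm0⟩
    · exact hq.2.1.trans h'

theorem finite_isAdmissible (hΛ : IsGrid L Λ) (N N' N'' : ℕ) :
    {r | IsAdmissible Λ N N' N'' r}.Finite := by
  refine (((Finset.range (N' + N'')).finite_toSet.prod (hΛ.finite_inter N)).image
    (fun x : ℕ × ℂ => sheetLog ((x.1 : ℤ) - N') x.2)).subset ?_
  rintro r ⟨h1, h2, h3, h4⟩
  obtain ⟨j, hj, hr⟩ := sheet_bounds h3 h4
  exact ⟨(j, Complex.exp r), ⟨hj, h1, h2⟩, hr.symm⟩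

theorem finite_pairSet (hΛ : IsGrid L Λ) (N N' N'' : ℕ) : (pairSet Λ N N' N'').Finite :=
  ((finite_isAdmissible hΛ N N' N'').prod (finite_isAdmissible hΛ N N' N'')).subset
    fun _ h => ⟨h.1, h.2.1⟩

theorem isFiniteMeasure_empirical (hΛ : IsGrid L Λ) (α : ℝ) (φ : ℕ → ℝ) (N N' N'' : ℕ) :
    IsFiniteMeasure (empirical α Λ φ N N' N'') := by
  have : Finite (pairSet Λ N N' N'') := (finite_pairSet hΛ N N' N'').to_subtype
  have := Fintype.ofFinite (pairSet Λ N N' N'')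
  unfold empirical
  rw [Measure.sum_fintype]
  exact Measure.smul_finite _ ENNReal.ofReal_ne_top

theorem integral_empirical (hΛ : IsGrid L Λ) (α : ℝ) (φ : ℕ → ℝ) (N N' N'' : ℕ) (f : ℂ → ℂ) :
    ∫ z, f z ∂(empirical α Λ φ N N' N'') =
      ((1 / (((N' : ℝ) + N'') * renorm α φ N) : ℝ) : ℂ) *
        ∑' q : pairSet Λ N N' N'', f ((φ N : ℂ) *
          (Complex.exp (α * (q : ℂ × ℂ).2) - Complex.exp (α * (q : ℂ × ℂ).1))) := by
  have : Finite (pairSet Λ N N' N'') := (finite_pairSet hΛ N N' N'').to_subtype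
  have := Fintype.ofFinite (pairSet Λ N N' N'')
  have h0 : 0 ≤ 1 / (((N' : ℝ) + N'') * renorm α φ N) := by
    unfold renorm; positivity
  unfold empirical
  rw [integral_smul_measure, Measure.sum_fintype,
    integral_finsetSum_measure (fun i _ => integrable_dirac (by simp)), tsum_fintype]
  simp only [integral_dirac]
  rw [ENNReal.toReal_ofReal h0, Complex.real_smul]

variable {α A B₀ B₁ s c d : ℝ} {f : ℂ → ℂ} {z₀ : ℂ}

/-- The pair correlation sum as a sum over sheets, lattice vectors and grid points. -/
theorem tsum_pairSet_eq (hΛ : Λ = {w : ℂ | ∃ p ∈ L, w = z₀ + p}) {φ : ℝ} (N N' N'' : ℕ)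
    (hc : ∀ m ∈ Λ, m ≠ 0 → c ≤ ‖m‖) (h : Regime α A s c d φ) (hf : IsTest A B₀ B₁ f) :
    {x : (Finset.range (N' + N'') × puncturedBall L (4 * A / α / (φ / (N : ℝ) ^ (1 - α)))) × L |
      pairTerm α φ f N N' N'' ((x.1.1 : ℤ) - N') x.1.2 (z₀ + x.2) ≠ 0}.Finite ∧
    ∑' q : pairSet Λ N N' N'', f ((φ : ℂ) *
          (Complex.exp (α * (q : ℂ × ℂ).2) - Complex.exp (α * (q : ℂ × ℂ).1))) =
      ∑ j ∈ Finset.range (N' + N''),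
        ∑ p ∈ puncturedBall L (4 * A / α / (φ / (N : ℝ) ^ (1 - α))),
          ∑' l : L, pairTerm α φ f N N' N'' ((j : ℤ) - N') p (z₀ + l) := by
  set P := 4 * A / α / (φ / (N : ℝ) ^ (1 - α)) with hP
  set g : (Finset.range (N' + N'') × puncturedBall L P) × L → ℂ := fun x =>
    pairTerm α φ f N N' N'' ((x.1.1 : ℤ) - N') x.1.2 (z₀ + x.2) with hg
  set F : pairSet Λ N N' N'' → ℂ := fun q => f ((φ : ℂ) *
          (Complex.exp (α * (q : ℂ × ℂ).2) - Complex.exp (α * (q : ℂ × ℂ).1))) with hF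
  set e : (Finset.range (N' + N'') × puncturedBall L P) × L → ℂ × ℂ := fun x =>
    (sheetLog ((x.1.1 : ℤ) - N') (z₀ + x.2),
      sheetLog ((x.1.1 : ℤ) - N') (z₀ + x.2)
        + Complex.log ((z₀ + x.2 + x.1.2) / (z₀ + x.2))) with he
  have hcond : ∀ x, g x ≠ 0 → (z₀ + x.2 ≠ 0 ∧ z₀ + x.2 + x.1.2 ≠ 0) ∧
      e x ∈ pairSet Λ N N' N'' ∧ f ((φ : ℂ) *
          (Complex.exp (α * (e x).2) - Complex.exp (α * (e x).1))) = g x := by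
    intro x hx
    have hx0 := hx
    simp only [hg, pairTerm] at hx
    rw [ite_ne_right_iff] at hx
    obtain ⟨⟨h1, h2, h3, h4, h5, h6⟩, -⟩ := hx
    have hexp1 : Complex.exp (e x).1 = z₀ + x.2 := exp_sheetLog _ h1
    have hexp2 : Complex.exp (e x).2 = z₀ + x.2 + x.1.2 := by
      simp only [he]
      rw [Complex.exp_add, exp_sheetLog _ h1, Complex.exp_log (div_ne_zero h2 h1),
        mul_div_cancel₀ _ h1]
    have hp := mem_puncturedBall.1 x.1.2.2
    refine ⟨⟨h1, h2⟩, ⟨⟨?_, ?_, ?_⟩, ⟨?_, ?_, h5, h6⟩, ?_, ?_⟩, ?_⟩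
    · rw [hexp1, hΛ]; exact ⟨x.2, x.2.2, rfl⟩
    · rw [hexp1]; exact h3
    · exact im_sheetLog_mem x.1.1.2 _
    · rw [hexp2, hΛ]; exact ⟨x.2 + x.1.2, L.add_mem x.2.2 hp.1, by ring⟩
    · rw [hexp2]; exact h4
    · rw [hexp1, hexp2]; simpa using hp.2.1
    · simp only [he, Complex.add_im, sub_add_cancel_left, abs_neg, Complex.log_im]
      linarith [Complex.abs_arg_le_pi ((z₀ + x.2 + x.1.2) / (z₀ + x.2)), Real.pi_pos]
    · simp only [hg, pairTerm, he]
      rw [if_pos ⟨h1, h2, h3, h4, h5, h6⟩]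
  -- The first logarithm determines the sheet and the grid point; the exponential of the second then
  -- determines `p`.
  have hinj : Set.InjOn e (Function.support g) := by
    intro x hx y hy hxy
    obtain ⟨⟨h1, h2⟩, -⟩ := hcond x hx
    obtain ⟨⟨h3, h4⟩, -⟩ := hcond y hy
    obtain ⟨h5, h6⟩ := sheetLog_injective h1 h3 (congrArg Prod.fst hxy)
    have h7 := congrArg (fun q : ℂ × ℂ => Complex.exp q.2) hxy
    simp only [he] at h7
    rw [Complex.exp_add, exp_sheetLog _ h1, Complex.exp_log (div_ne_zero h2 h1),
        mul_div_cancel₀ _ h1, Complex.exp_add, exp_sheetLog _ h3,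
        Complex.exp_log (div_ne_zero h4 h3), mul_div_cancel₀ _ h3] at h7
    have h8 : x.2 = y.2 := Subtype.ext (add_left_cancel h6)
    rw [h8] at h7
    have h9 : x.1.2 = y.1.2 := Subtype.ext (add_left_cancel h7)
    have h10 : x.1.1 = y.1.1 := by
      apply Subtype.ext
      have : ((x.1.1 : ℕ) : ℤ) = (y.1.1 : ℕ) := by linarith
      exact_mod_cast this
    exact Prod.ext (Prod.ext h10 h9) h8
  have hfin : (Function.support g).Finite := by
    refine Set.Finite.of_finite_image ((finite_pairSet ⟨z₀, hΛ⟩ N N' N'').subset ?_) hinj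
    rintro _ ⟨x, hx, rfl⟩
    exact (hcond x hx).2.1
  refine ⟨hfin, ?_⟩
  have hsum : ∑' q, F q = ∑' x, g x := by
    refine tsum_eq_tsum_of_ne_zero_bij (fun x : Function.support g =>
      (⟨e x, (hcond x x.2).2.1⟩ : pairSet Λ N N' N'')) ?_ ?_ ?_
    · intro x y hxy
      exact Subtype.ext (hinj x.2 y.2 (congrArg Subtype.val hxy))
    · rintro ⟨⟨r, t⟩, ⟨⟨h1, h2, h3, h4⟩, ⟨h5, h6, h7, h8⟩, h9, h10⟩⟩ hq
      simp only at h1 h2 h3 h4 h5 h6 h7 h8 h9 h10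
      obtain ⟨j, hj, hr⟩ := sheet_bounds h3 h4
      -- A non-zero value of `f` triggers the separation lemma: `t - r` is short, hence is the
      -- principal logarithm of its exponential, and the pair lies in the range of `e`.
      have hA : ‖(φ : ℂ) * (Complex.exp (α * (r + (t - r))) - Complex.exp (α * r))‖ < A := by
        by_contra! h'
        refine hq (hf.eq_zero _ ?_)
        rwa [add_sub_cancel] at h'
      obtain ⟨h11, h12⟩ := h.separation (hc _ h1 (Complex.exp_ne_zero r)) (w := t - r)
        (by rw [Complex.sub_im, abs_sub_comm]; exact h10) hA
      rw [add_sub_cancel] at h12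
      have hwim := (Complex.abs_im_le_norm (t - r)).trans h11
      have hpi := Real.pi_gt_three
      have hw : Complex.log (Complex.exp (t - r)) = t - r :=
        Complex.log_exp (by linarith [(abs_le.1 hwim).1]) (by linarith [(abs_le.1 hwim).2])
      have h1' := h1
      rw [hΛ] at h1' h5
      obtain ⟨l, hl, hl'⟩ := h1'
      obtain ⟨l', hl2, hl2'⟩ := h5
      have hp : Complex.exp t - Complex.exp r ∈ puncturedBall L P := by
        refine mem_puncturedBall.2 ⟨?_, sub_ne_zero.2 h9.symm, ?_⟩
        · rw [hl', hl2', add_sub_add_left_eq_sub]; exact L.sub_mem hl2 hl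
        · have hR : 0 < ‖Complex.exp r‖ := norm_pos_iff.2 (Complex.exp_ne_zero r)
          have hN0 : (0 : ℝ) < N := hR.trans_le h2
          -- The exponent `α - 1` is negative, so the weakest constraint on `p` occurs at modulus
          -- `N`; this is the origin of the radius `P`.
          have h13 : (N : ℝ) ^ (α - 1) ≤ ‖Complex.exp r‖ ^ (α - 1) :=
            Real.rpow_le_rpow_of_nonpos hR h2 (by linarith [h.α_lt])
          have h14 : φ / (N : ℝ) ^ (1 - α) = φ * (N : ℝ) ^ (α - 1) := by
            rw [div_eq_mul_inv, ← Real.rpow_neg hN0.le]; congr 2; ring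
          have hφ0 := h.φ_pos
          rw [hP, le_div_iff₀ (by positivity), h14]
          calc _ = φ * ‖Complex.exp t - Complex.exp r‖ * (N : ℝ) ^ (α - 1) := by ring
            _ ≤ φ * ‖Complex.exp t - Complex.exp r‖ * ‖Complex.exp r‖ ^ (α - 1) := by gcongr
            _ ≤ _ := h12
      have hd1 : (z₀ + l + (Complex.exp t - Complex.exp r)) / (z₀ + l) = Complex.exp (t - r) := by
        rw [← hl', add_sub_cancel, Complex.exp_sub]
      have hex : e ((⟨j, hj⟩, ⟨_, hp⟩), ⟨l, hl⟩) = (r, t) := by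
        simp only [he]
        rw [hd1, hw, ← hl', ← hr, add_sub_cancel]
      have hgx : g ((⟨j, hj⟩, ⟨_, hp⟩), ⟨l, hl⟩) = f ((φ : ℂ) *
          (Complex.exp (α * t) - Complex.exp (α * r))) := by
        simp only [hg, pairTerm]
        rw [hd1, hw, ← hl', ← hr, add_sub_cancel, add_sub_cancel, if_pos]
        exact ⟨Complex.exp_ne_zero _, Complex.exp_ne_zero _, h2, h6, h7, h8⟩
      refine ⟨⟨((⟨j, hj⟩, ⟨_, hp⟩), ⟨l, hl⟩), ?_⟩, ?_⟩
      · rw [Function.mem_support, hgx]; exact hq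
      · exact Subtype.ext hex
    · intro x
      exact (hcond x x.2).2.2
  have hsg : Summable g := summable_of_hasFiniteSupport hfin
  rw [hsum, hsg.tsum_prod, tsum_fintype, Fintype.sum_prod_type, Finset.univ_eq_attach,
    Finset.sum_attach (Finset.range (N' + N'')) (fun j => ∑ p : puncturedBall L P,
      ∑' l : L, pairTerm α φ f N N' N'' ((j : ℤ) - N') p (z₀ + l))]
  refine Finset.sum_congr rfl fun j _ => ?_
  rw [Finset.univ_eq_attach, Finset.sum_attach (puncturedBall L P) (fun p =>
      ∑' l : L, pairTerm α φ f N N' N'' ((j : ℤ) - N') p (z₀ + l))]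

end Empirical

/-! ### Reduction of the empirical measure to a lattice sum. -/

section Core

variable {L : Submodule ℤ ℂ} [DiscreteTopology L] {Λ : Set ℂ}
variable {α A B₀ B₁ s c d : ℝ} {f : ℂ → ℂ} {z₀ : ℂ}

/-- The lattice sum to which the pair correlation integrals are compared, with
`τ = φ(N) / N^(1-α)` and summation over `0 < ‖p‖ ≤ R`. -/
def latticeSum (α : ℝ) (L : Submodule ℤ ℂ) [DiscreteTopology L] (f : ℂ → ℂ) (τ R : ℝ) : ℂ :=
  ((τ ^ 2 / ZLattice.covolume L : ℝ) : ℂ) * ∑ p ∈ puncturedBall L R, diskAverage α f (τ * p)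

theorem renorm_eq {φ : ℕ → ℝ} {N : ℕ} (hN : 0 < N) (hφ : 0 < φ N) :
    renorm α φ N = ((N : ℝ) / (φ N / (N : ℝ) ^ (1 - α))) ^ 2 := by
  have hN' : (0 : ℝ) < N := by exact_mod_cast hN
  unfold renorm
  congr 1
  rw [show 2 - α = 1 + (1 - α) by ring, Real.rpow_add hN', Real.rpow_one]
  field_simp

/-- This estimate treats all scalings with `τ` arbitrary; the limit of `τ` is used only later. Two
errors enter: cell comparison for each sheet and vector, and the incomplete last period in the
angular average. -/
theorem exists_core_estimate [IsZLattice ℝ L] (hΛ : IsGrid L Λ) (hα0 : 0 < α) (hα1 : α < 1) :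
    ∃ C c d : ℝ, 0 < C ∧ 0 < c ∧ 0 < d ∧ ∀ (φ : ℕ → ℝ) (A B₀ B₁ : ℝ) (f : ℂ → ℂ) (N N' N'' : ℕ),
      1 ≤ A → Regime α A (systole L) c d (φ N) → 4 * A / α * (1 + d / systole L) ≤ φ N →
      IsTest A B₀ B₁ f → Measurable f → 0 ≤ B₁ → 0 < N → 0 < N' + N'' →
      ‖∫ z, f z ∂(empirical α Λ φ N N' N'')
        - latticeSum α L f (φ N / (N : ℝ) ^ (1 - α)) (4 * A / α / (φ N / (N : ℝ) ^ (1 - α)))‖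
        ≤ C * (B₀ + B₁) * (A ^ 4 * (1 / ((N : ℝ) ^ α * φ N)) + A ^ 2 * (1 / ((N' : ℝ) + N''))) := by
  obtain ⟨d, hd, hcell⟩ := exists_cell_comparison L
  obtain ⟨C₂, hC₂, hcard⟩ := exists_card_puncturedBall_le L
  obtain ⟨c, hc, hcmin⟩ := hΛ.exists_norm_ge
  obtain ⟨z₀, hz₀⟩ := hΛ
  have hs := systole_pos L
  have hcov := ZLattice.covolume_pos L volume
  have hβ : 0 < 1 - α := by linarith
  have hpi := Real.pi_pos
  set s := systole L
  set V := ZLattice.covolume L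
  -- With `P = 4A/(ατ)`, the count `C₂ P²` times the cell error of order `N P A`, normalized by
  -- `τ²/N²`, gives `A⁴/(τN)`. The angular error of order `N²`, normalized by `τ²/(H N²)`, gives
  -- `A²/H`.
  set K₁ := C₂ * (4 / α) ^ 3 * (1 + d / s) * (60 + 13 * (24 / α)) / V with hK₁
  set K₂ := C₂ * (4 / α) ^ 2 * (4 * Real.pi / (1 - α)) / V with hK₂
  have hK₁0 : 0 < K₁ := by positivity
  have hK₂0 : 0 < K₂ := by positivity
  refine ⟨K₁ + K₂, c, d, by positivity, hc, hd, ?_⟩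
  intro φ A B₀ B₁ f N N' N'' hA hreg hwide hf hfm hB₁ hN hH
  have hB₀ : 0 ≤ B₀ := (norm_nonneg _).trans (hf.norm_le 0)
  have hA0 : 0 < A := hreg.A_pos
  have hφ := hreg.φ_pos
  have hN' : (0 : ℝ) < N := by exact_mod_cast hN
  have hN1 : (1 : ℝ) ≤ N := by exact_mod_cast hN
  set τ := φ N / (N : ℝ) ^ (1 - α) with hτ
  have hτ0 : 0 < τ := by positivity
  set P := 4 * A / α / τ with hP
  have hP0 : 0 < P := by positivity
  set H : ℝ := (N' : ℝ) + N'' with hHdef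
  have hH0 : 0 < H := by rw [hHdef]; exact_mod_cast hH
  have hτN : τ * N = (N : ℝ) ^ α * φ N := by
    have : (N : ℝ) = N ^ α * (N : ℝ) ^ (1 - α) := by
      rw [← Real.rpow_add hN']; simp
    rw [hτ, div_mul_eq_mul_div, div_eq_iff (by positivity)]
    conv_lhs => rw [this]
    ring
  -- This ensures `D = ‖p‖ + d ≤ N` for every relevant `p`, as the area bound on the bad set
  -- requires.
  have hPN : P * (1 + d / s) ≤ N := by
    have h1 : φ N ≤ τ * N := by
      rw [hτN]
      exact le_mul_of_one_le_left hφ.le (Real.one_le_rpow hN1 hα0.le)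
    rw [hP, div_mul_eq_mul_div, div_le_iff₀ hτ0]
    linarith
  obtain ⟨hfin, hsum⟩ := tsum_pairSet_eq hz₀ N N' N''  hcmin hreg hf
  rw [integral_empirical ⟨z₀, hz₀⟩, hsum, renorm_eq hN hφ]
  set T : ℕ → ℂ → ℂ := fun j p =>
    ∑' l : L, pairTerm α (φ N) f N N' N'' ((j : ℤ) - N') p (z₀ + l) with hT
  set Q : ℕ → ℂ → ℂ := fun j p => ∫ z, modelTerm α (φ N) f N ((j : ℤ) - N') p z with hQ
  have hTQ : ∀ j ∈ Finset.range (N' + N''), ∀ p ∈ puncturedBall L P,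
      ‖(V : ℂ) * T j p - Q j p‖ ≤ N * ((1 + d / s) * P) * (60 + 13 * (24 / α)) * A * (B₀ + B₁) := by
    intro j hj p hp
    have hp' := mem_puncturedBall.1 hp
    have hsp := systole_le L hp'.1 hp'.2.1
    have hD0 : 0 ≤ ‖p‖ + d := by positivity
    have hDP : ‖p‖ + d ≤ (1 + d / s) * P := by
      have h1 : d ≤ d / s * ‖p‖ := by
        rw [div_mul_eq_mul_div, le_div_iff₀ hs]; gcongr
      calc ‖p‖ + d ≤ (1 + d / s) * ‖p‖ := by linarith
        _ ≤ _ := by gcongr; exact hp'.2.2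
    have hE0 : 0 ≤ 24 / α * (A * B₁ * (‖p‖ + d)) := by positivity
    obtain ⟨hEi, hEle⟩ := integral_pointError_le (B₀ := B₀) (N := N) hB₀ hE0 hD0
      (by linarith)
    have hj' := Finset.mem_range.1 hj
    have h1 := hcell z₀ (pairTerm α (φ N) f N N' N'' ((j : ℤ) - N') p)
      (modelTerm α (φ N) f N ((j : ℤ) - N') p)
      (pointError B₀ N (‖p‖ + d) (24 / α * (A * B₁ * (‖p‖ + d))))
      (integrable_of_bounded_of_eq_zero (B := B₀) (R := N) (measurable_modelTerm hfm N _ p)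
        (fun z => norm_modelTerm_le hf)
        (fun z hz => Set.indicator_of_notMem (by rintro ⟨h, -⟩; simp at h; linarith) _))
      hEi (by
        refine Set.Finite.of_finite_image (f := fun l : L =>
          (((⟨j, hj⟩ : Finset.range (N' + N'')), (⟨p, hp⟩ : puncturedBall L P)), l))
          (hfin.subset ?_) ?_
        · rintro _ ⟨l, hl, rfl⟩; exact hl
        · intro x _ y _ hxy; exact congrArg Prod.snd hxy)
      (fun l z hz => norm_pairTerm_sub_modelTerm_le hreg hf (by omega) (by omega) hB₁ hp'.2.1 hsp
        (fun h0 => hcmin _ (by rw [hz₀]; exact ⟨l, l.2, rfl⟩) h0) hz)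
    refine (h1.trans hEle).trans ?_
    calc 60 * B₀ * (N * (‖p‖ + d)) + 13 * N * (24 / α * (A * B₁ * (‖p‖ + d)))
        = N * (‖p‖ + d) * (60 * (1 * B₀) + 13 * (24 / α) * (A * B₁)) := by ring
      _ ≤ N * ((1 + d / s) * P) * (60 * (A * (B₀ + B₁))
          + 13 * (24 / α) * (A * (B₀ + B₁))) := by gcongr <;> linarith
      _ = _ := by ring
  have hQh : ∀ p : ℂ, ‖(∑ j ∈ Finset.range (N' + N''), Q j p)
      - (H : ℂ) * ((N : ℂ) ^ 2 * diskAverage α f (τ * p))‖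
      ≤ 4 * Real.pi / (1 - α) * B₀ * (N : ℝ) ^ 2 := by
    intro p
    have := norm_sum_modelTerm_sub_le (φ := φ N) hα1 hfm hf.norm_le hN N' N'' p
    rw [show ((N' + N'' : ℕ) : ℂ) = (H : ℂ) by rw [hHdef]; push_cast; ring] at this
    exact this
  have hcardP : ((puncturedBall L P).card : ℝ) ≤ C₂ * P ^ 2 := hcard P hP0.le
  -- the error before normalization
  have hmain : ‖(V : ℂ) * (∑ j ∈ Finset.range (N' + N''), ∑ p ∈ puncturedBall L P, T j p)
      - (H : ℂ) * ((N : ℂ) ^ 2 * ∑ p ∈ puncturedBall L P, diskAverage α f (τ * p))‖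
      ≤ C₂ * P ^ 2 * (H * (N * ((1 + d / s) * P) * (60 + 13 * (24 / α)) * A * (B₀ + B₁))
        + 4 * Real.pi / (1 - α) * B₀ * (N : ℝ) ^ 2) := by
    have h1 : (V : ℂ) * (∑ j ∈ Finset.range (N' + N''), ∑ p ∈ puncturedBall L P, T j p)
      - (H : ℂ) * ((N : ℂ) ^ 2 * ∑ p ∈ puncturedBall L P, diskAverage α f (τ * p))
      = ∑ p ∈ puncturedBall L P, ((∑ j ∈ Finset.range (N' + N''), ((V : ℂ) * T j p - Q j p))
        + ((∑ j ∈ Finset.range (N' + N''), Q j p)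
          - (H : ℂ) * ((N : ℂ) ^ 2 * diskAverage α f (τ * p)))) := by
      rw [Finset.sum_comm, Finset.mul_sum, Finset.mul_sum, Finset.mul_sum,
        ← Finset.sum_sub_distrib]
      refine Finset.sum_congr rfl fun p _ => ?_
      rw [Finset.sum_sub_distrib, Finset.mul_sum]; ring
    have h2 : ∀ p ∈ puncturedBall L P,
        ‖(∑ j ∈ Finset.range (N' + N''), ((V : ℂ) * T j p - Q j p))
        + ((∑ j ∈ Finset.range (N' + N''), Q j p)
          - (H : ℂ) * ((N : ℂ) ^ 2 * diskAverage α f (τ * p)))‖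
        ≤ H * (N * ((1 + d / s) * P) * (60 + 13 * (24 / α)) * A * (B₀ + B₁))
        + 4 * Real.pi / (1 - α) * B₀ * (N : ℝ) ^ 2 := by
      intro p hp
      refine (norm_add_le _ _).trans (add_le_add ?_ (hQh p))
      refine (norm_sum_le_of_le _ fun j hj => hTQ j hj p hp).trans (le_of_eq ?_)
      rw [Finset.sum_const, Finset.card_range, nsmul_eq_mul, hHdef]; push_cast; ring
    rw [h1]
    refine (norm_sum_le_of_le _ h2).trans ?_
    rw [Finset.sum_const, nsmul_eq_mul]
    gcongr
  unfold latticeSum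
  have hfac : (((1 / (H * (N / τ) ^ 2) : ℝ)) : ℂ) *
        (∑ j ∈ Finset.range (N' + N''), ∑ p ∈ puncturedBall L P, T j p)
      - ((τ ^ 2 / V : ℝ) : ℂ) * ∑ p ∈ puncturedBall L P, diskAverage α f (τ * p)
      = ((τ ^ 2 / (H * N ^ 2 * V) : ℝ) : ℂ) *
        ((V : ℂ) * (∑ j ∈ Finset.range (N' + N''), ∑ p ∈ puncturedBall L P, T j p)
      - (H : ℂ) * ((N : ℂ) ^ 2 * ∑ p ∈ puncturedBall L P, diskAverage α f (τ * p))) := by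
    have e1 : (V : ℂ) ≠ 0 := by exact_mod_cast hcov.ne'
    have e2 : (H : ℂ) ≠ 0 := by exact_mod_cast hH0.ne'
    have e3 : (N : ℂ) ≠ 0 := by exact_mod_cast hN.ne'
    have e4 : (τ : ℂ) ≠ 0 := by exact_mod_cast hτ0.ne'
    generalize (∑ j ∈ Finset.range (N' + N''), ∑ p ∈ puncturedBall L P, T j p) = X
    generalize ∑ p ∈ puncturedBall L P, diskAverage α f (τ * p) = Y
    push_cast
    field_simp
  rw [hfac, norm_mul, Complex.norm_real, Real.norm_of_nonneg (by positivity)]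
  calc _ ≤ τ ^ 2 / (H * N ^ 2 * V) * (C₂ * P ^ 2 *
        (H * (N * ((1 + d / s) * P) * (60 + 13 * (24 / α)) * A * (B₀ + B₁))
        + 4 * Real.pi / (1 - α) * B₀ * (N : ℝ) ^ 2)) :=
        mul_le_mul_of_nonneg_left hmain (by positivity)
    _ = K₁ * (B₀ + B₁) * (A ^ 4 * (1 / (τ * N))) + K₂ * B₀ * (A ^ 2 * (1 / H)) := by
      rw [hK₁, hK₂, hP]; field_simp
    _ ≤ (K₁ + K₂) * (B₀ + B₁) * (A ^ 4 * (1 / (τ * N)))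
        + (K₁ + K₂) * (B₀ + B₁) * (A ^ 2 * (1 / H)) := by gcongr <;> linarith
    _ = _ := by rw [hτN]; ring

end Core

/-! ### Regularity, support and total integral of the disk average. -/

section DiskAverage

variable {α A B₀ B₁ : ℝ} {f : ℂ → ℂ}

theorem IsTest.continuous (hf : IsTest A B₀ B₁ f) (hB₁ : 0 ≤ B₁) : Continuous f :=
  (LipschitzWith.of_dist_le_mul (K := ⟨B₁, hB₁⟩) fun x y => by
    rw [dist_eq_norm, dist_eq_norm]; exact hf.lipschitz x y).continuous

theorem integrableOn_diskAverage (hf : Measurable f) (hB : ∀ z, ‖f z‖ ≤ B₀) (q : ℂ) :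
    IntegrableOn (fun w : ℂ => f (α * q * ((‖w‖ ^ (α - 2) : ℝ) * w))) (Metric.closedBall 0 1) := by
  refine Measure.integrableOn_of_bounded (M := B₀) Metric.isBounded_closedBall.measure_lt_top.ne
    (hf.comp ?_).aestronglyMeasurable (ae_of_all _ fun _ => hB _)
  fun_prop

theorem norm_rpow_mul_self {w : ℂ} (hw : w ≠ 0) :
    ‖(((‖w‖ ^ (α - 2) : ℝ) : ℂ) * w)‖ = ‖w‖ ^ (α - 1) := by
  have : 0 < ‖w‖ := norm_pos_iff.2 hw
  rw [norm_mul, Complex.norm_real, Real.norm_of_nonneg (by positivity),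
    ← Real.rpow_add_one this.ne']
  congr 1; ring

theorem norm_diskAverage_le (hB : ∀ z, ‖f z‖ ≤ B₀) (q : ℂ) :
    ‖diskAverage α f q‖ ≤ Real.pi * B₀ := by
  have := norm_setIntegral_le_of_norm_le_const (μ := (volume : Measure ℂ))
    (s := Metric.closedBall (0 : ℂ) 1) (f := fun w : ℂ => f (α * q * ((‖w‖ ^ (α - 2) : ℝ) * w)))
    (C := B₀) Metric.isBounded_closedBall.measure_lt_top (fun w _ => hB _)
  rw [measureReal_def, Complex.volume_closedBall] at this
  simp only [ENNReal.ofReal_one, one_pow, one_mul, ENNReal.coe_toReal, NNReal.coe_real_pi] at this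
  rw [mul_comm]; exact this

/-- The Lipschitz constant of the integrand in `q` grows like `‖w‖^(α-1) ≤ ‖w‖⁻¹`, which is
integrable on the disk. -/
theorem norm_diskAverage_sub_le (hα0 : 0 < α) (hα1 : α < 1) (hf : IsTest A B₀ B₁ f)
    (hB₁ : 0 ≤ B₁) (q q' : ℂ) :
    ‖diskAverage α f q - diskAverage α f q'‖ ≤ 2 * Real.pi * B₁ * ‖q - q'‖ := by
  have hm := (hf.continuous hB₁).measurable
  obtain ⟨h1, h2⟩ := integral_indicator_div_norm (E := B₁ * ‖q - q'‖) (R := 1) zero_le_one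
  rw [integrable_indicator_iff measurableSet_closedBall] at h1
  rw [integral_indicator measurableSet_closedBall] at h2
  unfold diskAverage
  rw [← integral_sub (integrableOn_diskAverage hm hf.norm_le q)
    (integrableOn_diskAverage hm hf.norm_le q')]
  refine (norm_integral_le_of_norm_le h1 ?_).trans (by rw [h2]; apply le_of_eq; ring)
  refine (ae_restrict_iff' measurableSet_closedBall).2 (ae_of_all _ fun w hw => ?_)
  rw [mem_closedBall_zero_iff] at hw
  by_cases hw0 : w = 0
  · simp [hw0]
  have hwn : 0 < ‖w‖ := norm_pos_iff.2 hw0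
  refine (hf.lipschitz _ _).trans ?_
  rw [← sub_mul, ← mul_sub, norm_mul, norm_mul, norm_rpow_mul_self hw0, Complex.norm_real,
    Real.norm_of_nonneg hα0.le, mul_div_assoc]
  have h3 : ‖w‖ ^ (α - 1) ≤ ‖w‖⁻¹ := by
    rw [← Real.rpow_neg_one]
    exact Real.rpow_le_rpow_of_exponent_ge hwn hw (by linarith)
  calc B₁ * (α * ‖q - q'‖ * ‖w‖ ^ (α - 1)) ≤ B₁ * (1 * ‖q - q'‖ * ‖w‖⁻¹) := by gcongr
    _ = _ := by rw [div_eq_mul_inv]; ring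

/-- On the unit disk `‖w‖^(α-1) ≥ 1`, so the argument of `f` has modulus at least `α‖q‖`. This gives
`diskAverage` compact support. -/
theorem eq_zero_of_norm_ge (hα0 : 0 < α) (hα1 : α < 1) (hf : IsTest A B₀ B₁ f) {q w : ℂ}
    (hq : A ≤ α * ‖q‖) (hw : ‖w‖ ≤ 1) (hw0 : w ≠ 0) :
    f (α * q * ((‖w‖ ^ (α - 2) : ℝ) * w)) = 0 := by
  refine hf.eq_zero _ (hq.trans ?_)
  rw [norm_mul, norm_mul, norm_rpow_mul_self hw0, Complex.norm_real,
    Real.norm_of_nonneg hα0.le]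
  exact le_mul_of_one_le_right (by positivity)
    (Real.one_le_rpow_of_pos_of_le_one_of_nonpos (norm_pos_iff.2 hw0) hw (by linarith))

theorem diskAverage_eq_zero (hα0 : 0 < α) (hα1 : α < 1) (hf : IsTest A B₀ B₁ f) {q : ℂ}
    (hq : A ≤ α * ‖q‖) : diskAverage α f q = 0 := by
  refine integral_eq_zero_of_ae ((ae_restrict_iff' measurableSet_closedBall).2 ?_)
  filter_upwards [compl_mem_ae_iff.2 (measure_singleton (0 : ℂ))] with w hw0 hw
  exact eq_zero_of_norm_ge hα0 hα1 hf hq (by simpa using hw) hw0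

theorem continuous_diskAverage (hα0 : 0 < α) (hα1 : α < 1) (hf : IsTest A B₀ B₁ f)
    (hB₁ : 0 ≤ B₁) : Continuous (diskAverage α f) := by
  have := Real.pi_pos
  exact (LipschitzWith.of_dist_le_mul (K := ⟨2 * Real.pi * B₁, by positivity⟩) fun x y => by
    rw [dist_eq_norm, dist_eq_norm]
    exact norm_diskAverage_sub_le hα0 hα1 hf hB₁ x y).continuous

theorem integral_comp_complex_mul (f : ℂ → ℂ) {c : ℂ} (hc : c ≠ 0) :
    ∫ q, f (c * q) = ((‖c‖ ^ 2)⁻¹ : ℝ) • ∫ q, f q := by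
  have hcn : 0 < ‖c‖ := norm_pos_iff.2 hc
  let u : Circle := Circle.exp c.arg
  have h1 := (rotation u).measurePreserving.integral_comp' (f := (rotation u).toMeasurableEquiv) f
  have h2 := Measure.integral_comp_smul_of_nonneg (volume : Measure ℂ)
    (fun q => f (rotation u q)) ‖c‖ (hR := hcn.le)
  rw [Complex.finrank_real_complex] at h2
  have h3 : ∀ q : ℂ, rotation u (‖c‖ • q) = c * q := by
    intro q
    rw [rotation_apply, Complex.real_smul]
    conv_rhs => rw [← Complex.norm_mul_exp_arg_mul_I c]
    rw [Circle.coe_exp]; ring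
  simp only [h3] at h2
  rw [h2]
  congr 1

theorem integral_closedBall_rpow (hα1 : α < 1) :
    ∫ w in Metric.closedBall (0 : ℂ) 1, ‖w‖ ^ (2 - 2 * α) = Real.pi / (2 - α) := by
  rw [← integral_indicator measurableSet_closedBall]
  have h1 : (Metric.closedBall (0 : ℂ) 1).indicator (fun z => ‖z‖ ^ (2 - 2 * α))
      = fun z : ℂ => (Set.Iic (1 : ℝ)).indicator (fun t => t ^ (2 - 2 * α)) ‖z‖ := by
    ext z
    by_cases hz : ‖z‖ ≤ 1
    · rw [Set.indicator_of_mem (by simpa using hz), Set.indicator_of_mem (by simpa using hz)]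
    · rw [Set.indicator_of_notMem (by simpa using hz), Set.indicator_of_notMem (by simpa using hz)]
  have h2 : ∀ y ∈ Set.Ioi (0 : ℝ), y ^ (Module.finrank ℝ ℂ - 1) •
      (Set.Iic (1 : ℝ)).indicator (fun t => t ^ (2 - 2 * α)) y
      = (Set.Ioc 0 1).indicator (fun t => t ^ (3 - 2 * α)) y := by
    intro y hy
    have hy : 0 < y := hy
    rw [Complex.finrank_real_complex]
    by_cases hyR : y ≤ 1
    · rw [Set.indicator_of_mem (by simpa using hyR), Set.indicator_of_mem (by exact ⟨hy, hyR⟩),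
        show 3 - 2 * α = 2 - 2 * α + 1 by ring, Real.rpow_add_one hy.ne']
      simp; ring
    · rw [Set.indicator_of_notMem (by simpa using hyR), Set.indicator_of_notMem
        (by rintro ⟨-, h⟩; exact hyR h)]
      simp
  rw [h1, integral_fun_norm_addHaar, setIntegral_congr_fun measurableSet_Ioi h2,
      setIntegral_indicator measurableSet_Ioc, measureReal_def,
      Complex.volume_ball, Complex.finrank_real_complex]
  have : Set.Ioi (0 : ℝ) ∩ Set.Ioc 0 1 = Set.Ioc 0 1 :=
    Set.inter_eq_right.2 fun x hx => hx.1
  rw [this, ← intervalIntegral.integral_of_le zero_le_one, integral_rpow (Or.inl (by linarith))]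
  have h3 : 3 - 2 * α + 1 ≠ 0 := by linarith
  have h4 : 2 - α ≠ 0 := by linarith
  rw [Real.zero_rpow h3]
  simp
  field_simp
  ring

/-- By Fubini: for fixed `w`, the multiplication of `q` scales area by `α²‖w‖^(2α-2)`, and the mean
of the inverse factor over the disk is computed in `integral_closedBall_rpow`. -/
theorem integral_diskAverage (hα0 : 0 < α) (hα1 : α < 1) (hf : IsTest A B₀ B₁ f)
    (hB₁ : 0 ≤ B₁) :
    ∫ q, diskAverage α f q = ((Real.pi / (α ^ 2 * (2 - α)) : ℝ) : ℂ) * ∫ z, f z := by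
  have hm := (hf.continuous hB₁).measurable
  unfold diskAverage
  have hint : Integrable (Function.uncurry fun (q w : ℂ) => f (α * q * ((‖w‖ ^ (α - 2) : ℝ) * w)))
      ((volume : Measure ℂ).prod ((volume : Measure ℂ).restrict (Metric.closedBall 0 1))) := by
    have h1 : Measurable (Function.uncurry fun (q w : ℂ) =>
        f (α * q * ((‖w‖ ^ (α - 2) : ℝ) * w))) := by
      refine hm.comp ?_
      fun_prop
    have h2 : IntegrableOn (Function.uncurry fun (q w : ℂ) =>
        f (α * q * ((‖w‖ ^ (α - 2) : ℝ) * w))) (Metric.closedBall 0 (A / α) ×ˢ Set.univ)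
        ((volume : Measure ℂ).prod ((volume : Measure ℂ).restrict (Metric.closedBall 0 1))) := by
      refine Measure.integrableOn_of_bounded (M := B₀) ?_ h1.aestronglyMeasurable
        (ae_of_all _ fun _ => hf.norm_le _)
      rw [Measure.prod_prod, Measure.restrict_apply MeasurableSet.univ, Set.univ_inter]
      exact (ENNReal.mul_lt_top Metric.isBounded_closedBall.measure_lt_top
        Metric.isBounded_closedBall.measure_lt_top).ne
    rw [← integrableOn_univ]
    refine h2.of_ae_sdiff_eq_zero MeasurableSet.univ.nullMeasurableSet ?_
    have h3 : ∀ᵐ w ∂((volume : Measure ℂ).restrict (Metric.closedBall 0 1)), w ≠ 0 ∧ ‖w‖ ≤ 1 := by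
      refine (ae_restrict_iff' measurableSet_closedBall).2 ?_
      filter_upwards [compl_mem_ae_iff.2 (measure_singleton (0 : ℂ))] with w hw0 hw
      exact ⟨hw0, by simpa using hw⟩
    have h4 := (Measure.quasiMeasurePreserving_snd (μ := (volume : Measure ℂ))).ae h3
    filter_upwards [h4] with x hx hx'
    refine eq_zero_of_norm_ge hα0 hα1 hf ?_ hx.2 hx.1
    have h5 : ¬ ‖x.1‖ ≤ A / α := by
      intro h; exact hx'.2 ⟨by simpa using h, trivial⟩
    rw [not_le, div_lt_iff₀ hα0] at h5
    linarith
  rw [integral_integral_swap hint]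
  have h5 : ∀ᵐ w ∂((volume : Measure ℂ).restrict (Metric.closedBall 0 1)),
      ∫ q, f (α * q * ((‖w‖ ^ (α - 2) : ℝ) * w))
        = ((‖w‖ ^ (2 - 2 * α) : ℝ) : ℂ) * (((α ^ 2)⁻¹ : ℝ) * ∫ z, f z) := by
    filter_upwards [ae_restrict_of_ae (compl_mem_ae_iff.2 (measure_singleton (0 : ℂ)))] with w hw0
    have hw0 : w ≠ 0 := hw0
    have hwn : 0 < ‖w‖ := norm_pos_iff.2 hw0
    have hc : (α : ℂ) * (((‖w‖ ^ (α - 2) : ℝ) : ℂ) * w) ≠ 0 := by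
      rw [← norm_pos_iff, norm_mul, norm_rpow_mul_self hw0, Complex.norm_real,
        Real.norm_of_nonneg hα0.le]
      positivity
    have h6 : ∀ q : ℂ, f (α * q * ((‖w‖ ^ (α - 2) : ℝ) * w))
        = f ((α : ℂ) * (((‖w‖ ^ (α - 2) : ℝ) : ℂ) * w) * q) := by
      intro q; congr 1; ring
    simp only [h6]
    rw [integral_comp_complex_mul f hc, norm_mul, norm_rpow_mul_self hw0, Complex.norm_real,
        Real.norm_of_nonneg hα0.le, Complex.real_smul, mul_pow, mul_inv]
    have h7 : ((‖w‖ ^ (α - 1)) ^ 2)⁻¹ = ‖w‖ ^ (2 - 2 * α) := by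
      rw [← Real.rpow_natCast, ← Real.rpow_mul hwn.le, ← Real.rpow_neg hwn.le]
      congr 1; push_cast; ring
    rw [h7]; push_cast; ring
  rw [integral_congr_ae h5, integral_mul_const, integral_complex_ofReal,
    integral_closedBall_rpow hα1]
  have h8 : (2 - (α : ℂ)) ≠ 0 := by
    have : (2 - α) ≠ 0 := by linarith
    exact_mod_cast this
  push_cast
  field_simp

end DiskAverage

/-! ### Behaviour of the lattice sum as the scale varies. -/

section LatticeSum

variable {L : Submodule ℤ ℂ} [DiscreteTopology L]
variable {α A B₀ B₁ : ℝ} {f : ℂ → ℂ}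

theorem sum_puncturedBall_diskAverage (hα0 : 0 < α) (hα1 : α < 1) (hf : IsTest A B₀ B₁ f)
    {τ R : ℝ} (hτ : 0 < τ) (hR : A / (α * τ) ≤ R) :
    {l : L | diskAverage α f (τ * ((0 : ℂ) + l)) ≠ 0}.Finite ∧
    ∑' l : L, diskAverage α f (τ * ((0 : ℂ) + l)) = diskAverage α f 0 +
      ∑ p ∈ puncturedBall L R, diskAverage α f (τ * p) := by
  have h0 : ∀ l : ℂ, R < ‖l‖ → diskAverage α f (τ * l) = 0 := by
    intro l hl
    refine diskAverage_eq_zero hα0 hα1 hf ?_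
    rw [norm_mul, Complex.norm_real, Real.norm_of_nonneg hτ.le]
    have := (div_le_iff₀ (by positivity)).1 (hR.trans hl.le)
    linarith
  constructor
  · refine Set.Finite.of_finite_image (f := fun l : L => (l : ℂ))
      ((finite_lattice_ball L R).subset ?_) Subtype.val_injective.injOn
    rintro _ ⟨l, hl, rfl⟩
    refine ⟨l.2, ?_⟩
    by_contra! h
    exact hl (by rw [zero_add]; exact h0 _ h)
  · have h1 := Subtype.val_injective.tsum_eq (g := fun l : L => (l : ℂ))
      (f := (L : Set ℂ).indicator fun p => diskAverage α f (τ * p)) (by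
        intro p hp
        exact ⟨⟨p, Set.mem_of_indicator_ne_zero hp⟩, rfl⟩)
    have h2 : ∀ l : L, diskAverage α f (τ * ((0 : ℂ) + l))
        = (L : Set ℂ).indicator (fun p => diskAverage α f (τ * p)) l := by
      intro l
      rw [Set.indicator_of_mem l.2, zero_add]
    have h3 : (0 : ℂ) ∉ puncturedBall L R := fun h => (mem_puncturedBall.1 h).2.1 rfl
    simp only [h2]
    rw [h1, tsum_eq_sum (s := insert 0 (puncturedBall L R)), Finset.sum_insert h3]
    · rw [Set.indicator_of_mem L.zero_mem, mul_zero]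
      congr 1
      exact Finset.sum_congr rfl fun p hp => Set.indicator_of_mem (mem_puncturedBall.1 hp).1 _
    · intro p hp
      by_cases hpL : p ∈ (L : Set ℂ)
      · rw [Set.indicator_of_mem hpL]
        refine h0 p ?_
        by_contra! h
        refine hp (Finset.mem_insert.2 ?_)
        by_cases hp0 : p = 0
        · exact Or.inl hp0
        · exact Or.inr (mem_puncturedBall.2 ⟨hpL, hp0, h⟩)
      · exact Set.indicator_of_notMem hpL _

/-- A Riemann sum for `diskAverage` over the lattice scaled by `τ`: the support in the unscaled
variable has area of order `(A/τ)²`, the oscillation on a cell is of order `τ`, and the prefactor is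
`τ²`. -/
theorem exists_latticeSum_sub_integral_le [IsZLattice ℝ L] (hα0 : 0 < α) (hα1 : α < 1) :
    ∃ C : ℝ, 0 < C ∧ ∀ (A B₀ B₁ : ℝ) (f : ℂ → ℂ) (τ R : ℝ), 1 ≤ A → IsTest A B₀ B₁ f → 0 ≤ B₁ →
      0 < τ → τ ≤ 1 → A / (α * τ) ≤ R →
      ‖latticeSum α L f τ R
        - ((Real.pi / (α ^ 2 * (2 - α) * ZLattice.covolume L ^ 2) : ℝ) : ℂ) * ∫ z, f z‖
        ≤ C * (B₀ + B₁) * (A ^ 2 * τ) := by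
  obtain ⟨d, hd, hcell⟩ := exists_cell_comparison L
  have hV := ZLattice.covolume_pos L volume
  have hpi := Real.pi_pos
  set V := ZLattice.covolume L
  set K := 2 * Real.pi ^ 2 * d * (1 / α + d) ^ 2 / V ^ 2 + Real.pi / V with hK
  refine ⟨K, by positivity, ?_⟩
  intro A B₀ B₁ f τ R hA hf hB₁ hτ hτ1 hR
  have hB₀ : 0 ≤ B₀ := (norm_nonneg _).trans (hf.norm_le 0)
  obtain ⟨hfin, hsum⟩ := sum_puncturedBall_diskAverage (L := L) hα0 hα1 hf hτ hR
  set ρ := A / (α * τ) + d with hρ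
  have hρ0 : 0 < ρ := by positivity
  have hzero : ∀ z : ℂ, A / (α * τ) ≤ ‖z‖ → diskAverage α f (τ * z) = 0 := by
    intro z hz
    refine diskAverage_eq_zero hα0 hα1 hf ?_
    rw [norm_mul, Complex.norm_real, Real.norm_of_nonneg hτ.le]
    have := (div_le_iff₀ (by positivity)).1 hz
    linarith
  have hcont : Continuous (fun z : ℂ => diskAverage α f (τ * z)) :=
    (continuous_diskAverage hα0 hα1 hf hB₁).comp (by fun_prop)
  have hgi : Integrable (fun z : ℂ => diskAverage α f (τ * z)) :=
    integrable_of_bounded_of_eq_zero hcont.measurable (fun z => norm_diskAverage_le hf.norm_le _)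
      (fun z hz => hzero z hz.le)
  have hEi : Integrable ((Metric.closedBall (0 : ℂ) ρ).indicator
      (fun _ => 2 * Real.pi * B₁ * (τ * d))) := by
    rw [integrable_indicator_iff measurableSet_closedBall]
    exact integrableOn_const (Metric.isBounded_closedBall.measure_lt_top.ne)
  have h1 := hcell 0 (fun p => diskAverage α f (τ * p)) (fun z => diskAverage α f (τ * z)) _
    hgi hEi hfin (by
      intro l z hz
      by_cases hzρ : z ∈ Metric.closedBall (0 : ℂ) ρ
      · rw [Set.indicator_of_mem hzρ]
        refine (norm_diskAverage_sub_le hα0 hα1 hf hB₁ _ _).trans ?_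
        rw [← mul_sub, norm_mul, Complex.norm_real, Real.norm_of_nonneg hτ.le, norm_sub_rev]
        gcongr
      · rw [Set.indicator_of_notMem hzρ]
        rw [mem_closedBall_zero_iff, not_le] at hzρ
        have h2 : ‖z‖ ≤ ‖(0 : ℂ) + l‖ + d := by
          have := norm_le_norm_add_norm_sub ((0 : ℂ) + l) z
          rw [norm_sub_rev] at this
          linarith
        rw [hzero z (by linarith), hzero _ (by linarith)]; simp)
  have hint : ∫ z, diskAverage α f (τ * z) = (((τ ^ 2)⁻¹ : ℝ) : ℂ) *
      (((Real.pi / (α ^ 2 * (2 - α)) : ℝ) : ℂ) * ∫ z, f z) := by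
    rw [← integral_diskAverage hα0 hα1 hf hB₁]
    have := Measure.integral_comp_smul_of_nonneg (volume : Measure ℂ)
      (diskAverage α f) τ (hR := hτ.le)
    rw [Complex.finrank_real_complex] at this
    simp only [Complex.real_smul] at this
    exact this
  rw [hsum, hint, integral_indicator measurableSet_closedBall, setIntegral_const, smul_eq_mul,
    measureReal_def, Complex.volume_closedBall] at h1
  simp only [ENNReal.toReal_mul, ENNReal.toReal_pow, ENNReal.coe_toReal, NNReal.coe_real_pi] at h1
  rw [ENNReal.toReal_ofReal hρ0.le] at h1
  have hρ1 : ρ ≤ (1 / α + d) * (A / τ) := by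
    have : 1 ≤ A / τ := by rw [le_div_iff₀ hτ]; linarith
    calc ρ = 1 / α * (A / τ) + d * 1 := by rw [hρ]; field_simp
      _ ≤ 1 / α * (A / τ) + d * (A / τ) := by gcongr
      _ = _ := by ring
  unfold latticeSum
  set S := ∑ p ∈ puncturedBall L R, diskAverage α f (τ * p)
  set J := ∫ z, f z
  have hVc : (V : ℂ) ≠ 0 := by exact_mod_cast hV.ne'
  have hτc : (τ : ℂ) ≠ 0 := by exact_mod_cast hτ.ne'
  have hαc : (α : ℂ) ≠ 0 := by exact_mod_cast hα0.ne'
  have h2αc : (2 - (α : ℂ)) ≠ 0 := by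
    have : (2 - α) ≠ 0 := by linarith
    exact_mod_cast this
  -- The Riemann sum runs over the full lattice, so the term at the origin is added and subtracted;
  -- it costs only `O(τ²)`.
  have hdec : ((τ ^ 2 / V : ℝ) : ℂ) * S - ((Real.pi / (α ^ 2 * (2 - α) * V ^ 2) : ℝ) : ℂ) * J
      = ((τ ^ 2 / V ^ 2 : ℝ) : ℂ) * ((V : ℂ) * (diskAverage α f 0 + S) - (((τ ^ 2)⁻¹ : ℝ) : ℂ) *
      (((Real.pi / (α ^ 2 * (2 - α)) : ℝ) : ℂ) * J)) - ((τ ^ 2 / V : ℝ) : ℂ) * diskAverage α f 0 := by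
    push_cast
    field_simp
    ring
  rw [hdec]
  refine (norm_sub_le _ _).trans ?_
  rw [norm_mul, norm_mul, Complex.norm_real, Complex.norm_real, Real.norm_of_nonneg (by positivity),
    Real.norm_of_nonneg (by positivity)]
  have hA2 : 1 ≤ A ^ 2 := one_le_pow₀ hA
  have e1 : τ ^ 2 / V ^ 2 * ‖(V : ℂ) * (diskAverage α f 0 + S) - (((τ ^ 2)⁻¹ : ℝ) : ℂ) *
      (((Real.pi / (α ^ 2 * (2 - α)) : ℝ) : ℂ) * J)‖
      ≤ 2 * Real.pi ^ 2 * d * (1 / α + d) ^ 2 / V ^ 2 * (B₀ + B₁) * (A ^ 2 * τ) := by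
    calc _ ≤ τ ^ 2 / V ^ 2 * (((1 / α + d) * (A / τ)) ^ 2 * Real.pi *
          (2 * Real.pi * (B₀ + B₁) * (τ * d))) := by
          refine mul_le_mul_of_nonneg_left (h1.trans ?_) (by positivity)
          gcongr
          linarith
      _ = _ := by field_simp
  have e2 : τ ^ 2 / V * ‖diskAverage α f 0‖ ≤ Real.pi / V * (B₀ + B₁) * (A ^ 2 * τ) := by
    calc τ ^ 2 / V * ‖diskAverage α f 0‖ ≤ (τ * 1) / V * (Real.pi * (B₀ + B₁)) := by
          gcongr
          · rw [sq]; gcongr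
          · exact (norm_diskAverage_le hf.norm_le _).trans (by gcongr; linarith)
      _ = Real.pi / V * (B₀ + B₁) * (1 * τ) := by ring
      _ ≤ _ := by gcongr
  calc _ ≤ _ := add_le_add e1 e2
    _ = _ := by rw [hK]; ring

/-- Both sums share the radius `R`, so they are compared term by term: the prefactor changes by
`lam² ε(2 + ε)` and the argument by at most `lam |ε| R`, where `ε = τ/lam - 1`. -/
theorem exists_latticeSum_sub_le [IsZLattice ℝ L] (hα0 : 0 < α) :
    ∃ C : ℝ, 0 < C ∧ ∀ (A B₀ B₁ : ℝ) (f : ℂ → ℂ) (τ lam R : ℝ), 1 ≤ A → α < 1 →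
      IsTest A B₀ B₁ f → 0 ≤ B₁ → 0 < lam → |τ / lam - 1| ≤ 1 / 2 → 0 ≤ R →
      R ≤ 8 * A / (α * lam) →
      ‖latticeSum α L f τ R - latticeSum α L f lam R‖ ≤ C * (B₀ + B₁) * (A ^ 3 * |τ / lam - 1|)
      := by
  obtain ⟨C₂, hC₂, hcard⟩ := exists_card_puncturedBall_le L
  have hV := ZLattice.covolume_pos L volume
  have hpi := Real.pi_pos
  set V := ZLattice.covolume L
  set K₁ := 5 / 2 * C₂ * (8 / α) ^ 2 * Real.pi / V with hK₁
  set K₂ := 2 * Real.pi * C₂ * (8 / α) ^ 3 / V with hK₂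
  refine ⟨K₁ + K₂, by positivity, ?_⟩
  intro A B₀ B₁ f τ lam R hA hα1 hf hB₁ hlam hε hR0 hR
  have hB₀ : 0 ≤ B₀ := (norm_nonneg _).trans (hf.norm_le 0)
  set ε := τ / lam - 1 with hεdef
  have hτ : τ = lam * (1 + ε) := by rw [hεdef]; field_simp; ring
  have hA0 : 0 < A := by linarith
  unfold latticeSum
  have hdec : ((τ ^ 2 / V : ℝ) : ℂ) * ∑ p ∈ puncturedBall L R, diskAverage α f (τ * p)
      - ((lam ^ 2 / V : ℝ) : ℂ) * ∑ p ∈ puncturedBall L R, diskAverage α f (lam * p)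
      = ∑ p ∈ puncturedBall L R, (((lam ^ 2 * (ε * (2 + ε)) / V : ℝ) : ℂ) * diskAverage α f (τ * p)
        + ((lam ^ 2 / V : ℝ) : ℂ) * (diskAverage α f (τ * p) - diskAverage α f (lam * p))) := by
    rw [Finset.mul_sum, Finset.mul_sum, ← Finset.sum_sub_distrib]
    refine Finset.sum_congr rfl fun p _ => ?_
    have : τ ^ 2 = lam ^ 2 * (ε * (2 + ε)) + lam ^ 2 := by rw [hτ]; ring
    rw [this]; push_cast; ring
  rw [hdec]
  have hterm : ∀ p ∈ puncturedBall L R,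
      ‖((lam ^ 2 * (ε * (2 + ε)) / V : ℝ) : ℂ) * diskAverage α f (τ * p)
        + ((lam ^ 2 / V : ℝ) : ℂ) * (diskAverage α f (τ * p) - diskAverage α f (lam * p))‖
      ≤ lam ^ 2 / V * |ε| * (5 / 2 * Real.pi * B₀ + 2 * Real.pi * B₁ * (lam * R)) := by
    intro p hp
    have hpR := (mem_puncturedBall.1 hp).2.2
    refine (norm_add_le _ _).trans ?_
    rw [norm_mul, norm_mul, Complex.norm_real, Complex.norm_real, Real.norm_eq_abs,
      Real.norm_of_nonneg (show 0 ≤ lam ^ 2 / V by positivity)]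
    have h1 : |lam ^ 2 * (ε * (2 + ε)) / V| ≤ lam ^ 2 / V * |ε| * (5 / 2) := by
      rw [abs_div, abs_mul, abs_mul, abs_of_pos hV, abs_of_pos (show 0 < lam ^ 2 by positivity)]
      have : |2 + ε| ≤ 5 / 2 := by
        rw [abs_le]; constructor <;> linarith [(abs_le.1 hε).1, (abs_le.1 hε).2]
      calc lam ^ 2 * (|ε| * |2 + ε|) / V ≤ lam ^ 2 * (|ε| * (5 / 2)) / V := by gcongr
        _ = _ := by ring
    have h2 : ‖diskAverage α f (τ * p) - diskAverage α f (lam * p)‖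
        ≤ 2 * Real.pi * B₁ * (lam * |ε| * R) := by
      refine (norm_diskAverage_sub_le hα0 hα1 hf hB₁ _ _).trans ?_
      have : (τ : ℂ) * p - lam * p = ((lam * ε : ℝ) : ℂ) * p := by rw [hτ]; push_cast; ring
      rw [this, norm_mul, Complex.norm_real, Real.norm_eq_abs, abs_mul, abs_of_pos hlam]
      gcongr
    calc _ ≤ lam ^ 2 / V * |ε| * (5 / 2) * (Real.pi * B₀)
        + lam ^ 2 / V * (2 * Real.pi * B₁ * (lam * |ε| * R)) := by
          gcongr; exact norm_diskAverage_le hf.norm_le _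
      _ = _ := by ring
  refine (norm_sum_le_of_le _ hterm).trans ?_
  rw [Finset.sum_const, nsmul_eq_mul]
  have hA3 : A ^ 2 ≤ A ^ 3 := pow_le_pow_right₀ hA (by norm_num)
  calc _ ≤ (C₂ * (8 * A / (α * lam)) ^ 2) * (lam ^ 2 / V * |ε| *
        (5 / 2 * Real.pi * B₀ + 2 * Real.pi * B₁ * (lam * (8 * A / (α * lam))))) := by
        gcongr
        exact (hcard R hR0).trans (by gcongr)
    _ = K₁ * B₀ * (A ^ 2 * |ε|) + K₂ * B₁ * (A ^ 3 * |ε|) := by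
        rw [hK₁, hK₂]; field_simp
    _ ≤ K₁ * (B₀ + B₁) * (A ^ 3 * |ε|) + K₂ * (B₀ + B₁) * (A ^ 3 * |ε|) := by
        gcongr <;> linarith
    _ = _ := by ring

end LatticeSum

/-! ### The disk average as an integral against a radial density. -/

section Radial

variable {α A B₀ B₁ : ℝ} {f : ℂ → ℂ}

/-- The density of the image of the Lebesgue measure of the unit disk under `w ↦ b ‖w‖^(α-2) w`. -/
def radialWeight (α b : ℝ) : ℝ → ℝ :=
  (Set.Ici b).indicator fun r => (1 - α)⁻¹ * (r / b) ^ (-(2 / (1 - α))) * (r ^ 2)⁻¹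

theorem measurable_radialWeight (α b : ℝ) : Measurable (radialWeight α b) := by
  unfold radialWeight
  exact Measurable.indicator (by fun_prop) measurableSet_Ici

theorem radialWeight_nonneg (hα1 : α < 1) {b r : ℝ} (hb : 0 < b) : 0 ≤ radialWeight α b r := by
  unfold radialWeight
  refine Set.indicator_apply_nonneg fun hr => ?_
  have hr : b ≤ r := hr
  have : 0 < 1 - α := by linarith
  have : 0 < r := by linarith
  positivity

theorem radialWeight_le (hα1 : α < 1) {b : ℝ} (hb : 0 < b) (r : ℝ) :
    radialWeight α b r ≤ (1 - α)⁻¹ * (b ^ 2)⁻¹ := by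
  have h1 : 0 < 1 - α := by linarith
  unfold radialWeight
  refine Set.indicator_apply_le' (fun hr => ?_) (fun _ => by positivity)
  have hr : b ≤ r := hr
  have h2 : (r / b) ^ (-(2 / (1 - α))) ≤ 1 :=
    Real.rpow_le_one_of_one_le_of_nonpos (by rwa [le_div_iff₀ hb, one_mul])
      (by rw [neg_nonpos]; positivity)
  calc (1 - α)⁻¹ * (r / b) ^ (-(2 / (1 - α))) * (r ^ 2)⁻¹
      ≤ (1 - α)⁻¹ * 1 * (b ^ 2)⁻¹ := by gcongr
    _ = _ := by ring

theorem integrable_mul_radialWeight (hα1 : α < 1) (hf : IsTest A B₀ B₁ f) (hB₁ : 0 ≤ B₁) {b : ℝ}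
    (hb : 0 < b) : Integrable (fun z : ℂ => f z * (radialWeight α b ‖z‖ : ℝ)) ∧
      Measurable (fun z : ℂ => f z * (radialWeight α b ‖z‖ : ℝ)) ∧
      ∀ z : ℂ, ‖f z * (radialWeight α b ‖z‖ : ℝ)‖ ≤ B₀ * ((1 - α)⁻¹ * (b ^ 2)⁻¹) := by
  have hm := (hf.continuous hB₁).measurable
  have h1 := measurable_radialWeight α b
  have hB₀ : 0 ≤ B₀ := (norm_nonneg _).trans (hf.norm_le 0)
  have hmm : Measurable (fun z : ℂ => f z * (radialWeight α b ‖z‖ : ℝ)) :=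
    hm.mul (Complex.measurable_ofReal.comp (h1.comp measurable_norm))
  have hbd : ∀ z : ℂ, ‖f z * (radialWeight α b ‖z‖ : ℝ)‖ ≤ B₀ * ((1 - α)⁻¹ * (b ^ 2)⁻¹) := by
    intro z
    rw [norm_mul, Complex.norm_real, Real.norm_of_nonneg (radialWeight_nonneg hα1 hb)]
    exact mul_le_mul (hf.norm_le z) (radialWeight_le hα1 hb _) (radialWeight_nonneg hα1 hb) hB₀
  exact ⟨integrable_of_bounded_of_eq_zero hmm hbd
    (R := A) (fun z hz => by rw [hf.eq_zero z hz.le, zero_mul]), hmm, hbd⟩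

theorem diskAverage_eq_integral_radialWeight (hα0 : 0 < α) (hα1 : α < 1) (hf : IsTest A B₀ B₁ f)
    (hB₁ : 0 ≤ B₁) {q : ℂ} (hq : q ≠ 0) :
    diskAverage α f q = ∫ z, f z * (radialWeight α (α * ‖q‖) ‖z‖ : ℝ) := by
  set b := α * ‖q‖ with hb
  have hb0 : 0 < b := by
    have : 0 < ‖q‖ := norm_pos_iff.2 hq
    positivity
  have hβ : 0 < 1 - α := by linarith
  have hm := (hf.continuous hB₁).measurable
  obtain ⟨-, hmm, hbd⟩ := integrable_mul_radialWeight hα1 hf hB₁ hb0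
  set Φ : ℝ → ℂ := fun ρ => ∫ θ in (0 : ℝ)..(2 * Real.pi), f (ρ * Complex.exp (θ * Complex.I))
    with hΦ
  have hL : diskAverage α f q = ∫ t in Set.Ioi (0 : ℝ), t • (Set.Iic (1 : ℝ)).indicator
      (fun t => Φ (b * t ^ (α - 1))) t := by
    unfold diskAverage
    rw [(integral_closedBall_polar (α := α) (R := 1) hm hf.norm_le (α * q)).2]
    refine setIntegral_congr_fun measurableSet_Ioi fun t ht => ?_
    have ht : 0 < t := ht
    congr 1
    by_cases h1 : t ∈ Set.Iic (1 : ℝ)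
    · rw [Set.indicator_of_mem h1, Set.indicator_of_mem h1, integral_comp_circle_rotate, hΦ]
      have : ‖(α : ℂ) * q * ((t ^ (α - 1) : ℝ) : ℂ)‖ = b * t ^ (α - 1) := by
        rw [norm_mul, norm_mul, Complex.norm_real, Complex.norm_real, Real.norm_of_nonneg hα0.le,
          Real.norm_of_nonneg (by positivity)]
      rw [this]
    · rw [Set.indicator_of_notMem h1, Set.indicator_of_notMem h1]
  have hRt : ∫ z, f z * (radialWeight α b ‖z‖ : ℝ)
      = ∫ r in Set.Ioi (0 : ℝ), (r * radialWeight α b r) • Φ r := by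
    rw [(integral_polar hmm hbd (R := A)
      (fun z hz => by rw [hf.eq_zero z hz.le, zero_mul])).2]
    refine setIntegral_congr_fun measurableSet_Ioi fun r hr => ?_
    have hr : 0 < r := hr
    have hn : ∀ θ : ℝ, ‖(r : ℂ) * Complex.exp (θ * Complex.I)‖ = r := by
      intro θ
      rw [norm_mul, Complex.norm_exp_ofReal_mul_I, mul_one, Complex.norm_real,
        Real.norm_of_nonneg hr.le]
    simp only [hn]
    rw [intervalIntegral.integral_mul_const, mul_smul, hΦ]
    congr 1
    rw [Complex.real_smul, mul_comm]
  rw [hL, hRt]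
  -- The substitution `r = b t^(α-1)` is made in two stages, a dilation and then a power; it sends
  -- `]0, 1]` onto `[b, ∞[`.
  have h1 := integral_comp_mul_left_Ioi (fun r => (r * radialWeight α b r) • Φ r) 0 hb0
  rw [mul_zero] at h1
  have h2 : ∫ r in Set.Ioi (0 : ℝ), (r * radialWeight α b r) • Φ r
      = ∫ y in Set.Ioi (0 : ℝ), b • ((b * y * radialWeight α b (b * y)) • Φ (b * y)) := by
    rw [integral_smul, h1, smul_smul, mul_inv_cancel₀ hb0.ne', one_smul]
  rw [h2, ← integral_comp_rpow_Ioi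
    (fun y => b • ((b * y * radialWeight α b (b * y)) • Φ (b * y))) (show α - 1 ≠ 0 by linarith)]
  refine setIntegral_congr_fun measurableSet_Ioi fun t ht => ?_
  have ht : 0 < t := ht
  by_cases h3 : t ≤ 1
  · rw [Set.indicator_of_mem (show t ∈ Set.Iic (1 : ℝ) from h3)]
    have h4 : 1 ≤ t ^ (α - 1) :=
      Real.one_le_rpow_of_pos_of_le_one_of_nonpos ht h3 (by linarith)
    have h5 : b * t ^ (α - 1) ∈ Set.Ici b := le_mul_of_one_le_right hb0.le h4
    unfold radialWeight
    rw [Set.indicator_of_mem h5, smul_smul, smul_smul]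
    congr 1
    have h6 : b * t ^ (α - 1) / b = t ^ (α - 1) := by field_simp
    have h7 : (t ^ (α - 1)) ^ (-(2 / (1 - α))) = t ^ 2 := by
      rw [← Real.rpow_mul ht.le, ← Real.rpow_natCast]
      congr 1
      push_cast
      field_simp
      ring
    have h8 : |α - 1| = 1 - α := by rw [abs_of_neg (by linarith)]; ring
    have h9 : t ^ (α - 1 - 1) = t ^ (α - 1) / t := Real.rpow_sub_one ht.ne' _
    have h10 : 0 < t ^ (α - 1) := by positivity
    rw [h6, h7, h8, h9]
    field_simp
  · rw [Set.indicator_of_notMem (show t ∉ Set.Iic (1 : ℝ) from h3), smul_zero]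
    have h4 : t ^ (α - 1) < 1 :=
      Real.rpow_lt_one_of_one_lt_of_neg (by linarith) (by linarith)
    have h5 : b * t ^ (α - 1) ∉ Set.Ici b := by
      intro h
      have : b * t ^ (α - 1) < b * 1 := by gcongr
      have h : b ≤ b * t ^ (α - 1) := h
      linarith
    unfold radialWeight
    rw [Set.indicator_of_notMem h5]; simp

end Radial

/-! ### The limit density: measurability, bounds, level repulsion. -/

section Density

variable (L : Submodule ℤ ℂ) [DiscreteTopology L]
variable {α A B₀ B₁ : ℝ} {f : ℂ → ℂ}

theorem tsum_norm_rpow_eq {κ : ℝ} (hκ : κ ≠ 0) (R : ℝ) :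
    ∑' p : {p : ℂ // p ∈ L ∧ ‖p‖ ≤ R}, ‖(p : ℂ)‖ ^ κ = ∑ p ∈ puncturedBall L R, ‖p‖ ^ κ := by
  have h1 := tsum_subtype {p : ℂ | p ∈ L ∧ ‖p‖ ≤ R} (fun p : ℂ => ‖p‖ ^ κ)
  refine h1.trans ?_
  rw [tsum_eq_sum (s := puncturedBall L R)]
  · refine Finset.sum_congr rfl fun p hp => ?_
    have hp := mem_puncturedBall.1 hp
    rw [Set.indicator_of_mem (show p ∈ {p : ℂ | p ∈ L ∧ ‖p‖ ≤ R} from ⟨hp.1, hp.2.2⟩)]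
  · intro p hp
    refine Set.indicator_apply_eq_zero.2 fun hp' => ?_
    by_cases h0 : p = 0
    · simp [h0, hκ]
    · exact absurd (mem_puncturedBall.2 ⟨hp'.1, h0, hp'.2⟩) hp

theorem density_eq_of_pos {lam : ℝ≥0∞} (h0 : lam ≠ 0) (ht : lam ≠ ⊤) (hα1 : α < 1) (z : ℂ) :
    density α L lam z = α ^ (2 / (1 - α)) / ((1 - α) * ZLattice.covolume L) *
      (‖z‖ / lam.toReal) ^ (-((4 - 2 * α) / (1 - α))) *
      ∑ p ∈ puncturedBall L (‖z‖ / (α * lam.toReal)), ‖p‖ ^ (2 / (1 - α)) := by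
  have : 2 / (1 - α) ≠ 0 := div_ne_zero two_ne_zero (by linarith)
  rw [density, if_neg ht, if_neg h0, tsum_norm_rpow_eq L this]

theorem density_nonneg [IsZLattice ℝ L] (hα0 : 0 < α) (hα1 : α < 1) (lam : ℝ≥0∞) (z : ℂ) :
    0 ≤ density α L lam z := by
  have hV := ZLattice.covolume_pos L volume
  have h1 : 0 < 1 - α := by linarith
  have h2 : 0 < 2 - α := by linarith
  have hpi := Real.pi_pos
  unfold density
  split_ifs
  · exact le_rfl
  · positivity
  · have : 0 ≤ ∑' p : {p : ℂ // p ∈ L ∧ ‖p‖ ≤ ‖z‖ / (α * lam.toReal)}, ‖(p : ℂ)‖ ^ (2 / (1 - α)) :=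
      tsum_nonneg fun p => by positivity
    positivity

theorem measurable_density (hα1 : α < 1) (lam : ℝ≥0∞) : Measurable (density α L lam) := by
  by_cases ht : lam = ⊤
  · have : density α L lam = fun _ => 0 := by ext z; simp [density, ht]
    rw [this]; exact measurable_const
  by_cases h0 : lam = 0
  · have : density α L lam = fun _ => Real.pi / (α ^ 2 * (2 - α) * ZLattice.covolume L ^ 2) := by
      ext z; simp [density, h0]
    rw [this]; exact measurable_const
  -- Measurability of the lattice sum comes for free from its monotonicity in the radius.
  have hmono : Monotone (fun R => ∑ p ∈ puncturedBall L R, ‖p‖ ^ (2 / (1 - α))) := by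
    intro R R' hR
    refine Finset.sum_le_sum_of_subset_of_nonneg (fun p hp => ?_) (fun p _ _ => by positivity)
    have hp := mem_puncturedBall.1 hp
    exact mem_puncturedBall.2 ⟨hp.1, hp.2.1, hp.2.2.trans hR⟩
  have hS := hmono.measurable
  have : density α L lam = fun z => α ^ (2 / (1 - α)) / ((1 - α) * ZLattice.covolume L) *
      (‖z‖ / lam.toReal) ^ (-((4 - 2 * α) / (1 - α))) *
      ∑ p ∈ puncturedBall L (‖z‖ / (α * lam.toReal)), ‖p‖ ^ (2 / (1 - α)) := by
    ext z; exact density_eq_of_pos L h0 ht hα1 z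
  rw [this]
  refine Measurable.mul (by fun_prop) ?_
  exact hS.comp (by fun_prop)

/-- The cutoff in `radialWeight` encodes the `z`-dependent summation range, so the range can be
enlarged to one independent of `z` and the sum exchanged with an integral. The exponents match since
`(4 - 2α)/(1 - α) = 2/(1 - α) + 2`. -/
theorem density_eq_sum_radialWeight [IsZLattice ℝ L] (hα0 : 0 < α) (hα1 : α < 1) {lam : ℝ≥0∞}
    (h0 : lam ≠ 0) (ht : lam ≠ ⊤) {R : ℝ} {z : ℂ} (hz : ‖z‖ / (α * lam.toReal) ≤ R) :
    density α L lam z = lam.toReal ^ 2 / ZLattice.covolume L *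
      ∑ p ∈ puncturedBall L R, radialWeight α (α * (lam.toReal * ‖p‖)) ‖z‖ := by
  have hV := ZLattice.covolume_pos L volume
  have hl : 0 < lam.toReal := ENNReal.toReal_pos h0 ht
  have hβ : 0 < 1 - α := by linarith
  rw [density_eq_of_pos L h0 ht hα1]
  set V := ZLattice.covolume L
  set l := lam.toReal
  have hsub : puncturedBall L (‖z‖ / (α * l)) ⊆ puncturedBall L R := fun p hp =>
    mem_puncturedBall.2 ⟨(mem_puncturedBall.1 hp).1, (mem_puncturedBall.1 hp).2.1,
      (mem_puncturedBall.1 hp).2.2.trans hz⟩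
  rw [← Finset.sum_subset hsub, Finset.mul_sum, Finset.mul_sum]
  · refine Finset.sum_congr rfl fun p hp => ?_
    have hp := mem_puncturedBall.1 hp
    have hp0 : 0 < ‖p‖ := norm_pos_iff.2 hp.2.1
    have h1 : α * (l * ‖p‖) ≤ ‖z‖ := by
      have := (le_div_iff₀ (by positivity)).1 hp.2.2
      linarith
    have hz0 : 0 < ‖z‖ := lt_of_lt_of_le (by positivity) h1
    unfold radialWeight
    rw [Set.indicator_of_mem (show ‖z‖ ∈ Set.Ici (α * (l * ‖p‖)) from h1)]
    have h2 : ‖z‖ / (α * (l * ‖p‖)) = ‖z‖ / l * (α * ‖p‖)⁻¹ := by field_simp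
    have h3 : -((4 - 2 * α) / (1 - α)) = -(2 / (1 - α)) + (-2 : ℝ) := by field_simp; ring
    rw [h2, h3, Real.rpow_add (by positivity), Real.mul_rpow (by positivity) (by positivity),
      Real.inv_rpow (by positivity), Real.rpow_neg (by positivity : (0 : ℝ) ≤ α * ‖p‖), inv_inv,
      Real.mul_rpow hα0.le hp0.le, Real.rpow_neg (by positivity) 2, Real.rpow_two]
    field_simp
  · intro p hp hp'
    have hp := mem_puncturedBall.1 hp
    unfold radialWeight
    refine Set.indicator_of_notMem (fun h => hp' ?_) _
    refine mem_puncturedBall.2 ⟨hp.1, hp.2.1, ?_⟩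
    have h : α * (l * ‖p‖) ≤ ‖z‖ := h
    rw [le_div_iff₀ (by positivity)]; linarith

theorem exists_density_le [IsZLattice ℝ L] (hα0 : 0 < α) (hα1 : α < 1) (lam : ℝ≥0∞) (R : ℝ) :
    ∃ C : ℝ, ∀ z : ℂ, ‖z‖ ≤ R → density α L lam z ≤ C := by
  by_cases ht : lam = ⊤
  · exact ⟨0, fun z _ => by simp [density, ht]⟩
  by_cases h0 : lam = 0
  · exact ⟨_, fun z _ => by rw [density, if_neg ht, if_pos h0]⟩
  have hl : 0 < lam.toReal := ENNReal.toReal_pos h0 ht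
  have hV := ZLattice.covolume_pos L volume
  refine ⟨lam.toReal ^ 2 / ZLattice.covolume L *
      ∑ p ∈ puncturedBall L (R / (α * lam.toReal)),
        (1 - α)⁻¹ * ((α * (lam.toReal * ‖p‖)) ^ 2)⁻¹, fun z hz => ?_⟩
  rw [density_eq_sum_radialWeight L hα0 hα1 h0 ht (R := R / (α * lam.toReal)) (by gcongr)]
  gcongr with p hp
  have hp0 : 0 < ‖p‖ := norm_pos_iff.2 (mem_puncturedBall.1 hp).2.1
  exact radialWeight_le hα1 (by positivity) _

theorem integral_mul_density_eq_latticeSum [IsZLattice ℝ L] (hα0 : 0 < α) (hα1 : α < 1)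
    {lam : ℝ≥0∞} (h0 : lam ≠ 0) (ht : lam ≠ ⊤) (hf : IsTest A B₀ B₁ f) (hB₁ : 0 ≤ B₁) {R : ℝ}
    (hR : A / (α * lam.toReal) ≤ R) :
    ∫ z, f z * (density α L lam z : ℂ) = latticeSum α L f lam.toReal R := by
  have hl : 0 < lam.toReal := ENNReal.toReal_pos h0 ht
  have hb : ∀ p ∈ puncturedBall L R, 0 < α * (lam.toReal * ‖p‖) := by
    intro p hp
    have hp0 : 0 < ‖p‖ := norm_pos_iff.2 (mem_puncturedBall.1 hp).2.1
    positivity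
  have h1 : ∀ z : ℂ, f z * (density α L lam z : ℂ)
      = ((lam.toReal ^ 2 / ZLattice.covolume L : ℝ) : ℂ) * ∑ p ∈ puncturedBall L R,
        f z * (radialWeight α (α * (lam.toReal * ‖p‖)) ‖z‖ : ℝ) := by
    intro z
    by_cases hz : A ≤ ‖z‖
    · simp [hf.eq_zero z hz]
    · rw [density_eq_sum_radialWeight L hα0 hα1 h0 ht (R := R)
        (le_trans (by gcongr; linarith) hR), ← Finset.mul_sum]
      push_cast; ring
  simp only [h1]
  rw [integral_const_mul, integral_finsetSum _ fun p hp =>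
    (integrable_mul_radialWeight hα1 hf hB₁ (hb p hp)).1, latticeSum]
  congr 1
  refine Finset.sum_congr rfl fun p hp => ?_
  have hne : (lam.toReal : ℂ) * p ≠ 0 :=
    mul_ne_zero (by exact_mod_cast hl.ne') (mem_puncturedBall.1 hp).2.1
  rw [diskAverage_eq_integral_radialWeight hα0 hα1 hf hB₁ hne, norm_mul, Complex.norm_real,
    Real.norm_of_nonneg hl.le]

theorem integral_limitMeasure [IsZLattice ℝ L] (hα0 : 0 < α) (hα1 : α < 1) (lam : ℝ≥0∞)
    (f : ℂ → ℂ) :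
    ∫ z, f z ∂(limitMeasure α L lam) = ∫ z, f z * (density α L lam z : ℂ) := by
  unfold limitMeasure
  rw [integral_withDensity_eq_integral_toReal_smul
    (measurable_density L hα1 lam).ennreal_ofReal (ae_of_all _ fun _ => ENNReal.ofReal_lt_top)]
  refine integral_congr_ae (ae_of_all _ fun z => ?_)
  simp only
  rw [ENNReal.toReal_ofReal (density_nonneg L hα0 hα1 lam z), Complex.real_smul, mul_comm]

theorem isLocallyFiniteMeasure_limitMeasure [IsZLattice ℝ L] (hα0 : 0 < α) (hα1 : α < 1)
    (lam : ℝ≥0∞) : IsLocallyFiniteMeasure (limitMeasure α L lam) := by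
  refine ⟨fun x => ⟨Metric.ball x 1, Metric.ball_mem_nhds x one_pos, ?_⟩⟩
  obtain ⟨C, hC⟩ := exists_density_le L hα0 hα1 lam (‖x‖ + 1)
  unfold limitMeasure
  rw [withDensity_apply _ measurableSet_ball]
  calc ∫⁻ z in Metric.ball x 1, ENNReal.ofReal (density α L lam z)
      ≤ ∫⁻ z in Metric.ball x 1, ENNReal.ofReal C := by
        refine setLIntegral_mono measurable_const fun z hz => ENNReal.ofReal_le_ofReal (hC z ?_)
        have h1 := norm_le_norm_add_norm_sub x z
        rw [norm_sub_rev, ← dist_eq_norm] at h1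
        have h2 := Metric.mem_ball.1 hz
        linarith
    _ < ⊤ := by
        rw [setLIntegral_const]
        exact ENNReal.mul_lt_top ENNReal.ofReal_lt_top Metric.isBounded_ball.measure_lt_top

theorem level_repulsion [IsZLattice ℝ L] (hα0 : 0 < α) (hα1 : α < 1) {lam : ℝ≥0∞} (h0 : 0 < lam)
    (ht : lam < ⊤) : 0 < α * lam.toReal * systole L ∧
      ∀ z : ℂ, ‖z‖ < α * lam.toReal * systole L → density α L lam z = 0 := by
  have hl : 0 < lam.toReal := ENNReal.toReal_pos h0.ne' ht.ne
  refine ⟨mul_pos (mul_pos hα0 hl) (systole_pos L), fun z hz => ?_⟩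
  have hemp : puncturedBall L (‖z‖ / (α * lam.toReal)) = ∅ := by
    refine Finset.eq_empty_of_forall_notMem fun p hp => ?_
    have hp := mem_puncturedBall.1 hp
    have h1 := systole_le L hp.1 hp.2.1
    have h2 := h1.trans hp.2.2
    rw [le_div_iff₀ (by positivity)] at h2
    linarith
  rw [density_eq_of_pos L h0.ne' ht.ne hα1, hemp, Finset.sum_empty, mul_zero]

end Density

/-! ### The error bound in the three regimes. -/

section ErrorTerm

variable {α A : ℝ} {f : ℂ → ℂ} {φ : ℕ → ℝ} {lam : ℝ≥0∞}

theorem eventually_regime {s c d : ℝ} (hα0 : 0 < α) (hα1 : α < 1) (hA : 0 < A) (hs : 0 < s)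
    (hc : 0 < c) (hd : 0 < d) : ∀ᶠ x in atTop, Regime α A s c d x := by
  have h1 : ∀ a b κ : ℝ, 0 < b → 0 < κ → ∀ᶠ x : ℝ in atTop, a / (x * b) ≤ κ := by
    intro a b κ hb hκ
    filter_upwards [eventually_ge_atTop (a / (κ * b)), eventually_gt_atTop 0] with x hx hx0
    rw [div_le_iff₀ (by positivity)] at hx ⊢
    linarith
  have hcα : 0 < c ^ α := by positivity
  filter_upwards [h1 A (c ^ α) (1 / 2) hcα (by norm_num), h1 A (c ^ α) (1 - α) hcα (by linarith),
    h1 A (c ^ α) (α / 4) hcα (by positivity), h1 A α (1 / 64) hα0 (by norm_num),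
    eventually_ge_atTop ((16 * d + 1) ^ (1 - α) * (4 * A) / (α * s)), eventually_gt_atTop 0]
    with x e1 e2 e3 e4 e5 e6
  refine ⟨hα0, hα1, hA, hs, hc, hd, e6, e1, e2, e3, by rwa [mul_comm], ?_⟩
  rw [div_le_iff₀ (by positivity)] at e5
  rw [le_div_iff₀ (by positivity)]
  linarith

theorem IsScaling.tendsto_ratio_toReal (h : IsScaling α φ lam) (ht : lam ≠ ⊤) :
    Tendsto (fun N : ℕ => φ N / (N : ℝ) ^ (1 - α)) atTop (𝓝 lam.toReal) := by
  have h1 := (ENNReal.tendsto_toReal ht).comp h.tendsto_ratio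
  refine h1.congr fun N => ?_
  have := (h.pos N).le
  exact ENNReal.toReal_ofReal (by positivity)

theorem c1Norm_bounds (hf : ContDiff ℝ 1 f) (hc : HasCompactSupport f)
    (hA : tsupport f ⊆ Metric.ball 0 A) :
    IsTest A (⨆ z, ‖f z‖) (⨆ z, ‖fderiv ℝ f z‖) f ∧ 0 ≤ ⨆ z, ‖fderiv ℝ f z‖ := by
  have hb0 : BddAbove (Set.range fun z => ‖f z‖) :=
    hf.continuous.norm.bddAbove_range_of_hasCompactSupport hc.norm
  have hb1 : BddAbove (Set.range fun z => ‖fderiv ℝ f z‖) :=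
    (hf.continuous_fderiv one_ne_zero).norm.bddAbove_range_of_hasCompactSupport
      (hc.fderiv (𝕜 := ℝ)).norm
  refine ⟨⟨fun z hz => ?_, fun z => le_ciSup hb0 z, fun x y => ?_⟩,
    Real.iSup_nonneg fun z => norm_nonneg _⟩
  · refine image_eq_zero_of_notMem_tsupport fun h => ?_
    have := hA h
    rw [mem_ball_zero_iff] at this
    linarith
  · exact Convex.norm_image_sub_le_of_norm_fderiv_le (𝕜 := ℝ) (s := Set.univ)
      (fun z _ => hf.differentiable one_ne_zero z) (fun z _ => le_ciSup hb1 z) convex_univ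
      (Set.mem_univ y) (Set.mem_univ x)

/-- Pairs near the cut are already counted through `badSet`, so this sign is all that the final
estimate needs. -/
theorem branchCutError_nonneg (h : IsScaling α φ lam) (hA : 0 ≤ A) (N N' N'' : ℕ) :
    0 ≤ branchCutError α φ lam A N N' N'' := by
  have := (h.pos N).le
  unfold branchCutError renorm
  split_ifs <;> positivity

variable {L : Submodule ℤ ℂ} [DiscreteTopology L] {Λ : Set ℂ}

/-- For `lam = ⊤`: once `P` is below the systole there is no displacement vector left, hence exact
vanishing and a zero error term. -/
theorem integral_empirical_eq_zero (hΛ : IsGrid L Λ) {s c d B₀ B₁ : ℝ} {N N' N'' : ℕ}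
    (hc : ∀ m ∈ Λ, m ≠ 0 → c ≤ ‖m‖) (h : Regime α A s c d (φ N)) (hf : IsTest A B₀ B₁ f)
    (hP : 4 * A / α / (φ N / (N : ℝ) ^ (1 - α)) < systole L) :
    ∫ z, f z ∂(empirical α Λ φ N N' N'') = 0 := by
  obtain ⟨z₀, hz₀⟩ := hΛ
  have hemp : puncturedBall L (4 * A / α / (φ N / (N : ℝ) ^ (1 - α))) = ∅ := by
    refine Finset.eq_empty_of_forall_notMem fun p hp => ?_
    have hp := mem_puncturedBall.1 hp
    linarith [systole_le L hp.1 hp.2.1, hp.2.2]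
  rw [integral_empirical ⟨z₀, hz₀⟩, (tsum_pairSet_eq hz₀ N N' N'' hc h hf).2, hemp]
  simp

theorem exists_levelError_bound [IsZLattice ℝ L] (hΛ : IsGrid L Λ) (hα0 : 0 < α) (hα1 : α < 1) :
    ∃ C : ℝ, 0 < C ∧ ∀ (φ : ℕ → ℝ) (lam : ℝ≥0∞), IsScaling α φ lam → ∀ A : ℝ, 1 < A →
      ∃ M : ℕ, ∀ f : ℂ → ℂ, ContDiff ℝ 1 f → HasCompactSupport f →
        tsupport f ⊆ Metric.ball 0 A →
      ∀ N N' N'' : ℕ, M ≤ min N (N' + N'') →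
        ‖∫ z, f z ∂(empirical α Λ φ N N' N'') - ∫ z, f z * (density α L lam z : ℂ)‖
          ≤ C * levelError α φ lam f A N N' N'' := by
  obtain ⟨C₁, c, d, hC₁, hc, hd, hcore⟩ := exists_core_estimate hΛ hα0 hα1
  obtain ⟨C₂, hC₂, hzero⟩ := exists_latticeSum_sub_integral_le (L := L) hα0 hα1
  obtain ⟨C₃, hC₃, hfinite⟩ := exists_latticeSum_sub_le (L := L) hα0
  obtain ⟨c', hc', hcmin⟩ := hΛ.exists_norm_ge
  have hs := systole_pos L
  refine ⟨2 * C₁ + C₂ + C₃, by positivity, fun φ lam hφ A hA => ?_⟩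
  have hA0 : 0 < A := by linarith
  have hev : ∀ᶠ N : ℕ in atTop, Regime α A (systole L) c d (φ N) ∧
      4 * A / α * (1 + d / systole L) ≤ φ N ∧ 0 < N :=
    (hφ.tendsto_atTop.eventually (eventually_regime hα0 hα1 hA0 hs hc hd)).and
      ((hφ.tendsto_atTop.eventually (eventually_ge_atTop _)).and (eventually_gt_atTop 0))
  by_cases ht : lam = ⊤
  · have hτ : Tendsto (fun N : ℕ => φ N / (N : ℝ) ^ (1 - α)) atTop atTop := by
      have := hφ.tendsto_ratio
      rw [ht] at this
      exact ENNReal.tendsto_ofReal_nhds_top.1 this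
    obtain ⟨M, hM⟩ := eventually_atTop.1
      ((hφ.tendsto_atTop.eventually (eventually_regime hα0 hα1 hA0 hs hc' hd)).and
      ((hτ.eventually (eventually_gt_atTop (4 * A / α / systole L))).and
        (hτ.eventually (eventually_gt_atTop 0))))
    refine ⟨M, fun f hf hfc hfA N N' N'' hN => ?_⟩
    obtain ⟨h1, h2, h3⟩ := hM N (hN.trans (min_le_left _ _))
    have hP : 4 * A / α / (φ N / (N : ℝ) ^ (1 - α)) < systole L := by
      rw [div_lt_iff₀ hs] at h2
      rw [div_lt_iff₀ h3]; linarith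
    rw [integral_empirical_eq_zero hΛ hcmin h1 (c1Norm_bounds hf hfc hfA).1 hP]
    simp [density, levelError, ht]
  have hτ := hφ.tendsto_ratio_toReal ht
  by_cases h0 : lam = 0
  · rw [h0, ENNReal.toReal_zero] at hτ
    obtain ⟨M, hM⟩ := eventually_atTop.1 (hev.and (hτ.eventually (eventually_le_nhds one_pos)))
    -- The thresholds involve `f` only through `A`, so `M` is uniform in `f`; the `1` guarantees `0
    -- < N' + N''`.
    refine ⟨max M 1, fun f hf hfc hfA N N' N'' hN => ?_⟩
    obtain ⟨⟨hreg, hwide, hN0⟩, hτ1⟩ := hM N (by omega)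
    obtain ⟨hT, hB₁⟩ := c1Norm_bounds hf hfc hfA
    have hφN := hφ.pos N
    have hN' : (0 : ℝ) < N := by exact_mod_cast hN0
    have hτ0 : 0 < φ N / (N : ℝ) ^ (1 - α) := by positivity
    have e1 := hcore φ A _ _ f N N' N'' hA.le hreg hwide hT hf.continuous.measurable hB₁ hN0
      (by omega)
    have e2 := hzero A _ _ f _ (4 * A / α / (φ N / (N : ℝ) ^ (1 - α))) hA.le hT hB₁ hτ0 hτ1
      (by
        rw [div_div]; gcongr; linarith)
    have hdens : ∫ z, f z * (density α L lam z : ℂ)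
        = ((Real.pi / (α ^ 2 * (2 - α) * ZLattice.covolume L ^ 2) : ℝ) : ℂ) * ∫ z, f z := by
      rw [← integral_const_mul]
      refine integral_congr_ae (ae_of_all _ fun z => ?_)
      simp only [density, if_neg ht, if_pos h0]
      ring
    rw [hdens]
    rw [levelError, if_neg ht, if_pos h0]
    refine (norm_sub_le_norm_sub_add_norm_sub _ _ _).trans ((add_le_add e1 e2).trans ?_)
    have hB₀ : 0 ≤ ⨆ z, ‖f z‖ := Real.iSup_nonneg fun z => norm_nonneg _
    change _ ≤ (2 * C₁ + C₂ + C₃) * (A ^ 4 * ((⨆ z, ‖f z‖) + ⨆ z, ‖fderiv ℝ f z‖) * _)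
    set B := (⨆ z, ‖f z‖) + ⨆ z, ‖fderiv ℝ f z‖
    set x := 1 / ((N : ℝ) ^ α * φ N)
    set y := 1 / ((N' : ℝ) + N'')
    set t := φ N / (N : ℝ) ^ (1 - α)
    have hx : 0 ≤ x := by positivity
    have hy : 0 ≤ y := by positivity
    have hB : 0 ≤ B := by positivity
    have hA24 : A ^ 2 ≤ A ^ 4 := pow_le_pow_right₀ hA.le (by norm_num)
    calc C₁ * B * (A ^ 4 * x + A ^ 2 * y) + C₂ * B * (A ^ 2 * t)
        ≤ (2 * C₁ + C₂ + C₃) * B * (A ^ 4 * x + A ^ 4 * y)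
          + (2 * C₁ + C₂ + C₃) * B * (A ^ 4 * t) := by
          gcongr <;> linarith
      _ = _ := by ring
  · have hl : 0 < lam.toReal := ENNReal.toReal_pos h0 ht
    have hε : Tendsto (fun N : ℕ => |φ N / (N : ℝ) ^ (1 - α) / lam.toReal - 1|) atTop (𝓝 0) := by
      have := ((hτ.div_const lam.toReal).sub_const 1).abs
      rwa [div_self hl.ne', sub_self, abs_zero] at this
    obtain ⟨M, hM⟩ := eventually_atTop.1 (hev.and (hε.eventually
      (eventually_le_nhds (show (0 : ℝ) < 1 / 2 by norm_num))))
    refine ⟨max M 1, fun f hf hfc hfA N N' N'' hN => ?_⟩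
    obtain ⟨⟨hreg, hwide, hN0⟩, hε1⟩ := hM N (by omega)
    obtain ⟨hT, hB₁⟩ := c1Norm_bounds hf hfc hfA
    have hφN := hφ.pos N
    have hN' : (0 : ℝ) < N := by exact_mod_cast hN0
    set l := lam.toReal with hldef
    set t := φ N / (N : ℝ) ^ (1 - α) with htdef
    have ht0 : 0 < t := by positivity
    have ht1 : l / 2 ≤ t := by
      have := (abs_le.1 hε1).1
      have h1 : 1 / 2 ≤ t / l := by linarith
      rw [le_div_iff₀ hl] at h1; linarith
    have ht2 : t ≤ 3 / 2 * l := by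
      have := (abs_le.1 hε1).2
      have h1 : t / l ≤ 3 / 2 := by linarith
      rwa [div_le_iff₀ hl] at h1
    -- The radius attached to `t` still covers the support at scale `l`, and by `hRu` it is not much
    -- larger, so one radius serves both lattice sums.
    have hRl : A / (α * l) ≤ 4 * A / α / t := by
      rw [div_div, div_le_div_iff₀ (by positivity) (by positivity)]
      have : A * α * t ≤ A * α * (3 / 2 * l) := by gcongr
      have : 0 < A * α * l := by positivity
      nlinarith
    have hRu : 4 * A / α / t ≤ 8 * A / (α * l) := by
      rw [div_div, div_le_div_iff₀ (by positivity) (by positivity)]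
      have : A * α * (l / 2) ≤ A * α * t := by gcongr
      nlinarith
    have e1 := hcore φ A _ _ f N N' N'' hA.le hreg hwide hT hf.continuous.measurable hB₁ hN0
      (by omega)
    have e2 := hfinite A _ _ f t l (4 * A / α / t) hA.le hα1 hT hB₁ hl hε1 (by positivity) hRu
    rw [integral_mul_density_eq_latticeSum L hα0 hα1 h0 ht hT hB₁ hRl]
    rw [levelError, if_neg ht, if_neg h0]
    refine (norm_sub_le_norm_sub_add_norm_sub _ _ _).trans ((add_le_add e1 e2).trans ?_)
    have hB₀ : 0 ≤ ⨆ z, ‖f z‖ := Real.iSup_nonneg fun z => norm_nonneg _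
    change _ ≤ (2 * C₁ + C₂ + C₃) * (((⨆ z, ‖f z‖) + ⨆ z, ‖fderiv ℝ f z‖) * _ * _)
    set B := (⨆ z, ‖f z‖) + ⨆ z, ‖fderiv ℝ f z‖
    have hB : 0 ≤ B := by positivity
    have hβ : 0 < 1 - α := by linarith
    have hx1 : 1 / ((N : ℝ) ^ α * φ N) ≤ 2 * (1 / l) * (1 / N) := by
      have h1 : (N : ℝ) ^ α * φ N = t * N := by
        have : (N : ℝ) = N ^ α * (N : ℝ) ^ (1 - α) := by
          rw [← Real.rpow_add hN']; simp
        rw [htdef, div_mul_eq_mul_div, eq_div_iff (by positivity)]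
        conv_rhs => rw [this]
        ring
      rw [h1]
      calc 1 / (t * N) ≤ 1 / (l / 2 * N) := by gcongr
        _ = _ := by field_simp
    have hE : |φ N / (l * (N : ℝ) ^ (1 - α)) - 1| = |t / l - 1| := by
      rw [htdef, div_div, mul_comm l]
    rw [hE]
    set W := (l + 1 / l) ^ ((10 - 8 * α) / (1 - α)) with hW
    have hbase : 1 ≤ l + 1 / l := by
      rcases le_total 1 l with h | h
      · have : 0 < 1 / l := by positivity
        linarith
      · have : 1 ≤ 1 / l := by rwa [le_div_iff₀ hl, one_mul]
        linarith
    -- Only `W ≥ 1` and `W ≥ 1 / l` are needed, and the exponent exceeds `1`; likewise `A ^ 3` is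
    -- smaller than the stated power of `A`.
    have hW2 : l + 1 / l ≤ W := by
      refine Real.self_le_rpow_of_one_le hbase ?_
      rw [le_div_iff₀ hβ]; linarith
    have hW1 : 1 ≤ W := hbase.trans hW2
    have hWl : 1 / l ≤ W := by linarith
    have hA3 : A ^ 3 ≤ A ^ ((8 - 6 * α) / (1 - α)) := by
      rw [← Real.rpow_natCast]
      refine Real.rpow_le_rpow_of_exponent_le hA.le ?_
      rw [le_div_iff₀ hβ]; push_cast; linarith
    set Y := A ^ ((8 - 6 * α) / (1 - α))
    set y := 1 / ((N' : ℝ) + N'') with hy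
    set e := |t / l - 1|
    have hy0 : 0 ≤ y := by positivity
    have he0 : 0 ≤ e := abs_nonneg _
    have hy' : A ^ 2 / ((N' : ℝ) + N'') = A ^ 2 * y := by rw [hy]; ring
    rw [hy']
    calc C₁ * B * (A ^ 4 * (1 / ((N : ℝ) ^ α * φ N)) + A ^ 2 * y) + C₃ * B * (A ^ 3 * e)
        ≤ C₁ * B * (A ^ 4 * (2 * W * (1 / N)) + A ^ 2 * (W * y))
          + C₃ * B * (Y * (W * e)) := by
          gcongr
          · exact hx1.trans (by gcongr)
          · exact le_mul_of_one_le_left hy0 hW1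
          · exact le_mul_of_one_le_left he0 hW1
      _ = (2 * C₁) * (B * W * (A ^ 4 / N)) + C₁ * (B * W * (A ^ 2 * y))
          + C₃ * (B * W * (Y * e)) := by ring
      _ ≤ (2 * C₁ + C₂ + C₃) * (B * W * (A ^ 4 / N))
          + (2 * C₁ + C₂ + C₃) * (B * W * (A ^ 2 * y))
          + (2 * C₁ + C₂ + C₃) * (B * W * (Y * e)) := by
          gcongr <;> linarith
      _ = _ := by ring

end ErrorTerm

/-! ### From `C¹` test functions to vague convergence. -/

section Vague

variable {α A : ℝ} {f : ℂ → ℂ} {φ : ℕ → ℝ} {lam : ℝ≥0∞}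

theorem tendsto_min_minFilter :
    Tendsto (fun q : ℕ × ℕ × ℕ => min q.1 (q.2.1 + q.2.2)) minFilter atTop := tendsto_comap

theorem tendsto_fst_minFilter : Tendsto (fun q : ℕ × ℕ × ℕ => q.1) minFilter atTop :=
  tendsto_atTop_mono (fun _ => min_le_left _ _) tendsto_min_minFilter

theorem tendsto_inv_height_minFilter :
    Tendsto (fun q : ℕ × ℕ × ℕ => 1 / ((q.2.1 : ℝ) + q.2.2)) minFilter (𝓝 0) := by
  have h1 : Tendsto (fun q : ℕ × ℕ × ℕ => q.2.1 + q.2.2) minFilter atTop :=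
    tendsto_atTop_mono (fun _ => min_le_right _ _) tendsto_min_minFilter
  have h2 := (tendsto_one_div_atTop_nhds_zero_nat (𝕜 := ℝ)).comp h1
  refine h2.congr fun q => ?_
  simp

theorem tendsto_levelError (hα0 : 0 < α) (h : IsScaling α φ lam) (f : ℂ → ℂ) (A : ℝ) :
    Tendsto (fun q : ℕ × ℕ × ℕ => levelError α φ lam f A q.1 q.2.1 q.2.2) minFilter (𝓝 0) := by
  have hH := tendsto_inv_height_minFilter
  have hN : Tendsto (fun q : ℕ × ℕ × ℕ => 1 / (q.1 : ℝ)) minFilter (𝓝 0) :=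
    (tendsto_one_div_atTop_nhds_zero_nat (𝕜 := ℝ)).comp tendsto_fst_minFilter
  by_cases ht : lam = ⊤
  · simp only [levelError, if_pos ht]; exact tendsto_const_nhds
  have hτ := (h.tendsto_ratio_toReal ht).comp tendsto_fst_minFilter
  by_cases h0 : lam = 0
  · rw [h0, ENNReal.toReal_zero] at hτ
    have hx : Tendsto (fun N : ℕ => 1 / ((N : ℝ) ^ α * φ N)) atTop (𝓝 0) := by
      have h1 : Tendsto (fun N : ℕ => (N : ℝ) ^ α * φ N) atTop atTop :=
        ((tendsto_rpow_atTop hα0).comp tendsto_natCast_atTop_atTop).atTop_mul_atTop₀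
          h.tendsto_atTop
      simp only [one_div]
      exact h1.inv_tendsto_atTop
    have hx' := hx.comp tendsto_fst_minFilter
    have := ((hτ.add hx').add hH).const_mul (A ^ 4 * c1Norm f)
    simp only [add_zero, mul_zero] at this
    simp only [levelError, if_neg ht, if_pos h0]
    exact this
  · have hl : 0 < lam.toReal := ENNReal.toReal_pos h0 ht
    have hε := ((hτ.div_const lam.toReal).sub_const 1).abs
    rw [div_self hl.ne', sub_self, abs_zero] at hε
    have := (((hε.const_mul (A ^ ((8 - 6 * α) / (1 - α)))).add (hN.const_mul (A ^ 4))).add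
      (hH.const_mul (A ^ 2))).const_mul
        (c1Norm f * (lam.toReal + 1 / lam.toReal) ^ ((10 - 8 * α) / (1 - α)))
    simp only [add_zero, mul_zero] at this
    simp only [levelError, if_neg ht, if_neg h0]
    refine this.congr fun q => ?_
    simp only [Function.comp]
    rw [div_div, mul_comm lam.toReal, mul_one_div, mul_one_div]

/-- Vague convergence follows from convergence on `C¹` test functions. -/
theorem tendsto_integral_of_contDiff {ι : Type*} {l : Filter ι} {μ : ι → Measure ℂ} {ν : Measure ℂ}
    [∀ i, IsLocallyFiniteMeasure (μ i)] [IsLocallyFiniteMeasure ν]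
    (h : ∀ g : ℂ → ℂ, ContDiff ℝ 1 g → HasCompactSupport g →
      Tendsto (fun i => ∫ z, g z ∂(μ i)) l (𝓝 (∫ z, g z ∂ν)))
    {f : ℂ → ℂ} (hf : Continuous f) (hfc : HasCompactSupport f) :
    Tendsto (fun i => ∫ z, f z ∂(μ i)) l (𝓝 (∫ z, f z ∂ν)) := by
  obtain ⟨R, hR0, hR⟩ : ∃ R : ℝ, 0 < R ∧ tsupport f ⊆ Metric.closedBall 0 R := by
    obtain ⟨R, hR⟩ := hfc.isCompact.isBounded.subset_closedBall 0
    exact ⟨max R 1, by positivity, hR.trans (Metric.closedBall_subset_closedBall (le_max_left _ _))⟩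
  let χ : ContDiffBump (0 : ℂ) := ⟨R, R + 1, hR0, by linarith⟩
  have hχc : HasCompactSupport (χ : ℂ → ℝ) := χ.hasCompactSupport
  have hχ1 : ∀ z ∈ tsupport f, χ z = 1 := fun z hz => χ.one_of_mem_closedBall (hR hz)
  set X : ℂ → ℂ := fun z => (χ z : ℂ) with hX
  have hXd : ContDiff ℝ 1 X := Complex.ofRealCLM.contDiff.comp χ.contDiff
  have hXc : HasCompactSupport X := hχc.comp_left Complex.ofReal_zero
  have hbound : ∀ (m : Measure ℂ) [IsLocallyFiniteMeasure m] (δ : ℝ) (g : ℂ → ℂ), 0 < δ →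
      Continuous g → Function.support g ⊆ Function.support f → (∀ z, dist (g z) (f z) < δ) →
      ‖(∫ z, f z ∂m) - ∫ z, g z ∂m‖ ≤ δ * ∫ z, χ z ∂m := by
    intro m _ δ g hδ hg hgs hgf
    have hgc : HasCompactSupport g := hfc.mono hgs
    rw [← integral_sub (hf.integrable_of_hasCompactSupport hfc)
      (hg.integrable_of_hasCompactSupport hgc), ← integral_const_mul]
    refine norm_integral_le_of_norm_le
      ((χ.continuous.integrable_of_hasCompactSupport hχc).const_mul δ) (ae_of_all _ fun z => ?_)
    by_cases hz : z ∈ tsupport f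
    · rw [hχ1 z hz, mul_one, ← dist_eq_norm, dist_comm]
      exact (hgf z).le
    · have h1 : f z = 0 := image_eq_zero_of_notMem_tsupport hz
      have h2 : g z = 0 := by
        by_contra h2
        exact (hgs h2) h1
      rw [h1, h2, sub_zero, norm_zero]
      exact mul_nonneg hδ.le χ.nonneg
  set M := ∫ z, χ z ∂ν with hM
  have hM0 : 0 ≤ M := integral_nonneg fun z => χ.nonneg
  -- The bump function is itself an admissible test function, so the masses near the support of `f`
  -- are eventually bounded.
  have hmass : ∀ᶠ i in l, ∫ z, χ z ∂(μ i) ≤ M + 1 := by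
    have h1 := Complex.continuous_re.continuousAt.tendsto.comp (h X hXd hXc)
    have h2 : ∀ m : Measure ℂ, (∫ z, X z ∂m).re = ∫ z, χ z ∂m := by
      intro m
      rw [hX, integral_complex_ofReal, Complex.ofReal_re]
    simp only [Function.comp_def, h2] at h1
    exact h1.eventually (eventually_le_nhds (by linarith))
  rw [Metric.tendsto_nhds]
  intro ε hε
  -- The three differences cost `δ(M + 1)`, `δ` and `δM`, in total `ε / 2`.
  set δ := ε / (2 * (2 * M + 2)) with hδ
  have hδ0 : 0 < δ := by positivity
  obtain ⟨g, hg, hgf, hgs⟩ := hf.exists_contDiff_approx (ε := fun _ => δ) 1 continuous_const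
    (fun _ => hδ0)
  have hgc : HasCompactSupport g := hfc.mono hgs
  filter_upwards [hmass, Metric.tendsto_nhds.1 (h g (by exact_mod_cast hg) hgc) δ hδ0]
    with i hi1 hi2
  have e1 := hbound (μ i) δ g hδ0 hg.continuous hgs hgf
  have e2 := hbound ν δ g hδ0 hg.continuous hgs hgf
  rw [dist_eq_norm] at hi2 ⊢
  have e3 : (∫ z, f z ∂(μ i)) - ∫ z, f z ∂ν = ((∫ z, f z ∂(μ i)) - ∫ z, g z ∂(μ i))
      + ((∫ z, g z ∂(μ i)) - ∫ z, g z ∂ν) - ((∫ z, f z ∂ν) - ∫ z, g z ∂ν) := by ring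
  have e4 : δ * ∫ z, χ z ∂(μ i) ≤ δ * (M + 1) := by gcongr
  have e5 : δ * (2 * M + 2) = ε / 2 := by rw [hδ]; field_simp
  calc _ ≤ ‖(∫ z, f z ∂(μ i)) - ∫ z, g z ∂(μ i)‖ + ‖(∫ z, g z ∂(μ i)) - ∫ z, g z ∂ν‖
        + ‖(∫ z, f z ∂ν) - ∫ z, g z ∂ν‖ := by
        rw [e3]
        exact (norm_sub_le _ _).trans (add_le_add_left (norm_add_le _ _) _)
    _ < ε := by linarith

theorem vagueTendsto_empirical {L : Submodule ℤ ℂ} [DiscreteTopology L] [IsZLattice ℝ L]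
    {Λ : Set ℂ} (hΛ : IsGrid L Λ) (hα0 : 0 < α) (hα1 : α < 1) (h : IsScaling α φ lam) :
    VagueTendsto minFilter (fun q => empirical α Λ φ q.1 q.2.1 q.2.2) (limitMeasure α L lam) := by
  have h1 : ∀ q : ℕ × ℕ × ℕ, IsLocallyFiniteMeasure (empirical α Λ φ q.1 q.2.1 q.2.2) := fun q =>
    have := isFiniteMeasure_empirical hΛ α φ q.1 q.2.1 q.2.2
    inferInstance
  have h2 := isLocallyFiniteMeasure_limitMeasure L hα0 hα1 lam
  refine ⟨h1, h2, fun f hf hfc => tendsto_integral_of_contDiff (fun g hg hgc => ?_) hf hfc⟩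
  obtain ⟨C, -, hC⟩ := exists_levelError_bound hΛ hα0 hα1
  obtain ⟨R, hR⟩ := hgc.isCompact.isBounded.subset_ball 0
  -- The radius is enlarged to meet the requirement `1 < A`.
  obtain ⟨M, hM⟩ := hC φ lam h (max R 2) (lt_max_of_lt_right one_lt_two)
  have h3 := (tendsto_levelError hα0 h g (max R 2)).const_mul C
  rw [mul_zero] at h3
  rw [integral_limitMeasure L hα0 hα1, tendsto_iff_norm_sub_tendsto_zero]
  refine squeeze_zero' (Eventually.of_forall fun _ => norm_nonneg _) ?_ h3
  filter_upwards [tendsto_min_minFilter.eventually (eventually_ge_atTop M)] with q hq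
  exact hM g hg hgc (hR.trans (Metric.ball_subset_ball (le_max_left _ _))) q.1 q.2.1 q.2.2 hq

end Vague

end PairCorr

end

theorem mainTheorem2 (α : ℝ) (hα₀ : 0 < α) (hα₁ : α < 1)
    (L : Submodule ℤ ℂ) [DiscreteTopology L] [IsZLattice ℝ L]
    (Λ : Set ℂ) (hΛ : PairCorr.IsGrid L Λ) :
    -- vague convergence to the limit density
    (∀ (φ : ℕ → ℝ) (lam : ℝ≥0∞), PairCorr.IsScaling α φ lam →
      PairCorr.VagueTendsto PairCorr.minFilter
        (fun q => PairCorr.empirical α Λ φ q.1 q.2.1 q.2.2)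
        (PairCorr.limitMeasure α L lam)) ∧
    -- level repulsion in the exotic case
    (∀ lam : ℝ≥0∞, 0 < lam → lam < ⊤ → 0 < α * lam.toReal * PairCorr.systole L ∧
      ∀ z : ℂ, ‖z‖ < α * lam.toReal * PairCorr.systole L →
        PairCorr.density α L lam z = 0) ∧
    -- error term: `C` depends only on `α` and `Λ`, and the rank `M` does not depend on `f`
    (∃ C : ℝ, 0 < C ∧
      ∀ (φ : ℕ → ℝ) (lam : ℝ≥0∞), PairCorr.IsScaling α φ lam → ∀ A : ℝ, 1 < A →
      ∃ M : ℕ, ∀ f : ℂ → ℂ, ContDiff ℝ 1 f → HasCompactSupport f →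
        tsupport f ⊆ Metric.ball 0 A →
      ∀ N N' N'' : ℕ, M ≤ min N (N' + N'') →
        ‖∫ z, f z ∂(PairCorr.empirical α Λ φ N N' N'')
            - ∫ z, f z * (PairCorr.density α L lam z : ℂ)‖
          ≤ C * (PairCorr.levelError α φ lam f A N N' N''
              + PairCorr.branchCutError α φ lam A N N' N'')) := by
  refine ⟨fun φ lam h => PairCorr.vagueTendsto_empirical hΛ hα₀ hα₁ h,
    fun lam h0 ht => PairCorr.level_repulsion L hα₀ hα₁ h0 ht, ?_⟩
  obtain ⟨C, hC0, hC⟩ := PairCorr.exists_levelError_bound hΛ hα₀ hα₁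
  refine ⟨C, hC0, fun φ lam h A hA => ?_⟩
  obtain ⟨M, hM⟩ := hC φ lam h A hA
  refine ⟨M, fun f hf hfc hfA N N' N'' hN => (hM f hf hfc hfA N N' N'' hN).trans ?_⟩
  have := PairCorr.branchCutError_nonneg h (zero_lt_one.trans hA).le N N' N''
  exact mul_le_mul_of_nonneg_left (by linarith) hC0.le
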